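/- **Setting.** All bit strings are over $\{0,1\}$; $\Delta(P,Q)=\frac12\sum_a|P(a)-Q(a)|$ is the total variation distance. For $M\ge 1$ let $B_M$ be the balanced (complete) binary tree with vertices $v_0,\dots,v_{M-1}$ numbered level by level, with root $v_0$, and let $e_i$ be the edge joining $v_i$ ($i\ge1$) to its parent $v_{\lfloor (i-1)/2\rfloor}$. For $d\in\{0,1\}^{M-1}$ let $h(d)_i$ be the parity of the bits $d_j$ over the edges $e_j$ on the path from $v_0$ to $v_i$. For a prime $p$ and $a\in\mathbb Z$ let $\mathrm{MM}_p(a)=0$ if the residue of $a$ modulo $p$ in $\{0,\dots,p-1\}$ is $<p/2$, and $\mathrm{MM}_p(a)=1$ otherwise. For $z=(d,x)$ with $d,x\in\{0,1\}^{M-1}$ put $$\mathrm{pmmajmod}_p(z)=\mathrm{MM}_p\Big(\sum_{i=1}^{M-1}x_i(-1)^{h(d)_i}\Big)\oplus\bigoplus_{i=1}^{M-1}x_i .$$ This defines $\mathrm{pmmajmod}_p$ on strings of even length $N=2M-2$; on strings of odd length $N$ it is defined by ignoring the last bit. **Theorem.** For each $\delta<1$ there are $\alpha$ with $\max(0,\delta/3)<\alpha<1/3$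 and primes $p_n=\Theta(n^\alpha)$ such that the distributions $D_n$ ($n\ge1$) on $\{0,1\}^n$, where $D_n$ is the law of $(Z,\mathrm{pmmajmod}_{p_n}(Z))$ with $Z$ uniform on $\{0,1\}^{n-1}$, have the following two properties. 1. There is a uniform family of constant-depth quantum circuits $\{C_n\}$, with $C_n$ acting on $n$ qubits, such that measuring $C_n|0^n\rangle$ in the computational basis produces a distribution with $$\Delta(C_n,D_n)\le \frac12-\frac1\pi+O(n^{-\alpha}).$$ The gates used are $H$, $e^{-i\pi X/4}$, CNOT, SWAP, and the adjoints of the $m$-qubit unitaries $U_{m,\theta}$ with $m$ bounded by a constant and $\theta=\pi/q$, $q\ge3$ an integer. Here $U_{m,\theta}$ is the Gram–Schmidt orthonormalization (strings with first bit $0$ first) of the columns $M|x_1\cdots x_m\rangle=\bigotimes_{j=1}^m e^{-i\theta x_{j-1}X}|x_j\rangle$, $x_0:=x_m$, that is: $U_{m,\theta}|x\rangle=M|x\rangle$ if $x_1=0$, and $U_{m,\theta}|x\rangle=(1-|r|^2)^{-1/2}(M|x\rangle-r\,M|\overline x\rangle)$ with $r=\langle\overline x|M^\dagger M|x\rangle$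 if $x_1=1$. Uniform means that one program, given $n$, writes down the description of $C_n$ (the list of layers, each a list of gates with their parameters $m,q$ and their qubits) in time polynomial in $n$. 2. There is a constant $c>0$ such that for every function $g$ with $g(n)=\omega(1/\log n)$ and all sufficiently large $n$: every classical circuit with gates of fan-in 2 that takes $\ell\le n+n^\delta$ uniformly random bits as input and whose $n$-bit output distribution has total variation distance at most $\frac12-g(n)$ from $D_n$ has depth at least $c\log\log n$. -/

import Mathlib

open Filter Asymptotics

noncomputable section

/-! ## Distributions on bit strings -/

/-- Total variation distance of two probability mass functions on a finite set. -/
def tvDist {A : Type*} [Fintype A] (P Q : A → ℝ) : ℝ :=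
  (1 / 2) * ∑ a, |P a - Q a|

/-! ## The target distribution -/

/-- The `k`-th bit of a bit string (`false` past its end). -/
def bitAt {N : ℕ} (z : Fin N → Bool) (k : ℕ) : Bool :=
  if h : k < N then z ⟨k, h⟩ else false

/-- The balanced binary tree has vertices `v_0, v_1, …` numbered level by level, with root `v_0`;
for `k ≥ 0` the parent of `v_{k+1}` is `v_{⌊k/2⌋}`, and `e_{k+1}` is the edge joining the two.
Here `d k` is the bit on the edge `e_{k+1}`, and `pathParity d i` is the parity of the bits on
the path from `v_0` to `v_i`. -/
def pathParity (d : ℕ → Bool) : ℕ → Bool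
  | 0 => false
  | k + 1 => xor (d k) (pathParity d (k / 2))
decreasing_by omega

/-- `MM_p(a)` is `0` if the residue of `a` modulo `p` in `{0, …, p-1}` is less than `p / 2`,
and `1` otherwise. -/
def majMod (p : ℕ) (a : ℤ) : Bool :=
  decide ((p : ℤ) ≤ 2 * (a % (p : ℤ)))

/-- The bit `d_{k+1}` of `z = (d, x)`, attached to the edge `e_{k+1}`, for `k < N / 2`. -/
def edgeBit {N : ℕ} (z : Fin N → Bool) (k : ℕ) : Bool := bitAt z k

/-- The bit `x_{k+1}` of `z = (d, x)`, attached to the vertex `v_{k+1}`, for `k < N / 2`. -/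
def vertexBit {N : ℕ} (z : Fin N → Bool) (k : ℕ) : Bool := bitAt z (N / 2 + k)

/-- The signed sum `∑_{i ≥ 1} x_i (-1)^{h(d)_i}` over the non-root vertices of the balanced binary
tree with `N / 2 + 1` vertices. -/
def signedSum {N : ℕ} (z : Fin N → Bool) : ℤ :=
  ∑ k ∈ Finset.range (N / 2),
    if vertexBit z k then (if pathParity (edgeBit z) (k + 1) then -1 else 1) else 0

/-- The parity of the vertex bits. -/
def vertexParity {N : ℕ} (z : Fin N → Bool) : Bool :=
  decide (Odd ((Finset.range (N / 2)).filter (fun k => vertexBit z k = true)).card)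

/-- `pmmajmod_p` on `N` bits. The first `⌊N/2⌋` bits are the edge bits `d`, the next `⌊N/2⌋` bits
are the vertex bits `x`; if `N` is odd, the last bit is ignored. -/
def pmmajmod (p : ℕ) {N : ℕ} (z : Fin N → Bool) : Bool :=
  xor (majMod p (signedSum z)) (vertexParity z)

/-- The law of `(Z, pmmajmod_p(Z))` for `Z` uniform on `N` bits: a distribution on `N + 1` bits. -/
def targetDist (p N : ℕ) : (Fin (N + 1) → Bool) → ℝ := fun a =>
  if a (Fin.last N) = pmmajmod p (fun i : Fin N => a i.castSucc) then 1 / 2 ^ N else 0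

/-! ## Classical circuits of fan-in two -/

/-- A gate computing an arbitrary Boolean function of the wires `left` and `right`. -/
structure BoolGate where
  op : Bool → Bool → Bool
  left : ℕ
  right : ℕ

/-- A Boolean circuit of fan-in two (and unbounded fan-out) with `l` inputs and `n` outputs. The
wires are numbered: first the inputs, then the outputs of the gates in the order of the list, so a
gate reads inputs and outputs of earlier gates; a wire that does not exist yet is constantly
`false`. -/
structure BoolCircuit (l n : ℕ) where
  gates : List BoolGate
  out : Fin n → ℕ

namespace BoolCircuit

variable {l n : ℕ}

/-- The values of all the wires. -/
def wireValues (C : BoolCircuit l n) (u : Fin l → Bool) : List Bool :=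
  C.gates.foldl (fun v g => v ++ [g.op (v.getD g.left false) (v.getD g.right false)])
    (List.ofFn u)

/-- The depths of all the wires: inputs have depth `0`, and a gate lies one level above the deeper
of the two wires that it reads. -/
def wireDepths (C : BoolCircuit l n) : List ℕ :=
  C.gates.foldl (fun v g => v ++ [max (v.getD g.left 0) (v.getD g.right 0) + 1])
    (List.replicate l 0)

/-- The function computed by the circuit. -/
def eval (C : BoolCircuit l n) (u : Fin l → Bool) : Fin n → Bool := fun i =>
  (C.wireValues u).getD (C.out i) false

/-- The depth: the largest number of gates on a path from an input to an output. -/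
def depth (C : BoolCircuit l n) : ℕ :=
  Finset.univ.sup fun i => C.wireDepths.getD (C.out i) 0

/-- The output distribution on uniformly random input bits. -/
def outDist (C : BoolCircuit l n) : (Fin n → Bool) → ℝ := fun a =>
  ((Finset.univ.filter fun u => C.eval u = a).card : ℝ) / 2 ^ l

end BoolCircuit

/-! ## Quantum circuits -/

/-- The matrix of `exp(-iφX) = cos φ - i (sin φ) X`. -/
def rotX (φ : ℝ) : Matrix Bool Bool ℂ :=
  Matrix.of fun a b => if a = b then (Real.cos φ : ℂ) else -Complex.I * (Real.sin φ : ℂ)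

/-- Hadamard gate. -/
def hadMatrix : Matrix (Fin 1 → Bool) (Fin 1 → Bool) ℂ :=
  Matrix.of fun a b => (if a 0 && b 0 then -1 else 1) / (Real.sqrt 2 : ℂ)

/-- The one-qubit rotation `exp(-iπX/4)`. -/
def rotMatrix : Matrix (Fin 1 → Bool) (Fin 1 → Bool) ℂ :=
  Matrix.of fun a b => rotX (Real.pi / 4) (a 0) (b 0)

/-- CNOT gate, with control `0` and target `1`. -/
def cnotMatrix : Matrix (Fin 2 → Bool) (Fin 2 → Bool) ℂ :=
  Matrix.of fun a b => if a = ![b 0, xor (b 0) (b 1)] then 1 else 0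

/-- SWAP gate. -/
def swapMatrix : Matrix (Fin 2 → Bool) (Fin 2 → Bool) ℂ :=
  Matrix.of fun a b => if a = ![b 1, b 0] then 1 else 0

/-- The vector `M|x⟩ = ⨂_j exp(-iθ x_{j-1} X)|x_j⟩`, where `M` is the (non-unitary) matrix in which
each qubit controls an `X`-rotation of its cyclic successor (indices modulo `m + 1`). -/
def shiftRot {m : ℕ} (θ : ℝ) (x : Fin (m + 1) → Bool) : (Fin (m + 1) → Bool) → ℂ := fun y =>
  ∏ j, rotX (if x (j - 1) then θ else 0) (y j) (x j)

/-- The vector `U_{m+1,θ}|x⟩`. The matrix `U_{m+1,θ}` is the Gram-Schmidt orthonormalization of the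
columns `M|x⟩` of the matrix `M` of `shiftRot`, the strings with first bit `0` coming first:
the vectors `M|x⟩` are unit vectors, and `M|x⟩`, `M|y⟩` are orthogonal unless `y = x` or
`y` is the complement of `x`. -/
def blockColumn {m : ℕ} (θ : ℝ) (x : Fin (m + 1) → Bool) : (Fin (m + 1) → Bool) → ℂ :=
  let v := shiftRot θ x
  let v' := shiftRot θ (fun j => !(x j))
  let r : ℂ := ∑ y, star (v' y) * v y
  if x 0 then ((1 / Real.sqrt (1 - ‖r‖ ^ 2) : ℝ) : ℂ) • (v - r • v') else v

/-- The matrix of the adjoint of `U_{m+1,θ}`. -/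
def blockMatrix (m : ℕ) (θ : ℝ) : Matrix (Fin (m + 1) → Bool) (Fin (m + 1) → Bool) ℂ :=
  Matrix.of fun x y => star (blockColumn θ x y)

/-- The matrix `G ⊗ I` on `n` qubits, where `G` acts on the distinct qubits `w 0, …, w (k-1)`. -/
def onWires {k n : ℕ} (G : Matrix (Fin k → Bool) (Fin k → Bool) ℂ) (w : Fin k → Fin n) :
    Matrix (Fin n → Bool) (Fin n → Bool) ℂ :=
  open Classical in
  Matrix.of fun x y =>
    if ∀ i, (∀ j, w j ≠ i) → x i = y i then G (fun j => x (w j)) (fun j => y (w j)) else 0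

/-- The gates, on `n` qubits: Hadamard, `exp(-iπX/4)`, CNOT, SWAP, and the adjoint of the
`(m+1)`-qubit unitary `U_{m+1,π/q}`. -/
inductive QGate (n : ℕ) where
  | had (i : Fin n)
  | rot (i : Fin n)
  | cnot (c t : Fin n)
  | swap (i j : Fin n)
  | block (m q : ℕ) (w : Fin (m + 1) → Fin n)

namespace QGate

variable {n : ℕ}

/-- The qubits on which a gate acts. -/
def wires : QGate n → List (Fin n)
  | had i => [i]
  | rot i => [i]
  | cnot c t => [c, t]
  | swap i j => [i, j]
  | block _ _ w => List.ofFn w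

/-- The matrix of a gate on all `n` qubits. -/
def toMatrix : QGate n → Matrix (Fin n → Bool) (Fin n → Bool) ℂ
  | had i => onWires hadMatrix ![i]
  | rot i => onWires rotMatrix ![i]
  | cnot c t => onWires cnotMatrix ![c, t]
  | swap i j => onWires swapMatrix ![i, j]
  | block m q w => onWires (blockMatrix m (Real.pi / q)) w

/-- A gate acts on distinct qubits, and a gate `U_{m+1,π/q}` has `q ≥ 3` (so that it is
unitary). -/
def IsValid (g : QGate n) : Prop :=
  g.wires.Nodup ∧
    match g with
    | block _ q _ => 3 ≤ q
    | _ => True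

end QGate

/-- A quantum circuit on `n` qubits: a list of layers, each of which is a list of gates. -/
abbrev QCircuit (n : ℕ) := List (List (QGate n))

namespace QCircuit

variable {n : ℕ}

/-- All gates are valid, and the gates of one layer act on pairwise disjoint sets of qubits. -/
def IsValid (C : QCircuit n) : Prop :=
  ∀ layer ∈ C, (∀ g ∈ layer, g.IsValid) ∧
    layer.Pairwise fun g g' => List.Disjoint g.wires g'.wires

/-- The depth is the number of layers. -/
def depth (C : QCircuit n) : ℕ := C.length

/-- The state produced by the circuit on input `|0…0⟩`. -/
def finalState (C : QCircuit n) : (Fin n → Bool) → ℂ :=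
  C.foldl (fun ψ layer => layer.foldl (fun φ g => g.toMatrix.mulVec φ) ψ)
    (Pi.single (fun _ => false) 1)

/-- The distribution of the outcome when all qubits of the final state are measured in the
computational basis. -/
def outDist (C : QCircuit n) : (Fin n → Bool) → ℝ := fun a => ‖C.finalState a‖ ^ 2

end QCircuit

/-! ## Uniformity -/

/-- The symbols in which quantum circuits are described. -/
inductive CircSym where
  | layer | had | rot | cnot | swap | block | one | done
  deriving DecidableEq

/-- The description of a natural number (in unary). -/
def describeNat (k : ℕ) : List CircSym := List.replicate k CircSym.one ++ [CircSym.done]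

/-- The description of a gate: its type, its parameters, and the qubits on which it acts. -/
def QGate.describe {n : ℕ} : QGate n → List CircSym
  | had i => CircSym.had :: describeNat i
  | rot i => CircSym.rot :: describeNat i
  | cnot c t => CircSym.cnot :: (describeNat c ++ describeNat t)
  | swap i j => CircSym.swap :: (describeNat i ++ describeNat j)
  | block m q w => CircSym.block :: (describeNat m ++ describeNat q ++
      (List.ofFn w).flatMap fun i => describeNat i)

/-- The description of a circuit: its layers, and in each layer its gates. -/
def QCircuit.describe {n : ℕ} (C : QCircuit n) : List CircSym :=
  C.flatMap fun layer => CircSym.layer :: layer.flatMap QGate.describe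

/-- Programs of a random access machine with memory cells numbered by the natural numbers, each
holding a natural number, and with an output tape. The arithmetic is that of the successor
machine, so a computation of polynomial length can be simulated in polynomial time by a Turing
machine, and conversely. -/
inductive RamProg where
  /-- cell `a` gets the value `c` -/
  | const (a c : ℕ)
  /-- cell `a` gets the content of cell `b` -/
  | copy (a b : ℕ)
  /-- cell `a` is increased by one -/
  | inc (a : ℕ)
  /-- cell `a` is decreased by one, if it is positive -/
  | dec (a : ℕ)
  /-- cell `a` gets the content of the cell whose number is in cell `b` -/
  | load (a b : ℕ)
  /-- the cell whose number is in cell `a` gets the content of cell `b` -/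
  | store (a b : ℕ)
  /-- write a symbol on the output tape -/
  | write (s : CircSym)
  /-- first `P`, then `Q` -/
  | seq (P Q : RamProg)
  /-- as long as cell `a` is nonzero, repeat `P` -/
  | loop (a : ℕ) (P : RamProg)

/-- The state of the machine: its memory and what it has written so far. -/
structure RamState where
  mem : ℕ → ℕ
  out : List CircSym

/-- `RamExec P s s' t`: the program `P`, started in the state `s`, halts in the state `s'` after
exactly `t` steps (a test of a loop condition counts as one step). -/
inductive RamExec : RamProg → RamState → RamState → ℕ → Prop where
  | const (s a c) : RamExec (.const a c) s ⟨Function.update s.mem a c, s.out⟩ 1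
  | copy (s a b) : RamExec (.copy a b) s ⟨Function.update s.mem a (s.mem b), s.out⟩ 1
  | inc (s a) : RamExec (.inc a) s ⟨Function.update s.mem a (s.mem a + 1), s.out⟩ 1
  | dec (s a) : RamExec (.dec a) s ⟨Function.update s.mem a (s.mem a - 1), s.out⟩ 1
  | load (s a b) : RamExec (.load a b) s ⟨Function.update s.mem a (s.mem (s.mem b)), s.out⟩ 1
  | store (s a b) : RamExec (.store a b) s ⟨Function.update s.mem (s.mem a) (s.mem b), s.out⟩ 1
  | write (s x) : RamExec (.write x) s ⟨s.mem, s.out ++ [x]⟩ 1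
  | seq {P Q s s' s'' t t'} (h : RamExec P s s' t) (h' : RamExec Q s' s'' t') :
      RamExec (.seq P Q) s s'' (t + t')
  | loop_exit {a P s} (h : s.mem a = 0) : RamExec (.loop a P) s s 1
  | loop_step {a P s s' s'' t t'} (h : s.mem a ≠ 0) (h' : RamExec P s s' t)
      (h'' : RamExec (.loop a P) s' s'' t') : RamExec (.loop a P) s s'' (1 + t + t')

/-- The initial state on input `n`: cell `0` holds `n`, all other cells hold `0`, and nothing is
written. -/
def ramInit (n : ℕ) : RamState := ⟨Function.update (fun _ => 0) 0 n, []⟩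

/-- A family of quantum circuits is uniform if there is one program that, given `n`, writes the
description of the `n`-qubit circuit of the family in a number of steps polynomial in `n`. -/
def IsUniformFamily (C : ∀ n, QCircuit n) : Prop :=
  ∃ (P : RamProg) (T : Polynomial ℕ), ∀ n, ∃ (s : RamState) (t : ℕ),
    RamExec P (ramInit n) s t ∧ t ≤ T.eval n ∧ s.out = (C n).describe

/-- A family of quantum circuits has constant depth and consists of gates of constant size: the
depth, and the number of qubits on which a gate acts, are bounded independently of `n`. -/
def IsConstantDepthFamily (C : ∀ n, QCircuit n) : Prop :=
  ∃ d k : ℕ, ∀ n, (C n).IsValid ∧ (C n).depth ≤ d ∧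
    ∀ layer ∈ C n, ∀ g ∈ layer, g.wires.length ≤ k

end

/-! ## Equidistribution modulo `p` -/

/-! Quantum side. The circuit puts a superposition of all spin assignments on the tree and writes
into each edge qubit the difference of the spins at its two ends. Once the edge bits are fixed, only
two spin assignments remain, complementary to each other: the spin of a vertex is the root spin `c`
plus the path parity. On Hadamard states an `X`-rotation by `θ = π/p` is a phase `e^{±iθ}` whose
sign is the spin, so rotations controlled by the bits `x_i` give the branch `c` the phase
`e^{±iθS}`, where `S` is the signed sum. With the extra rotation by `π/4` at the root, the two
branches interfere to the probability `(1 + κ sin(2πS/p)) / 2^n`, where `κ` is the sign of the last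
bit plus the parity of `x` (`Sampler.finalState_circuit`, `Sampler.abs_outDist_sub_le`). The
majority bit is the sign of this sine, so the distance from the target is about `(1 - E|sin(2πS/p)|)
/ 2`. Equidistribution of `S` modulo `p` turns this into `1/2 - 1/π` plus small errors
(`Sampler.tvDist_circuit_le`).

The controls are the very qubits that carry the spins. Letting each qubit control its cyclic
successor in a block of length `m + 1` gives a matrix `M` that is not unitary, but the columns of
complementary strings overlap only by `|sin θ|^(m+1)`. For `m ≥ 1/α`, passing to the
orthonormalization costs `O(n^{-1-α})` per block, hence `O(n^{-α})` in total.

Classical side. At depth `D` each output bit depends on at most `k = 2^D` inputs. Cut the tree into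
a top and small pieces below it. There is an almost linear number of inputs that do not influence
the top and influence pairwise disjoint groups of pieces (`exists_isSpread`). For fixed values of
the other inputs, the last output bit is constant and `S` is a constant plus independent two-valued
terms. If many terms move modulo `p`, the parity-twisted majority is almost unbiased
(`abs_sum_majMod_mul_parity_le`), so the last bit is wrong about half of the time. An input could
also change the output without moving its term. This cannot happen at a peak, where all vertices of
its group contribute `1`: any other filling of the group has a smaller sum, by less than `p`
(`IsSpread.mem_moving_or_mem_idle`). A uniform string has many peaks, so an output that looks
typical forces many moving or many idle inputs. With many idle inputs only few outputs are
reachable, a loss that the surplus of `n^δ` random bits cannot repay. The three events together are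
a test with advantage almost `1/2` (`le_tvDist_of_isSpread`). A peak has probability `2^{-O(k²)}`,
so the argument works as long as `k²` is small against `log n`, that is, below depth `c log log n`.

The primes are found by a search whose test `n^(r-1) ≤ p^(3r)` is a comparison of integers; it gives
the exponent `α = (r-1)/(3r)`, which tends to `1/3` with growing `r`. -/

lemma two_div_le_abs_sin {Q : ℕ} {A : ℤ} (h : ¬ (Q : ℤ) ∣ A) (hQ : 0 < Q) :
    2 / (Q : ℝ) ≤ |Real.sin (Real.pi * A / Q)| := by
  have hQ' : (0 : ℝ) < Q := by exact_mod_cast hQ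
  have hQz : (0 : ℤ) < Q := by exact_mod_cast hQ
  set r := A % (Q : ℤ) with hr
  have hr0 : 1 ≤ r := by
    have h1 := Int.emod_nonneg A hQz.ne'
    have h2 : r ≠ 0 := fun h0 => h (Int.dvd_of_emod_eq_zero h0)
    omega
  have hr1 : r < Q := Int.emod_lt_of_pos A hQz
  have hA : (A : ℝ) = r + (A / (Q : ℤ) : ℤ) * Q := by
    have := Int.emod_add_mul_ediv A (Q : ℤ)
    rw [← hr] at this
    have h3 : ((r + Q * (A / (Q : ℤ)) : ℤ) : ℝ) = A := by exact_mod_cast this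
    push_cast at h3
    linarith
  have hang : Real.pi * A / Q = Real.pi * r / Q + (A / (Q : ℤ) : ℤ) * Real.pi := by
    rw [hA]; field_simp
  rw [hang, Real.sin_add_int_mul_pi, abs_mul, abs_zpow, abs_neg, abs_one, one_zpow, one_mul]
  have hr0' : (1 : ℝ) ≤ r := by exact_mod_cast hr0
  have hr1' : (r : ℝ) + 1 ≤ Q := by exact_mod_cast hr1
  refine le_trans ?_ (le_abs_self _)
  have hpi := Real.pi_pos
  rcases le_total (2 * (r : ℝ)) Q with h2 | h2
  · have := Real.mul_le_sin (x := Real.pi * r / Q) (by positivity)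
      (by rw [div_le_div_iff₀ hQ' two_pos]; nlinarith)
    refine le_trans ?_ this
    rw [show 2 / Real.pi * (Real.pi * r / Q) = 2 * r / Q by field_simp]
    gcongr; linarith
  · rw [← Real.sin_pi_sub]
    have hx : Real.pi - Real.pi * r / Q = Real.pi * (Q - r) / Q := by field_simp
    rw [hx]
    have := Real.mul_le_sin (x := Real.pi * (Q - r) / Q)
      (div_nonneg (mul_nonneg hpi.le (by linarith)) hQ'.le)
      (by rw [div_le_div_iff₀ hQ' two_pos]; nlinarith)
    refine le_trans ?_ this
    rw [show 2 / Real.pi * (Real.pi * (Q - r) / Q) = 2 * (Q - r) / Q by field_simp]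
    gcongr; linarith

/-- From `cos² = 1 - sin² ≤ 1 - 4/Q² ≤ exp(-4/Q²)`. This is the decay that each independent term
contributes to an exponential sum. -/
lemma abs_cos_le_exp {Q : ℕ} {A : ℤ} (h : ¬ (Q : ℤ) ∣ A) (hQ : 0 < Q) :
    |Real.cos (Real.pi * A / Q)| ≤ Real.exp (-2 / (Q : ℝ) ^ 2) := by
  have hs := two_div_le_abs_sin h hQ
  have hQ' : (0 : ℝ) < Q := by exact_mod_cast hQ
  have h4 : 4 / (Q : ℝ) ^ 2 ≤ Real.sin (Real.pi * A / Q) ^ 2 := by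
    rw [← sq_abs (Real.sin _)]
    calc 4 / (Q : ℝ) ^ 2 = (2 / (Q : ℝ)) ^ 2 := by ring
      _ ≤ _ := by gcongr
  apply abs_le_of_sq_le_sq _ (Real.exp_pos _).le
  rw [Real.cos_sq', ← Real.exp_nat_mul]
  have := Real.add_one_le_exp (((2 : ℕ) : ℝ) * (-2 / (Q : ℝ) ^ 2))
  have e : ((2 : ℕ) : ℝ) * (-2 / (Q : ℝ) ^ 2) = - (4 / (Q : ℝ) ^ 2) := by push_cast; ring
  rw [e] at this ⊢
  linarith

lemma sum_stdAddChar_mul {p : ℕ} [NeZero p] (a : ZMod p) :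
    ∑ k : ZMod p, ZMod.stdAddChar (k * a) = if a = 0 then (p : ℂ) else 0 := by
  have := AddChar.sum_mulShift (R := ZMod p) (R' := ℂ) a (ZMod.isPrimitive_stdAddChar p)
  rw [this]; simp [ZMod.card]

/-- A weighted sample whose nontrivial Fourier coefficients modulo `p` are small is close to
equidistributed modulo `p`. -/
lemma abs_sum_sub_average_le {p : ℕ} [NeZero p] [Fact (1 < p)] {Ω : Type*} [Fintype Ω] (S : Ω → ZMod p)
    (w : Ω → ℝ) (F : ZMod p → ℝ) (hF : ∀ j, |F j| ≤ 1) {B : ℝ}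
    (hB : ∀ k : ZMod p, k ≠ 0 → ‖∑ ω, (w ω : ℂ) * ZMod.stdAddChar (k * S ω)‖ ≤ B) :
    |∑ ω, w ω * F (S ω) - (∑ ω, w ω) * ((∑ j, F j) / p)| ≤ p * B := by
  have hp : (p : ℂ) ≠ 0 := by exact_mod_cast NeZero.ne p
  have hp' : (0 : ℝ) < p := by exact_mod_cast Nat.pos_of_ne_zero (NeZero.ne p)
  set T : ZMod p → ℂ := fun k => ∑ ω, (w ω : ℂ) * ZMod.stdAddChar (k * S ω) with hT
  set G : ZMod p → ℂ := fun k => ∑ j, (F j : ℂ) * ZMod.stdAddChar (k * (-j)) with hG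
  -- Fourier inversion on `ZMod p`: the indicator of `S ω = j` is expanded into characters.
  have hexp : ((∑ ω, w ω * F (S ω) : ℝ) : ℂ) = (1 / p) * ∑ k, G k * T k := by
    have h1 : ∀ ω, (F (S ω) : ℂ)
        = (1 / p) * ∑ k, ∑ j, (F j : ℂ) * ZMod.stdAddChar (k * (S ω - j)) := by
      intro ω
      rw [Finset.sum_comm]
      simp_rw [← Finset.mul_sum, sum_stdAddChar_mul, sub_eq_zero]
      simp
      field_simp
    push_cast
    simp_rw [h1, hG, hT, Finset.mul_sum, Finset.sum_mul]
    rw [Finset.sum_comm]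
    refine Finset.sum_congr rfl fun k _ => Finset.sum_congr rfl fun ω _ => ?_
    rw [Finset.mul_sum]
    refine Finset.sum_congr rfl fun j _ => ?_
    rw [show k * (S ω - j) = k * (-j) + k * S ω by ring, AddChar.map_add_eq_mul]
    ring
  have hG1 : ∀ k, ‖G k‖ ≤ p := by
    intro k
    refine (norm_sum_le _ _).trans ?_
    calc _ ≤ ∑ j : ZMod p, (1 : ℝ) := by
          refine Finset.sum_le_sum fun j _ => ?_
          rw [norm_mul, AddChar.norm_apply, mul_one, Complex.norm_real]
          exact hF j
      _ = p := by simp [ZMod.card]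
  -- The frequency `k = 0` is exactly the total weight times the average of `F`.
  have hsplit : ((∑ ω, w ω * F (S ω) - (∑ ω, w ω) * ((∑ j, F j) / p) : ℝ) : ℂ)
      = (1 / p) * ∑ k ∈ Finset.univ.erase (0 : ZMod p), G k * T k := by
    rw [Complex.ofReal_sub, hexp, ← Finset.add_sum_erase _ _ (Finset.mem_univ (0 : ZMod p))]
    simp [hG, hT]
    ring
  have hB0 : ∀ k ∈ Finset.univ.erase (0 : ZMod p), ‖G k * T k‖ ≤ p * B := by
    intro k hk
    rw [norm_mul]
    exact mul_le_mul (hG1 k) (hB k (Finset.ne_of_mem_erase hk)) (norm_nonneg _) hp'.le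
  rw [← Real.norm_eq_abs, ← Complex.norm_real, hsplit, norm_mul]
  have hs := (norm_sum_le _ _).trans (Finset.sum_le_sum hB0)
  rw [Finset.sum_const, Finset.card_erase_of_mem (Finset.mem_univ _), Finset.card_univ, ZMod.card,
    nsmul_eq_mul] at hs
  have hBnn : 0 ≤ B := (norm_nonneg _).trans (hB 1 one_ne_zero)
  have : ((p - 1 : ℕ) : ℝ) ≤ p := by exact_mod_cast Nat.sub_le _ _
  calc ‖(1 / (p : ℂ))‖ * _ ≤ (1 / p) * (p * (p * B)) := by
        rw [norm_div, norm_one, Complex.norm_natCast]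
        refine mul_le_mul_of_nonneg_left (hs.trans ?_) (by positivity)
        exact mul_le_mul_of_nonneg_right this (by positivity)
    _ = p * B := by field_simp

lemma norm_one_add_exp (x : ℝ) :
    ‖1 + Complex.exp (x * Complex.I)‖ = 2 * |Real.cos (x / 2)| := by
  have : 1 + Complex.exp (x * Complex.I)
      = Complex.exp ((x / 2 : ℝ) * Complex.I) * (2 * Real.cos (x / 2) : ℝ) := by
    rw [Complex.ofReal_mul, Complex.ofReal_cos, Complex.ofReal_ofNat, Complex.two_cos, mul_add,
      ← Complex.exp_add, ← Complex.exp_add]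
    push_cast
    rw [show (x : ℂ) / 2 * Complex.I + x / 2 * Complex.I = x * Complex.I by ring,
      show (x : ℂ) / 2 * Complex.I + -(x / 2) * Complex.I = 0 by ring, Complex.exp_zero, add_comm]
  rw [this, norm_mul, Complex.norm_exp_ofReal_mul_I, one_mul, Complex.norm_real, Real.norm_eq_abs,
    abs_mul, abs_two]

lemma stdAddChar_mul_intCast {p : ℕ} [NeZero p] (k : ZMod p) (a : ℤ) :
    ZMod.stdAddChar (k * (a : ZMod p))
      = Complex.exp ((2 * (Real.pi * (k.val * a : ℤ) / p) : ℝ) * Complex.I) := by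
  have : k * (a : ZMod p) = ((k.val * a : ℤ) : ZMod p) := by
    push_cast; rw [ZMod.natCast_zmod_val]
  rw [this, ZMod.stdAddChar_coe]
  congr 1
  push_cast
  ring

lemma sin_congr_of_emod {p : ℕ} (hp : 0 < p) (a : ℤ) :
    Real.sin (2 * Real.pi * a / p) = Real.sin (2 * Real.pi * (a % (p : ℤ) : ℤ) / p) := by
  have hA : (a : ℝ) = (a % (p : ℤ) : ℤ) + (a / (p : ℤ) : ℤ) * p := by
    have := Int.emod_add_mul_ediv a (p : ℤ)
    have h3 : ((a % p + p * (a / (p : ℤ)) : ℤ) : ℝ) = a := by exact_mod_cast this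
    push_cast at h3 ⊢
    linarith
  have hp' : (0 : ℝ) < p := by exact_mod_cast hp
  have : 2 * Real.pi * a / p
      = 2 * Real.pi * (a % (p : ℤ) : ℤ) / p + (a / (p : ℤ) : ℤ) * (2 * Real.pi) := by
    conv_lhs => rw [hA]
    field_simp
  rw [this, Real.sin_add_int_mul_two_pi]

/-- A residue below `p / 2` is an angle in `[0, π)`, where the sine is nonnegative; the other
residues give angles in `[π, 2π)`. -/
lemma majMod_sign_mul_sin {p : ℕ} (hp : 0 < p) (a : ℤ) :
    (if majMod p a then -1 else 1) * Real.sin (2 * Real.pi * a / p)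
      = |Real.sin (2 * Real.pi * a / p)| := by
  have hp' : (0 : ℝ) < p := by exact_mod_cast hp
  have hpz : (0 : ℤ) < p := by exact_mod_cast hp
  rw [sin_congr_of_emod hp]
  have h0 := Int.emod_nonneg a hpz.ne'
  have h1 := Int.emod_lt_of_pos a hpz
  unfold majMod
  set r := a % (p : ℤ)
  have hpi := Real.pi_pos
  have h0' : (0 : ℝ) ≤ r := by exact_mod_cast h0
  have h1' : (r : ℝ) < p := by exact_mod_cast h1
  by_cases h : (p : ℤ) ≤ 2 * r
  · have h' : (p : ℝ) ≤ 2 * r := by exact_mod_cast h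
    have : Real.sin (2 * Real.pi * r / p) ≤ 0 := by
      rw [← Real.sin_sub_two_pi]
      apply Real.sin_nonpos_of_nonpos_of_neg_pi_le
      · rw [sub_nonpos, div_le_iff₀ hp']; nlinarith
      · rw [le_sub_iff_add_le, le_div_iff₀ hp']; nlinarith
    simp [h, abs_of_nonpos this]
  · have h' : 2 * (r : ℝ) < p := by exact_mod_cast not_le.1 h
    have : 0 ≤ Real.sin (2 * Real.pi * r / p) := by
      apply Real.sin_nonneg_of_nonneg_of_le_pi (by positivity)
      rw [div_le_iff₀ hp']; nlinarith
    simp [h, abs_of_nonneg this]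

lemma sum_zmod_eq_sum_range {p : ℕ} [NeZero p] {M : Type*} [AddCommMonoid M] (f : ℕ → M) :
    ∑ j : ZMod p, f j.val = ∑ j ∈ Finset.range p, f j := by
  obtain ⟨n, rfl⟩ := Nat.exists_eq_succ_of_ne_zero (NeZero.ne p)
  exact Fin.sum_univ_eq_sum_range f (n + 1)

/-- For `p = 2r + 1` there are `r + 1` residues below `p / 2` and `r` above, so the signs sum to
`1`. -/
lemma abs_sum_majMod_sign_le {p : ℕ} [NeZero p] (hp : Odd p) :
    |∑ j : ZMod p, (if majMod p (j.val : ℤ) then -1 else 1 : ℝ)| ≤ 1 := by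
  rw [sum_zmod_eq_sum_range (fun j : ℕ => (if majMod p (j : ℤ) then -1 else 1 : ℝ))]
  obtain ⟨r, rfl⟩ := hp
  rw [show 2 * r + 1 = (r + 1) + r by ring, Finset.sum_range_add]
  have h1 : ∀ j ∈ Finset.range (r + 1),
      (if majMod (r + 1 + r) (j : ℤ) then -1 else 1 : ℝ) = 1 := by
    intro j hj
    rw [Finset.mem_range] at hj
    have : (j : ℤ) % ((r + 1 + r : ℕ) : ℤ) = j := Int.emod_eq_of_lt (by omega) (by omega)
    rw [majMod, this, if_neg]
    simp only [decide_eq_true_eq]; push_cast; omega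
  have h2 : ∀ j ∈ Finset.range r,
      (if majMod (r + 1 + r) ((r + 1 + j : ℕ) : ℤ) then -1 else 1 : ℝ) = -1 := by
    intro j hj
    rw [Finset.mem_range] at hj
    have : ((r + 1 + j : ℕ) : ℤ) % ((r + 1 + r : ℕ) : ℤ) = (r + 1 + j : ℕ) :=
      Int.emod_eq_of_lt (by omega) (by omega)
    rw [majMod, this, if_pos]
    simp only [decide_eq_true_eq]; push_cast; omega
  rw [Finset.sum_congr rfl h1, Finset.sum_congr rfl h2]
  simp

/-- Multiplied by `sin (π / (2p))`, the sum telescopes by the product-to-sum formula. -/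
lemma sum_range_sin {p : ℕ} (hp : 2 ≤ p) :
    ∑ j ∈ Finset.range p, Real.sin (Real.pi * j / p)
      = Real.cos (Real.pi / (2 * p)) / Real.sin (Real.pi / (2 * p)) := by
  have hp' : (2 : ℝ) ≤ p := by exact_mod_cast hp
  have hpi := Real.pi_pos
  have hs : 0 < Real.sin (Real.pi / (2 * p)) :=
    Real.sin_pos_of_pos_of_lt_pi (by positivity)
      (by rw [div_lt_iff₀ (by positivity)]; nlinarith)
  rw [eq_div_iff hs.ne', Finset.sum_mul]
  have h : ∀ m : ℕ, ∑ j ∈ Finset.range m, Real.sin (Real.pi * j / p) * Real.sin (Real.pi / (2 * p))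
      = (Real.cos (Real.pi / (2 * p)) - Real.cos (Real.pi * m / p - Real.pi / (2 * p))) / 2 := by
    intro m
    induction m with
    | zero => simp [Real.cos_neg]
    | succ m ih =>
      rw [Finset.sum_range_succ, ih]
      have : Real.pi * ((m + 1 : ℕ) : ℝ) / p - Real.pi / (2 * p)
          = Real.pi * m / p + Real.pi / (2 * p) := by push_cast; field_simp; ring
      rw [this, Real.cos_add, Real.cos_sub]
      ring
  rw [h p, show Real.pi * p / p = Real.pi by field_simp, Real.cos_pi_sub]
  ring

/-- The value `|sin(πa/p)|` depends only on `a` modulo `p`, and doubling permutes the residues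
because `p` is odd. The average is therefore that of `sin(πj/p)`, which is `cot(π/(2p)) / p`; Taylor
bounds at `π/(2p)` finish. -/
lemma average_abs_sin_ge {p : ℕ} [NeZero p] (hp : 2 ≤ p) (hodd : Odd p) :
    2 / Real.pi - 1 / p ≤ (∑ j : ZMod p, |Real.sin (2 * Real.pi * (j.val : ℤ) / p)|) / p := by
  have hp' : (2 : ℝ) ≤ p := by exact_mod_cast hp
  have hp0 : (0 : ℝ) < p := by linarith
  have hpi := Real.pi_pos
  have hper : ∀ a : ℕ, |Real.sin (Real.pi * (a : ℝ) / p)|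
      = |Real.sin (Real.pi * ((a % p : ℕ) : ℝ) / p)| := by
    intro a
    have hA : (a : ℝ) = (a % p : ℕ) + (a / p : ℕ) * p := by
      exact_mod_cast (Nat.mod_add_div' a p).symm
    have : Real.pi * a / p = Real.pi * (a % p : ℕ) / p + (a / p : ℕ) * Real.pi := by
      conv_lhs => rw [hA]
      field_simp
    rw [this, Real.sin_add_nat_mul_pi, abs_mul, abs_pow, abs_neg, abs_one, one_pow, one_mul]
  have h2 : IsUnit (2 : ZMod p) := by
    have : ((2 : ℕ) : ZMod p) = 2 := by norm_num
    rw [← this, ZMod.isUnit_iff_coprime]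
    exact (Nat.coprime_two_left.2 hodd)
  have e1 : ∀ j : ZMod p, |Real.sin (2 * Real.pi * (j.val : ℤ) / p)|
      = |Real.sin (Real.pi * ((h2.unit.mulLeft j).val : ℝ) / p)| := by
    intro j
    have : (h2.unit.mulLeft j : ZMod p) = ((2 * j.val : ℕ) : ZMod p) := by
      simp [Units.mulLeft]
    rw [this, ZMod.val_natCast, ← hper]
    congr 2
    push_cast
    ring
  rw [Finset.sum_congr rfl fun j _ => e1 j,
    Equiv.sum_comp h2.unit.mulLeft (fun j : ZMod p => |Real.sin (Real.pi * (j.val : ℝ) / p)|),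
    sum_zmod_eq_sum_range (fun j : ℕ => |Real.sin (Real.pi * (j : ℝ) / p)|)]
  have e2 : ∀ j ∈ Finset.range p, |Real.sin (Real.pi * (j : ℝ) / p)|
      = Real.sin (Real.pi * (j : ℝ) / p) := by
    intro j hj
    have : (j : ℝ) ≤ p := by exact_mod_cast (Finset.mem_range.1 hj).le
    apply abs_of_nonneg
    apply Real.sin_nonneg_of_nonneg_of_le_pi (by positivity)
    rw [div_le_iff₀ hp0]; nlinarith
  rw [Finset.sum_congr rfl e2, sum_range_sin hp]
  set x := Real.pi / (2 * p) with hx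
  have hx0 : 0 < x := by positivity
  have hs : 0 < Real.sin x :=
    Real.sin_pos_of_pos_of_lt_pi hx0 (by rw [hx, div_lt_iff₀ (by positivity)]; nlinarith)
  have hc := Real.one_sub_sq_div_two_le_cos (x := x)
  have hsx := Real.sin_le hx0.le
  have hxle : x ≤ 1 := by
    rw [hx, div_le_iff₀ (by positivity)]; nlinarith [Real.pi_lt_four]
  have : (1 - x ^ 2 / 2) / x ≤ Real.cos x / Real.sin x := by
    rw [div_le_div_iff₀ hx0 hs]
    have h0 : 0 ≤ 1 - x ^ 2 / 2 := by nlinarith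
    have h1 : 0 ≤ Real.cos x := h0.trans hc
    nlinarith [mul_le_mul hc hsx hs.le h1]
  calc 2 / Real.pi - 1 / p ≤ ((1 - x ^ 2 / 2) / x) / p := by
        have e : (1 - x ^ 2 / 2) / x / p = 2 / Real.pi - x / 2 / p := by
          rw [hx]; field_simp
        rw [e]
        have : x / 2 / p ≤ 1 / p := by gcongr; linarith
        linarith
    _ ≤ _ := by gcongr

/-! ## Shallow circuits are local -/

namespace BoolCircuit

/-- The function `F` depends only on at most `k` of its input bits. -/
def IsJunta {l : ℕ} {A : Type*} (k : ℕ) (F : (Fin l → Bool) → A) : Prop :=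
  ∃ J : Finset (Fin l), J.card ≤ k ∧ DependsOn F (J : Set (Fin l))

/-- The invariant of the evaluation: a wire of depth `D` reads at most `2 ^ D` inputs. A gate unites
the input sets of two wires that lie at least one level lower, which at most doubles the bound. -/
lemma isJunta_getD_foldl {l : ℕ} (gates : List BoolGate) (v : (Fin l → Bool) → List Bool)
    (D : List ℕ) (hlen : ∀ u, (v u).length = D.length)
    (hv : ∀ w, IsJunta (2 ^ D.getD w 0) fun u => (v u).getD w false) (w : ℕ) :
    IsJunta (2 ^ (gates.foldl
        (fun v g => v ++ [max (v.getD g.left 0) (v.getD g.right 0) + 1]) D).getD w 0)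
      fun u => (gates.foldl
        (fun v g => v ++ [g.op (v.getD g.left false) (v.getD g.right false)]) (v u)).getD w false := by
  induction gates generalizing v D with
  | nil => exact hv w
  | cons g gs ih =>
    simp only [List.foldl_cons]
    refine ih _ _ (by simp [hlen]) fun w => ?_
    rcases lt_trichotomy w D.length with h | h | h
    · have : ∀ u, w < (v u).length := fun u => by rw [hlen]; exact h
      simp only [List.getD_append _ _ _ _ h, List.getD_append _ _ _ _ (this _)]
      exact hv w
    · subst h
      have e0 : ∀ x, (D ++ [x]).getD D.length 0 = x := fun x => by simp
      have e1 : ∀ u x, (v u ++ [x]).getD D.length false = x := fun u x => by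
        rw [← hlen u]; simp
      simp only [e0, e1]
      obtain ⟨J, hJ, hd⟩ := hv g.left
      obtain ⟨J', hJ', hd'⟩ := hv g.right
      refine ⟨J ∪ J', (Finset.card_union_le _ _).trans ?_, fun a b hab => ?_⟩
      · rw [pow_succ, mul_two]
        exact add_le_add (hJ.trans (Nat.pow_le_pow_right two_pos (le_max_left _ _)))
          (hJ'.trans (Nat.pow_le_pow_right two_pos (le_max_right _ _)))
      · have e1 := hd (x := a) (y := b) fun i hi => hab i (by simp at hi ⊢; exact Or.inl hi)
        have e2 := hd' (x := a) (y := b) fun i hi => hab i (by simp at hi ⊢; exact Or.inr hi)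
        simp only at e1 e2 ⊢
        rw [e1, e2]
    -- Past the new end the default value `false` is read, which depends on no input.
    · have : ∀ u, (v u ++ [g.op ((v u).getD g.left false) ((v u).getD g.right false)]).length
          ≤ w := fun u => by simp [hlen]; omega
      simp only [List.getD_eq_default _ _ (this _)]
      exact ⟨∅, by simp, fun a b _ => rfl⟩

lemma isJunta_eval {l n : ℕ} (C : BoolCircuit l n) (i : Fin n) :
    IsJunta (2 ^ C.depth) fun u => C.eval u i := by
  obtain ⟨J, hJ, hd⟩ := isJunta_getD_foldl C.gates (fun u : Fin l → Bool => List.ofFn u)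
    (List.replicate l 0) (by simp) (fun w => by
      by_cases hw : w < l
      · refine ⟨{⟨w, hw⟩}, by simp, fun a b hab => ?_⟩
        simpa [List.getD_eq_getElem, hw] using hab
      · refine ⟨∅, by simp, fun a b _ => ?_⟩
        simp [hw]) (C.out i)
  refine ⟨J, hJ.trans (Nat.pow_le_pow_right two_pos ?_), hd⟩
  exact Finset.le_sup (f := fun i => C.wireDepths.getD (C.out i) 0) (Finset.mem_univ i)

end BoolCircuit

/-! ## Distinguishing events -/

/-- The totals agree, so an excess on `V` is matched by a deficit of the same size on the
complement; the two together make up for the factor `1 / 2`. -/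
lemma sub_le_tvDist {A : Type*} [Fintype A] {P Q : A → ℝ} (hPQ : ∑ a, P a = ∑ a, Q a)
    (V : Finset A) : ∑ a ∈ V, P a - ∑ a ∈ V, Q a ≤ tvDist P Q := by
  classical
  have h1 : ∑ a ∈ V, P a - ∑ a ∈ V, Q a ≤ ∑ a ∈ V, |P a - Q a| := by
    rw [← Finset.sum_sub_distrib]
    exact Finset.sum_le_sum fun a _ => le_abs_self _
  have h2 : ∑ a ∈ V, P a - ∑ a ∈ V, Q a ≤ ∑ a ∈ Vᶜ, |P a - Q a| := by
    have e1 := Finset.sum_add_sum_compl V P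
    have e2 := Finset.sum_add_sum_compl V Q
    have : ∑ a ∈ V, P a - ∑ a ∈ V, Q a = ∑ a ∈ Vᶜ, (Q a - P a) := by
      rw [Finset.sum_sub_distrib]; linarith
    rw [this]
    exact Finset.sum_le_sum fun a _ => by rw [abs_sub_comm]; exact le_abs_self _
  have h3 := Finset.sum_add_sum_compl V fun a => |P a - Q a|
  unfold tvDist
  linarith

lemma sum_targetDist (p N : ℕ) (V : (Fin (N + 1) → Bool) → Prop) [DecidablePred V] :
    ∑ a ∈ Finset.univ.filter V, targetDist p N a
      = ((Finset.univ.filter fun z : Fin N → Bool => V (Fin.snoc z (pmmajmod p z))).card : ℝ)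
        / 2 ^ N := by
  unfold targetDist
  rw [Finset.sum_ite, Finset.sum_const_zero, add_zero, Finset.sum_const, nsmul_eq_mul, mul_one_div]
  congr 2
  symm
  refine Finset.card_bij (fun z _ => Fin.snoc z (pmmajmod p z)) ?_ ?_ ?_
  · intro z hz
    simp only [Finset.mem_filter, Finset.mem_univ, true_and] at hz ⊢
    exact ⟨hz, by simp⟩
  · intro z _ z' _ h
    have := congrArg (fun a => fun i : Fin N => a i.castSucc) h
    simpa using this
  · intro a ha
    simp only [Finset.mem_filter, Finset.mem_univ, true_and] at ha
    have : (Fin.snoc (fun i : Fin N => a i.castSucc) (pmmajmod p fun i : Fin N => a i.castSucc) :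
        Fin (N + 1) → Bool) = a := by
      rw [← ha.2]
      exact Fin.snoc_init_self a
    exact ⟨fun i => a i.castSucc, by simpa [this] using ha.1, this⟩

lemma sum_outDist {l n : ℕ} (C : BoolCircuit l n) (V : (Fin n → Bool) → Prop) [DecidablePred V] :
    ∑ a ∈ Finset.univ.filter V, C.outDist a
      = ((Finset.univ.filter fun u => V (C.eval u)).card : ℝ) / 2 ^ l := by
  unfold BoolCircuit.outDist
  rw [← Finset.sum_div, ← Nat.cast_sum]
  congr 2
  rw [Finset.card_eq_sum_card_fiberwise (f := C.eval) (t := Finset.univ.filter V)]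
  · refine Finset.sum_congr rfl fun a ha => ?_
    congr 1
    ext u
    simp only [Finset.mem_filter, Finset.mem_univ, true_and] at ha ⊢
    exact ⟨fun h => ⟨h ▸ ha, h⟩, fun h => h.2⟩
  · intro u hu
    simpa using hu

lemma sum_univ_targetDist (p N : ℕ) : ∑ a, targetDist p N a = 1 := by
  have := sum_targetDist p N fun _ => True
  simpa using this

lemma BoolCircuit.sum_univ_outDist {l n : ℕ} (C : BoolCircuit l n) : ∑ a, C.outDist a = 1 := by
  have := sum_outDist C fun _ => True
  simpa using this

/-- A test for telling a circuit from the target distribution. -/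
lemma card_sub_card_le_tvDist {l N : ℕ} (C : BoolCircuit l (N + 1)) (p : ℕ)
    (V : (Fin (N + 1) → Bool) → Prop) [DecidablePred V] :
    ((Finset.univ.filter fun u => V (C.eval u)).card : ℝ) / 2 ^ l
      - ((Finset.univ.filter fun z : Fin N → Bool => V (Fin.snoc z (pmmajmod p z))).card : ℝ)
        / 2 ^ N ≤ tvDist C.outDist (targetDist p N) := by
  rw [← sum_outDist, ← sum_targetDist]
  exact sub_le_tvDist (by rw [sum_univ_targetDist, C.sum_univ_outDist]) _

/-! ## Two counting lemmas -/

lemma card_filter_agree {ι : Type*} [Fintype ι] [DecidableEq ι] (B : Finset ι) (c : ι → Bool) :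
    ((Finset.univ.filter fun w : ι → Bool => ∀ o ∈ B, w o = c o).card : ℝ)
      = 2 ^ Fintype.card ι / 2 ^ B.card := by
  have h : (Finset.univ.filter fun w : ι → Bool => ∀ o ∈ B, w o = c o)
      = Fintype.piFinset fun o => if o ∈ B then {c o} else Finset.univ := by
    ext w
    simp only [Finset.mem_filter, Finset.mem_univ, true_and, Fintype.mem_piFinset]
    refine forall_congr' fun o => ?_
    by_cases ho : o ∈ B <;> simp [ho]
  have h2 : ∀ o, (if o ∈ B then ({c o} : Finset Bool) else Finset.univ).card
      = if o ∈ B then 1 else 2 := by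
    intro o; split_ifs <;> simp
  rw [h, Fintype.card_piFinset, Finset.prod_congr rfl fun o _ => h2 o, Finset.prod_ite,
    Finset.prod_const_one, one_mul, Finset.prod_const, eq_div_iff (by positivity)]
  have h3 : (Finset.univ.filter fun o => o ∉ B).card + B.card = Fintype.card ι := by
    rw [show (Finset.univ.filter fun o => o ∉ B) = Bᶜ by ext; simp, Finset.card_compl_add_card]
  push_cast
  rw [← pow_add, h3]

/-- Second moment bound: for pairwise disjoint sets of coordinates, the number of sets on which a
uniformly random string agrees with a given one is rarely below half its expectation. -/
lemma card_few_agreements_le {ι κ : Type*} [Fintype ι] [DecidableEq ι] [DecidableEq κ]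
    (I : Finset κ) (B : κ → Finset ι) (hB : ∀ i ∈ I, ∀ j ∈ I, i ≠ j → Disjoint (B i) (B j))
    (c : ι → Bool) {μ : ℝ} (hμ0 : 0 < μ) (hμ : μ ≤ ∑ i ∈ I, (1 / 2 ^ (B i).card : ℝ)) :
    ((Finset.univ.filter fun w : ι → Bool =>
        2 * ((I.filter fun i => ∀ o ∈ B i, w o = c o).card : ℝ) ≤ μ).card : ℝ)
      ≤ 2 ^ Fintype.card ι * (4 / μ) := by
  classical
  set n := Fintype.card ι
  set ν := ∑ i ∈ I, (1 / 2 ^ (B i).card : ℝ) with hν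
  set A : κ → (ι → Bool) → ℝ := fun i w => if ∀ o ∈ B i, w o = c o then 1 else 0 with hA
  set X : (ι → Bool) → ℝ := fun w => ∑ i ∈ I, A i w with hX
  have hXc : ∀ w, X w = ((I.filter fun i => ∀ o ∈ B i, w o = c o).card : ℝ) := by
    intro w; simp [hX, hA]
  have hν0 : 0 < ν := hμ0.trans_le hμ
  have h1 : ∀ i, ∑ w, A i w = 2 ^ n * (1 / 2 ^ (B i).card) := by
    intro i
    have := card_filter_agree (B i) c
    simp only [hA, Finset.sum_boole]
    rw [this]; ring
  -- Agreement on both of two disjoint sets is agreement on their union, so the two events are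
  -- independent.
  have h2 : ∀ i ∈ I, ∀ j ∈ I, i ≠ j → ∑ w, A i w * A j w
      = 2 ^ n * (1 / 2 ^ (B i).card) * (1 / 2 ^ (B j).card) := by
    intro i hi j hj hij
    have e : ∀ w, A i w * A j w = if ∀ o ∈ B i ∪ B j, w o = c o then 1 else 0 := by
      intro w
      simp only [hA, Finset.mem_union, or_imp, forall_and]
      by_cases h : ∀ o ∈ B i, w o = c o
      · by_cases h' : ∀ o ∈ B j, w o = c o
        · rw [if_pos h, if_pos h', if_pos ⟨h, h'⟩, one_mul]
        · rw [if_neg h', mul_zero, if_neg fun x => h' (And.right x)]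
      · rw [if_neg h, zero_mul, if_neg fun x => h (And.left x)]
    rw [Finset.sum_congr rfl fun w _ => e w, Finset.sum_boole, card_filter_agree,
      Finset.card_union_of_disjoint (hB i hi j hj hij), pow_add]
    field_simp
    rfl
  have h3 : ∀ i, ∑ w, A i w * A i w = 2 ^ n * (1 / 2 ^ (B i).card) := by
    intro i
    rw [← h1 i]
    refine Finset.sum_congr rfl fun w _ => ?_
    simp only [hA]; split_ifs <;> simp
  have hX1 : ∑ w, X w = 2 ^ n * ν := by
    simp only [hX]
    rw [Finset.sum_comm, Finset.sum_congr rfl fun i _ => h1 i, ← Finset.mul_sum]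
  have hX2 : ∑ w, X w * X w ≤ 2 ^ n * ν + 2 ^ n * ν * ν := by
    simp only [hX, Finset.sum_mul_sum]
    rw [Finset.sum_comm]
    have : ∀ i ∈ I, ∑ w, ∑ j ∈ I, A i w * A j w
        ≤ 2 ^ n * (1 / 2 ^ (B i).card) + 2 ^ n * (1 / 2 ^ (B i).card) * ν := by
      intro i hi
      rw [Finset.sum_comm, ← Finset.add_sum_erase _ _ hi, h3]
      gcongr
      rw [Finset.sum_congr rfl fun j hj =>
        h2 i hi j (Finset.mem_of_mem_erase hj) (Finset.ne_of_mem_erase hj).symm, ← Finset.mul_sum]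
      gcongr
      exact Finset.sum_le_sum_of_subset_of_nonneg (Finset.erase_subset _ _)
        fun j _ _ => by positivity
    refine (Finset.sum_le_sum this).trans ?_
    rw [Finset.sum_add_distrib, ← Finset.sum_mul, ← Finset.mul_sum]
  -- Covariances vanish, hence the variance is at most the mean `ν`.
  have hvar : ∑ w, (X w - ν) ^ 2 ≤ 2 ^ n * ν := by
    have : ∀ w, (X w - ν) ^ 2 = X w * X w - 2 * ν * X w + ν ^ 2 := fun w => by ring
    rw [Finset.sum_congr rfl fun w _ => this w, Finset.sum_add_distrib, Finset.sum_sub_distrib,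
      ← Finset.mul_sum, hX1, Finset.sum_const, Finset.card_univ, Fintype.card_fun,
      Fintype.card_bool, nsmul_eq_mul]
    push_cast
    nlinarith [hX2]
  set Wb := Finset.univ.filter fun w : ι → Bool =>
    2 * ((I.filter fun i => ∀ o ∈ B i, w o = c o).card : ℝ) ≤ μ with hWb
  -- Chebyshev's inequality: `2 X ≤ μ ≤ ν` forces a deviation of at least `ν / 2`.
  have hlow : (Wb.card : ℝ) * (ν ^ 2 / 4) ≤ 2 ^ n * ν := by
    refine le_trans ?_ hvar
    calc (Wb.card : ℝ) * (ν ^ 2 / 4) = ∑ w ∈ Wb, ν ^ 2 / 4 := by rw [Finset.sum_const, nsmul_eq_mul]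
      _ ≤ ∑ w ∈ Wb, (X w - ν) ^ 2 := by
          refine Finset.sum_le_sum fun w hw => ?_
          rw [hWb, Finset.mem_filter, ← hXc] at hw
          nlinarith [hw.2]
      _ ≤ _ := Finset.sum_le_sum_of_subset_of_nonneg (Finset.subset_univ _)
          fun w _ _ => sq_nonneg _
  have h4 : (Wb.card : ℝ) * ν ≤ 2 ^ n * 4 := by nlinarith
  rw [mul_div_assoc', le_div_iff₀ hμ0]
  exact (mul_le_mul_of_nonneg_left hμ (Nat.cast_nonneg _)).trans h4

/-- In a graph in which all closed neighbourhoods have at most `Δ` elements, a maximal independent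
set is large. -/
lemma exists_independent {α : Type*} [DecidableEq α] (V : Finset α) (r : α → α → Prop)
    [DecidableRel r] (hr : ∀ i j, r i j → r j i) (Δ : ℕ)
    (hΔ : ∀ i ∈ V, (insert i (V.filter (r i))).card ≤ Δ) :
    ∃ I ⊆ V, (∀ i ∈ I, ∀ j ∈ I, i ≠ j → ¬ r i j) ∧ V.card ≤ I.card * Δ := by
  obtain ⟨I, hI, hmax⟩ := Finset.exists_max_image
    (V.powerset.filter fun I => ∀ i ∈ I, ∀ j ∈ I, i ≠ j → ¬ r i j) Finset.card ⟨∅, by simp⟩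
  simp only [Finset.mem_filter, Finset.mem_powerset] at hI hmax
  refine ⟨I, hI.1, hI.2, ?_⟩
  -- A vertex outside these neighbourhoods could be added to `I`, against maximality.
  have hcov : V ⊆ I.biUnion fun i => insert i (V.filter (r i)) := by
    intro j hj
    by_contra hcon
    simp only [Finset.mem_biUnion, Finset.mem_insert, Finset.mem_filter, not_exists, not_and,
      not_or] at hcon
    have hjI : j ∉ I := fun h => (hcon j h).1 rfl
    have := hmax (insert j I) ⟨Finset.insert_subset hj hI.1, ?_⟩
    · rw [Finset.card_insert_of_notMem hjI] at this; omega
    · intro a ha b hb hab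
      rcases Finset.mem_insert.1 ha with rfl | ha' <;> rcases Finset.mem_insert.1 hb with rfl | hb'
      · exact absurd rfl hab
      · exact fun h => (hcon b hb').2 hj (hr _ _ h)
      · exact fun h => (hcon a ha').2 hj h
      · exact hI.2 a ha' b hb' hab
  calc V.card ≤ _ := Finset.card_le_card hcov
    _ ≤ I.card * Δ := Finset.card_biUnion_le_card_mul _ _ _ fun i hi => hΔ i (hI.1 hi)

/-! ## Cutting the tree into small pieces -/

/-- In the heap numbering `1, 2, …` of the vertices of the tree, cut off the vertices `< T`. The
piece of a vertex `w ≥ T` is named after its root, and the top gets the name `0`. -/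
def treePiece (T w : ℕ) : ℕ :=
  if h : w < 2 * T ∨ w = 0 then (if w < T then 0 else w) else treePiece T (w / 2)
decreasing_by omega

lemma treePiece_of_lt {T w : ℕ} (h : w < T) : treePiece T w = 0 := by
  rw [treePiece, dif_pos (Or.inl (by omega)), if_pos h]

lemma treePiece_of_mem {T w : ℕ} (h : T ≤ w) (h' : w < 2 * T) : treePiece T w = w := by
  rw [treePiece, dif_pos (Or.inl h'), if_neg (by omega)]

lemma treePiece_of_ge {T w : ℕ} (hT : 0 < T) (h : 2 * T ≤ w) :
    treePiece T w = treePiece T (w / 2) := by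
  rw [treePiece, dif_neg (by omega)]

/-- In the heap numbering the parent of `w` is `w / 2`. So a path from the root stays in the top for
a while and then in a single piece. -/
lemma treePiece_half {T w : ℕ} (hT : 0 < T) :
    treePiece T (w / 2) = 0 ∨ treePiece T (w / 2) = treePiece T w := by
  rcases lt_or_ge w (2 * T) with h | h
  · exact Or.inl (treePiece_of_lt (by omega))
  · exact Or.inr (treePiece_of_ge hT h).symm

lemma treePiece_eq_zero {T w : ℕ} (hT : 0 < T) (h : treePiece T w = 0) : w < T := by
  induction w using Nat.strong_induction_on with
  | _ w ih =>
    by_contra hw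
    rcases lt_or_ge w (2 * T) with h' | h'
    · rw [treePiece_of_mem (by omega) h'] at h; omega
    · rw [treePiece_of_ge hT h'] at h
      have := ih (w / 2) (by omega) h
      omega

lemma treePiece_le {T w : ℕ} : treePiece T w ≤ w := by
  induction w using Nat.strong_induction_on with
  | _ w ih =>
    rw [treePiece]
    split_ifs with h h'
    · omega
    · exact le_rfl
    · exact (ih _ (by omega)).trans (by omega)

/-- Apart from its root, a piece consists of children of its own vertices. If it has `a` vertices up
to `X / 2`, it has at most `2a + 1` up to `X`; thus the count plus one at most doubles when `X`
does. -/
lemma card_treePiece {T ρ : ℕ} (hT : 0 < T) (hρ : 0 < ρ) (X : ℕ) (hX : ρ ≤ X) :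
    (((Finset.range (X + 1)).filter fun w => treePiece T w = ρ).card + 1) * ρ ≤ 2 * X := by
  induction X using Nat.strong_induction_on with
  | _ X ih =>
    have hsub : ((Finset.range (X + 1)).filter fun w => treePiece T w = ρ)
        ⊆ insert ρ (((Finset.range (X / 2 + 1)).filter fun w => treePiece T w = ρ).biUnion
          fun w => {2 * w, 2 * w + 1}) := by
      intro w hw
      simp only [Finset.mem_filter, Finset.mem_range] at hw
      simp only [Finset.mem_insert, Finset.mem_biUnion, Finset.mem_filter, Finset.mem_range,
        Finset.mem_singleton]
      rcases lt_or_ge w T with h | h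
      · rw [treePiece_of_lt h] at hw; omega
      rcases lt_or_ge w (2 * T) with h' | h'
      · rw [treePiece_of_mem h h'] at hw; exact Or.inl hw.2
      · rw [treePiece_of_ge hT h'] at hw
        exact Or.inr ⟨w / 2, ⟨by omega, hw.2⟩, by omega⟩
    have hcard := (Finset.card_le_card hsub).trans (Finset.card_insert_le _ _)
    have hb : (((Finset.range (X / 2 + 1)).filter fun w => treePiece T w = ρ).biUnion
          fun w => ({2 * w, 2 * w + 1} : Finset ℕ)).card
        ≤ ((Finset.range (X / 2 + 1)).filter fun w => treePiece T w = ρ).card * 2 :=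
      Finset.card_biUnion_le_card_mul _ _ _ fun w _ => Finset.card_le_two
    rcases lt_or_ge (X / 2) ρ with h | h
    · have : ((Finset.range (X / 2 + 1)).filter fun w => treePiece T w = ρ).card = 0 := by
        rw [Finset.card_eq_zero, Finset.filter_eq_empty_iff]
        intro w hw
        rw [Finset.mem_range] at hw
        have := treePiece_le (T := T) (w := w)
        omega
      rw [this] at hb
      have : ((Finset.range (X + 1)).filter fun w => treePiece T w = ρ).card + 1 ≤ 2 := by omega
      nlinarith
    · have := ih (X / 2) (by omega) h
      have h2 : 2 * (X / 2) ≤ X := by omega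
      set a := ((Finset.range (X / 2 + 1)).filter fun w => treePiece T w = ρ).card
      set b := ((Finset.range (X + 1)).filter fun w => treePiece T w = ρ).card
      have : b + 1 ≤ 2 * (a + 1) := by omega
      nlinarith

lemma le_treePiece {T w : ℕ} (h : treePiece T w ≠ 0) : T ≤ treePiece T w := by
  induction w using Nat.strong_induction_on with
  | _ w ih =>
    rw [treePiece] at h ⊢
    split_ifs at h ⊢ with h1 h2
    · exact absurd rfl h
    · omega
    · exact ih _ (by omega) h

/-- A nonempty piece has a root `ρ ≥ T`, so the previous count applies. The shift by `2` occurs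
because index `k` stands for `v_{k+1}`, whose heap number is `k + 2`. -/
lemma card_treePiece_mul_le {T ρ : ℕ} (hT : 0 < T) (hρ : ρ ≠ 0) (L : ℕ) :
    ((Finset.range L).filter fun k => treePiece T (k + 2) = ρ).card * T ≤ 2 * (L + 1) := by
  rcases Nat.eq_zero_or_pos ((Finset.range L).filter fun k => treePiece T (k + 2) = ρ).card
    with h | h
  · rw [h]; omega
  obtain ⟨k, hk⟩ := Finset.card_pos.1 h
  simp only [Finset.mem_filter, Finset.mem_range] at hk
  have hle : ρ ≤ L + 1 := by
    rw [← hk.2]; exact treePiece_le.trans (by omega)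
  have hTρ : T ≤ ρ := by
    rw [← hk.2]; exact le_treePiece (by rw [hk.2]; exact hρ)
  have h1 := card_treePiece hT (Nat.pos_of_ne_zero hρ) (L + 1) hle
  have h2 : ((Finset.range L).filter fun k => treePiece T (k + 2) = ρ).card
      ≤ ((Finset.range (L + 1 + 1)).filter fun w => treePiece T w = ρ).card := by
    refine Finset.card_le_card_of_injOn (fun k => k + 2) (fun k hk => ?_) (fun a _ b _ h => by
      simpa using h)
    simp only [Finset.coe_filter, Finset.mem_range, Set.mem_ofPred_eq] at hk ⊢
    exact ⟨by omega, hk.2⟩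
  calc _ ≤ (((Finset.range (L + 1 + 1)).filter fun w => treePiece T w = ρ).card + 1) * ρ :=
        Nat.mul_le_mul (h2.trans (Nat.le_succ _)) hTρ
    _ ≤ _ := h1

/-- The piece to which the `o`-th bit of `z = (d, x)` belongs. -/
def coordPiece (T N o : ℕ) : ℕ :=
  if o < N / 2 then treePiece T (o + 2)
  else if o < 2 * (N / 2) then treePiece T (o - N / 2 + 2) else 0

/-- The contribution of the `k`-th non-root vertex to the signed sum. -/
def signedBit {N : ℕ} (z : Fin N → Bool) (k : ℕ) : ℤ :=
  if vertexBit z k then (if pathParity (edgeBit z) (k + 1) then -1 else 1) else 0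

lemma signedSum_eq {N : ℕ} (z : Fin N → Bool) :
    signedSum z = ∑ k ∈ Finset.range (N / 2), signedBit z k := rfl

section Pieces

variable {N T : ℕ} {z z' : Fin N → Bool}

lemma pathParity_succ (d : ℕ → Bool) (k : ℕ) :
    pathParity d (k + 1) = xor (d k) (pathParity d (k / 2)) := by
  rw [pathParity]

lemma edgeBit_congr {k : ℕ} (hk : k < N / 2)
    (h : ∀ o : Fin N, (o : ℕ) = k → z o = z' o) : edgeBit z k = edgeBit z' k := by
  have : k < N := by omega
  simp only [edgeBit, bitAt, dif_pos this]
  exact h _ rfl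

lemma vertexBit_congr {k : ℕ} (hk : k < N / 2)
    (h : ∀ o : Fin N, (o : ℕ) = N / 2 + k → z o = z' o) : vertexBit z k = vertexBit z' k := by
  have : N / 2 + k < N := by omega
  simp only [vertexBit, bitAt, dif_pos this]
  exact h _ rfl

lemma coordPiece_edge {k : ℕ} (hk : k < N / 2) : coordPiece T N k = treePiece T (k + 2) := by
  rw [coordPiece, if_pos hk]

lemma coordPiece_vertex {k : ℕ} (hk : k < N / 2) :
    coordPiece T N (N / 2 + k) = treePiece T (k + 2) := by
  rw [coordPiece, if_neg (by omega), if_pos (by omega)]; congr 1; omega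

/-- All edges on the path to a vertex lie in the top or in the piece of this vertex. -/
lemma pathParity_edgeBit_congr (hT : 0 < T) {ρ : ℕ}
    (h : ∀ o : Fin N, coordPiece T N o = 0 ∨ coordPiece T N o = ρ → z o = z' o) (i : ℕ)
    (hi : i ≤ N / 2) (hi' : treePiece T (i + 1) = 0 ∨ treePiece T (i + 1) = ρ) :
    pathParity (edgeBit z) i = pathParity (edgeBit z') i := by
  induction i using Nat.strong_induction_on with
  | _ i ih =>
    rcases i with _ | k
    · simp [pathParity]
    · rw [pathParity_succ, pathParity_succ, ih (k / 2) (by omega) (by omega)]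
      · congr 1
        refine edgeBit_congr (by omega) fun o ho => h o ?_
        rw [ho, coordPiece_edge (by omega)]
        exact hi'
      · have := treePiece_half (w := k + 1 + 1) hT
        rw [show (k + 1 + 1) / 2 = k / 2 + 1 by omega] at this
        rcases this with h0 | h0
        · exact Or.inl h0
        · rw [h0]; exact hi'

lemma signedBit_congr (hT : 0 < T) {k : ℕ} (hk : k < N / 2)
    (h : ∀ o : Fin N, coordPiece T N o = 0 ∨ coordPiece T N o = treePiece T (k + 2) → z o = z' o) :
    signedBit z k = signedBit z' k := by
  rw [signedBit, signedBit, pathParity_edgeBit_congr hT h (k + 1) (by omega) (Or.inr rfl),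
    vertexBit_congr hk fun o ho => h o (Or.inr (by rw [ho, coordPiece_vertex hk]))]

/-- The contribution of the pieces in `R` to the signed sum. -/
def pieceSum (T : ℕ) (R : Finset ℕ) (z : Fin N → Bool) : ℤ :=
  ∑ k ∈ (Finset.range (N / 2)).filter fun k => treePiece T (k + 2) ∈ R, signedBit z k

/-- All the vertices in the pieces in `R` contribute `1` to the signed sum. -/
def IsPeak (T : ℕ) (R : Finset ℕ) (z : Fin N → Bool) : Prop :=
  ∀ k < N / 2, treePiece T (k + 2) ∈ R →
    vertexBit z k = true ∧ pathParity (edgeBit z) (k + 1) = false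

lemma signedBit_le_one (k : ℕ) : signedBit z k ≤ 1 := by
  unfold signedBit; split_ifs <;> norm_num

lemma neg_one_le_signedBit (k : ℕ) : -1 ≤ signedBit z k := by
  unfold signedBit; split_ifs <;> norm_num

lemma signedBit_eq_one {k : ℕ} :
    signedBit z k = 1 ↔ vertexBit z k = true ∧ pathParity (edgeBit z) (k + 1) = false := by
  unfold signedBit; split_ifs <;> simp_all

/-- On a peak the vertex bits in `R` are `1` and the path parities there are `0`. An edge bit is the
difference of the parities at its ends, and the upper end lies in `R` or in the top. So the bits
outside `R` determine everything. -/
lemma IsPeak.eq (hT : 0 < T) {R : Finset ℕ} (h0 : 0 ∉ R) (hz : IsPeak T R z) (hz' : IsPeak T R z')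
    (h : ∀ o : Fin N, coordPiece T N o ∉ R → z o = z' o) : z = z' := by
  have hpar : ∀ i ≤ N / 2, treePiece T (i + 1) = 0 ∨ treePiece T (i + 1) ∈ R →
      pathParity (edgeBit z) i = pathParity (edgeBit z') i := by
    intro i hi hi'
    by_cases hR : treePiece T (i + 1) ∈ R
    · rcases i with _ | k
      · simp [pathParity]
      · rw [(hz k (by omega) hR).2, (hz' k (by omega) hR).2]
    · have h0 : treePiece T (i + 1) = 0 := hi'.resolve_right hR
      refine pathParity_edgeBit_congr (ρ := 0) hT (fun o ho => h o ?_) i hi (Or.inl h0)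
      rw [or_self] at ho
      rw [ho, ← h0]
      exact hR
  funext o
  by_cases hR : coordPiece T N o ∈ R
  swap
  · exact h o hR
  rcases lt_or_ge (o : ℕ) (N / 2) with ho | ho
  · rw [coordPiece_edge ho] at hR
    have e1 := hpar (o + 1) (by omega) (Or.inr hR)
    have e2 : pathParity (edgeBit z) (o / 2) = pathParity (edgeBit z') (o / 2) := by
      refine hpar _ (by omega) ?_
      have := treePiece_half (w := o + 2) hT
      rw [show ((o : ℕ) + 2) / 2 = o / 2 + 1 by omega] at this
      rcases this with h0 | h0
      · exact Or.inl h0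
      · exact Or.inr (by rw [h0]; exact hR)
    rw [pathParity_succ, pathParity_succ, e2] at e1
    simpa [edgeBit, bitAt] using e1
  rcases lt_or_ge (o : ℕ) (2 * (N / 2)) with ho' | ho'
  · have hk : (o : ℕ) - N / 2 < N / 2 := by omega
    have hko : N / 2 + ((o : ℕ) - N / 2) = o := by omega
    have : treePiece T ((o : ℕ) - N / 2 + 2) ∈ R := by
      rw [← coordPiece_vertex hk, hko]; exact hR
    have e1 := (hz _ hk this).1
    have e2 := (hz' _ hk this).1
    simp only [vertexBit, hko] at e1 e2
    simp [bitAt] at e1 e2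
    rw [e1, e2]
  · rw [coordPiece, if_neg (by omega), if_neg (by omega)] at hR
    exact absurd hR h0

/-- Moving away from a peak changes the contribution to the signed sum, by a bounded amount. -/
lemma IsPeak.pieceSum_sub (hT : 0 < T) {R : Finset ℕ} (h0 : 0 ∉ R) (hz : IsPeak T R z) (hne : z ≠ z')
    (h : ∀ o : Fin N, coordPiece T N o ∉ R → z o = z' o) :
    0 < pieceSum T R z - pieceSum T R z' ∧ pieceSum T R z - pieceSum T R z'
      ≤ 2 * ((Finset.range (N / 2)).filter fun k => treePiece T (k + 2) ∈ R).card := by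
  have h1 : ∀ k ∈ (Finset.range (N / 2)).filter fun k => treePiece T (k + 2) ∈ R,
      signedBit z k = 1 := by
    intro k hk
    simp only [Finset.mem_filter, Finset.mem_range] at hk
    exact signedBit_eq_one.2 (hz k hk.1 hk.2)
  have e : pieceSum T R z - pieceSum T R z'
      = ∑ k ∈ (Finset.range (N / 2)).filter fun k => treePiece T (k + 2) ∈ R,
        (1 - signedBit z' k) := by
    rw [pieceSum, pieceSum, ← Finset.sum_sub_distrib]
    exact Finset.sum_congr rfl fun k hk => by rw [h1 k hk]
  rw [e]
  constructor
  · apply Finset.sum_pos'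
    · intro k _
      have := signedBit_le_one (z := z') k
      omega
    -- If no term is positive, `z'` is a peak as well, hence equal to `z`.
    · by_contra hcon
      push Not at hcon
      refine hne (IsPeak.eq hT h0 hz (fun k hk hR => signedBit_eq_one.1 ?_) h)
      have := hcon k (by simp [hk, hR])
      have := signedBit_le_one (z := z') k
      omega
  · refine (Finset.sum_le_card_nsmul _ _ 2 fun k _ => ?_).trans ?_
    · have := neg_one_le_signedBit (z := z') k
      omega
    · rw [nsmul_eq_mul, mul_comm]

/-- The bijection that replaces the bits on the edges by the path parities. -/
def parityMap (z : Fin N → Bool) : Fin N → Bool := fun o =>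
  if (o : ℕ) < N / 2 then pathParity (edgeBit z) (o + 1) else z o

/-- Edge bits are recovered as differences of path parities. Being a bijection, the map preserves
the uniform measure, and after it the path parities are independent bits. -/
lemma parityMap_injective : Function.Injective (parityMap (N := N)) := by
  intro z z' h
  have hpar : ∀ i ≤ N / 2, pathParity (edgeBit z) i = pathParity (edgeBit z') i := by
    intro i hi
    rcases i with _ | k
    · simp [pathParity]
    · have := congrFun h ⟨k, by omega⟩
      simpa [parityMap, show k < N / 2 by omega] using this
  funext o
  rcases lt_or_ge (o : ℕ) (N / 2) with ho | ho
  · have e1 := hpar (o + 1) (by omega)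
    rw [pathParity_succ, pathParity_succ, hpar (o / 2) (by omega)] at e1
    simpa [edgeBit, bitAt] using e1
  · have := congrFun h o
    simpa [parityMap, not_lt.2 ho] using this

/-- The bits in the pieces in `R`. -/
def pieceCoords (T N : ℕ) (R : Finset ℕ) : Finset (Fin N) :=
  Finset.univ.filter fun o => coordPiece T N o ∈ R

/-- In the new coordinates a peak is agreement with one fixed string, `0` on edges and `1` on
vertices, so the second moment bound for agreements applies to peaks. -/
lemma isPeak_iff {R : Finset ℕ} (h0 : 0 ∉ R) :
    IsPeak T R z ↔ ∀ o ∈ pieceCoords T N R, parityMap z o = decide (N / 2 ≤ (o : ℕ)) := by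
  simp only [pieceCoords, Finset.mem_filter, Finset.mem_univ, true_and]
  constructor
  · intro hz o hR
    rcases lt_or_ge (o : ℕ) (N / 2) with ho | ho
    · rw [coordPiece_edge ho] at hR
      simp [parityMap, ho, (hz o ho hR).2]
    rcases lt_or_ge (o : ℕ) (2 * (N / 2)) with ho' | ho'
    · have hk : (o : ℕ) - N / 2 < N / 2 := by omega
      have hko : N / 2 + ((o : ℕ) - N / 2) = o := by omega
      have : treePiece T ((o : ℕ) - N / 2 + 2) ∈ R := by
        rw [← coordPiece_vertex hk, hko]; exact hR
      have e1 := (hz _ hk this).1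
      simp only [vertexBit, hko] at e1
      simp [bitAt] at e1
      simp [parityMap, not_lt.2 ho, e1, ho]
    · rw [coordPiece, if_neg (by omega), if_neg (by omega)] at hR
      exact absurd hR h0
  · intro h k hk hR
    constructor
    · have hN : N / 2 + k < N := by omega
      have := h ⟨N / 2 + k, hN⟩ (by simpa [coordPiece_vertex hk] using hR)
      simpa [parityMap, vertexBit, bitAt, hN] using this
    · have hN : k < N := by omega
      have := h ⟨k, hN⟩ (by simpa [coordPiece_edge hk] using hR)
      simpa [parityMap, hk, not_le.2 hk] using this

lemma card_pieceCoords_le {R : Finset ℕ} (h0 : 0 ∉ R) :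
    (pieceCoords T N R).card
      ≤ 2 * ((Finset.range (N / 2)).filter fun k => treePiece T (k + 2) ∈ R).card := by
  rw [two_mul]
  set K := (Finset.range (N / 2)).filter fun k => treePiece T (k + 2) ∈ R with hK
  have : (pieceCoords T N R).map Fin.valEmbedding ⊆ K ∪ K.image (fun k => N / 2 + k) := by
    intro o ho
    simp only [pieceCoords, Finset.mem_map, Finset.mem_filter, Finset.mem_univ, true_and,
      Fin.valEmbedding_apply] at ho
    obtain ⟨a, ha, rfl⟩ := ho
    simp only [Finset.mem_union, Finset.mem_image, hK, Finset.mem_filter, Finset.mem_range]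
    rcases lt_or_ge (a : ℕ) (N / 2) with h | h
    · rw [coordPiece_edge h] at ha
      exact Or.inl ⟨h, ha⟩
    rcases lt_or_ge (a : ℕ) (2 * (N / 2)) with ho' | ho'
    · have hk : (a : ℕ) - N / 2 < N / 2 := by omega
      have hko : N / 2 + ((a : ℕ) - N / 2) = a := by omega
      rw [← hko, coordPiece_vertex hk] at ha
      exact Or.inr ⟨_, ⟨hk, ha⟩, hko⟩
    · rw [coordPiece, if_neg (by omega), if_neg (by omega)] at ha
      exact absurd ha h0
  have h1 := Finset.card_le_card this
  rw [Finset.card_map] at h1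
  exact h1.trans ((Finset.card_union_le _ _).trans (add_le_add le_rfl Finset.card_image_le))

lemma card_filter_mem_le (R : Finset ℕ) (m : ℕ)
    (hm : ∀ ρ ∈ R, ((Finset.range (N / 2)).filter fun k => treePiece T (k + 2) = ρ).card ≤ m) :
    ((Finset.range (N / 2)).filter fun k => treePiece T (k + 2) ∈ R).card ≤ R.card * m := by
  have : ((Finset.range (N / 2)).filter fun k => treePiece T (k + 2) ∈ R)
      = R.biUnion fun ρ => (Finset.range (N / 2)).filter fun k => treePiece T (k + 2) = ρ := by
    ext k; simp; tauto
  rw [this]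
  exact Finset.card_biUnion_le_card_mul _ _ _ hm

/-- Uniformly random strings have many peaks. -/
lemma card_few_peaks_le {κ : Type*} [DecidableEq κ] (I : Finset κ) (R : κ → Finset ℕ)
    (h0 : ∀ i ∈ I, 0 ∉ R i) (hR : ∀ i ∈ I, ∀ j ∈ I, i ≠ j → Disjoint (R i) (R j)) {m : ℕ}
    (hm : ∀ i ∈ I, (pieceCoords T N (R i)).card ≤ m) {μ : ℝ} (hμ0 : 0 < μ)
    (hμ : μ ≤ I.card / 2 ^ m) :
    open Classical in
    ((Finset.univ.filter fun z : Fin N → Bool =>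
      2 * ((I.filter fun i => IsPeak T (R i) z).card : ℝ) ≤ μ).card : ℝ) ≤ 2 ^ N * (4 / μ) := by
  classical
  have hbij : Function.Bijective (parityMap (N := N)) :=
    Finite.injective_iff_bijective.1 parityMap_injective
  have key := card_few_agreements_le I (fun i => pieceCoords T N (R i))
    (fun i hi j hj hij => by
      rw [Finset.disjoint_left]
      intro o ho ho'
      simp only [pieceCoords, Finset.mem_filter, Finset.mem_univ, true_and] at ho ho'
      exact Finset.disjoint_left.1 (hR i hi j hj hij) ho ho')
    (fun o : Fin N => decide (N / 2 ≤ (o : ℕ))) hμ0 (hμ.trans (by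
      rw [div_eq_mul_one_div, ← nsmul_eq_mul, ← Finset.sum_const]
      refine Finset.sum_le_sum fun i hi => ?_
      gcongr
      · norm_num
      · exact hm i hi))
  rw [Fintype.card_fin] at key
  refine le_trans (le_of_eq ?_) key
  norm_cast
  refine Finset.card_bij (fun z _ => parityMap z) (fun z hz => ?_) (fun z _ z' _ h => hbij.1 h)
    fun w hw => ?_
  · simp only [Finset.mem_filter, Finset.mem_univ, true_and] at hz ⊢
    convert hz using 7 with i hi
    exact (isPeak_iff (h0 i hi)).symm
  · obtain ⟨z, rfl⟩ := hbij.2 w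
    refine ⟨z, ?_, rfl⟩
    simp only [Finset.mem_filter, Finset.mem_univ, true_and] at hw ⊢
    convert hw using 7 with i hi
    exact isPeak_iff (h0 i hi)

end Pieces

/-! ## The signed sum as an exponential sum -/

lemma norm_exp_add_exp (φ : ℝ) (a b : ℤ) :
    ‖Complex.exp ((a * φ : ℝ) * Complex.I) + Complex.exp ((b * φ : ℝ) * Complex.I)‖
      = 2 * |Real.cos (((b - a : ℤ) : ℝ) * φ / 2)| := by
  have : Complex.exp ((a * φ : ℝ) * Complex.I) + Complex.exp ((b * φ : ℝ) * Complex.I)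
      = Complex.exp ((a * φ : ℝ) * Complex.I)
        * (1 + Complex.exp ((((b - a : ℤ) : ℝ) * φ : ℝ) * Complex.I)) := by
    rw [mul_add, mul_one, ← Complex.exp_add]
    congr 2
    push_cast
    ring
  rw [this, norm_mul, Complex.norm_exp_ofReal_mul_I, one_mul, norm_one_add_exp]

/-- The sum factors over the coordinates. A factor `e^{iaφ} + e^{ibφ}` has modulus `2 |cos((b -
a)φ/2)|`; outside `K` it is bounded by `2`. -/
lemma norm_sum_exp_le {ι : Type*} [Fintype ι] [DecidableEq ι] (φ : ℝ) (c : ℤ)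
    (W : ι → Bool → ℤ) (K : Finset ι) {e : ℝ}
    (he : ∀ i ∈ K, |Real.cos (((W i true - W i false : ℤ) : ℝ) * φ / 2)| ≤ e) :
    ‖∑ y : ι → Bool, Complex.exp ((((c + ∑ i, W i (y i) : ℤ) : ℝ) * φ : ℝ) * Complex.I)‖
      ≤ 2 ^ Fintype.card ι * e ^ K.card := by
  have h1 : ∀ y : ι → Bool,
      Complex.exp ((((c + ∑ i, W i (y i) : ℤ) : ℝ) * φ : ℝ) * Complex.I)
        = Complex.exp ((c * φ : ℝ) * Complex.I)
          * ∏ i, Complex.exp ((W i (y i) * φ : ℝ) * Complex.I) := by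
    intro y
    rw [← Complex.exp_sum, ← Complex.exp_add, ← Finset.sum_mul, ← add_mul]
    congr 2
    push_cast
    rw [add_mul, Finset.sum_mul]
  rw [Finset.sum_congr rfl fun y _ => h1 y, ← Finset.mul_sum, norm_mul,
    Complex.norm_exp_ofReal_mul_I, one_mul]
  have h2 := Finset.prod_univ_sum (fun _ : ι => (Finset.univ : Finset Bool))
    fun i b => Complex.exp ((W i b * φ : ℝ) * Complex.I)
  rw [Fintype.piFinset_univ] at h2
  rw [← h2, norm_prod]
  have h3 : ∀ i, ‖∑ b, Complex.exp ((W i b * φ : ℝ) * Complex.I)‖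
      ≤ 2 * if i ∈ K then e else 1 := by
    intro i
    rw [Fintype.sum_bool, add_comm, norm_exp_add_exp]
    gcongr
    split_ifs with hi
    · exact he i hi
    · exact Real.abs_cos_le_one _
  refine (Finset.prod_le_prod (fun i _ => norm_nonneg _) fun i _ => h3 i).trans (le_of_eq ?_)
  rw [Finset.prod_mul_distrib, Finset.prod_const, Finset.card_univ, Finset.prod_ite]
  simp

/-- A term `±1` is odd whatever its sign. Hence the target bit is a function of the signed sum
alone. -/
lemma odd_signedSum_iff {N : ℕ} (z : Fin N → Bool) :
    vertexParity z = decide (Odd (signedSum z)) := by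
  have h : ((signedSum z : ℤ) : ZMod 2)
      = (((Finset.range (N / 2)).filter (fun k => vertexBit z k = true)).card : ZMod 2) := by
    rw [signedSum, Int.cast_sum, Finset.card_filter, Nat.cast_sum]
    refine Finset.sum_congr rfl fun k _ => ?_
    split_ifs <;> decide
  rw [vertexParity]
  congr 1
  rw [← Int.odd_coe_nat, ← ZMod.intCast_eq_one_iff_odd, ← ZMod.intCast_eq_one_iff_odd, h]
  simp

lemma exp_int_mul_pi (a : ℤ) :
    Complex.exp ((a * Real.pi : ℝ) * Complex.I) = ((if Odd a then -1 else 1 : ℝ) : ℂ) := by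
  have : Complex.exp ((a * Real.pi : ℝ) * Complex.I) = (-1 : ℂ) ^ a := by
    rw [← Complex.exp_pi_mul_I, ← Complex.exp_int_mul]
    congr 1; push_cast; ring
  rw [this]
  split_ifs with h
  · rw [h.neg_one_zpow]; simp
  · rw [Int.not_odd_iff_even] at h
    rw [h.neg_one_zpow]; simp

/-- If a sum of independent integers moves modulo `p` in many of its terms, then
`majMod p` of the sum, twisted by its parity, is almost unbiased. -/
lemma abs_sum_majMod_mul_parity_le {ι : Type*} [Fintype ι] [DecidableEq ι] {p : ℕ}
    (hp : p.Prime) (hodd : Odd p) (c : ℤ) (W : ι → Bool → ℤ) (s : ℕ)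
    (hs : s ≤ (Finset.univ.filter fun i => ¬ (p : ℤ) ∣ W i true - W i false).card) :
    |∑ y : ι → Bool, (if Odd (c + ∑ i, W i (y i)) then -1 else 1 : ℝ)
        * (if majMod p (c + ∑ i, W i (y i)) then -1 else 1)|
      ≤ 2 ^ Fintype.card ι * (1 / p + p * Real.exp (-(s : ℝ) / (2 * (p : ℝ) ^ 2))) := by
  have : NeZero p := ⟨hp.ne_zero⟩
  have : Fact (1 < p) := ⟨hp.one_lt⟩
  set K := Finset.univ.filter fun i => ¬ (p : ℤ) ∣ W i true - W i false with hK
  have hp0 : (0 : ℝ) < p := by exact_mod_cast hp.pos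
  set e := Real.exp (-1 / (2 * (p : ℝ) ^ 2)) with he
  have hB : ∀ k : ZMod p, k ≠ 0 →
      ‖∑ y : ι → Bool, (((if Odd (c + ∑ i, W i (y i)) then -1 else 1 : ℝ)) : ℂ)
        * ZMod.stdAddChar (k * ((c + ∑ i, W i (y i) : ℤ) : ZMod p))‖
      ≤ 2 ^ Fintype.card ι * e ^ s := by
    intro k hk
    -- The parity sign is `e^{iπS}`; merged with the character of frequency `k` it becomes
    -- `e^{iSφ}`.
    set φ : ℝ := Real.pi * (p + 2 * k.val) / p with hφ
    have h1 : ∀ a : ℤ, (((if Odd a then -1 else 1 : ℝ)) : ℂ) * ZMod.stdAddChar (k * (a : ZMod p))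
        = Complex.exp ((a * φ : ℝ) * Complex.I) := by
      intro a
      rw [← exp_int_mul_pi, stdAddChar_mul_intCast, ← Complex.exp_add, ← add_mul,
        ← Complex.ofReal_add]
      congr 3
      rw [hφ]
      push_cast
      field_simp
    simp only [h1]
    refine (norm_sum_exp_le φ c W K (e := e) fun i hi => ?_).trans ?_
    · rw [hK, Finset.mem_filter] at hi
      -- Already `p` does not divide the product: it divides neither the step of the term nor `2k`,
      -- as `p` is odd and `0 < k < p`.
      have hA : ¬ ((2 * p : ℕ) : ℤ) ∣ (W i true - W i false) * (p + 2 * k.val) := by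
        intro hd
        have h2 : (p : ℤ) ∣ (W i true - W i false) * (p + 2 * k.val) :=
          Dvd.dvd.trans ⟨2, by push_cast; ring⟩ hd
        rcases (Nat.prime_iff_prime_int.1 hp).dvd_or_dvd h2 with h3 | h3
        · exact hi.2 h3
        · have h4 : (p : ℤ) ∣ ((2 * k.val : ℕ) : ℤ) := by
            push_cast
            exact (Int.dvd_add_right (dvd_refl _)).1 h3
          have h5 : p ∣ 2 * k.val := by exact_mod_cast h4
          rcases (hp.dvd_mul).1 h5 with h6 | h6
          · have := Nat.le_of_dvd two_pos h6
            have h2p := hp.two_le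
            have : p = 2 := le_antisymm this h2p
            rw [this] at hodd
            exact absurd hodd (by decide)
          · have hlt := ZMod.val_lt k
            rcases Nat.eq_zero_or_pos k.val with h0 | h0
            · exact hk ((ZMod.val_eq_zero k).1 h0)
            · exact absurd (Nat.le_of_dvd h0 h6) (not_le.2 hlt)
      have := abs_cos_le_exp hA (by have := hp.pos; omega)
      refine le_trans (le_of_eq ?_) (this.trans (le_of_eq ?_))
      · congr 2; rw [hφ]; push_cast; field_simp
      · rw [he]; congr 1; push_cast; field_simp
    · gcongr 2 ^ _ * ?_
      exact pow_le_pow_of_le_one (Real.exp_pos _).le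
        (Real.exp_le_one_iff.2 (div_nonpos_of_nonpos_of_nonneg (by norm_num) (by positivity))) hs
  have hF := abs_sum_sub_average_le (p := p)
    (fun y : ι → Bool => ((c + ∑ i, W i (y i) : ℤ) : ZMod p))
    (fun y : ι → Bool => (if Odd (c + ∑ i, W i (y i)) then -1 else 1 : ℝ))
    (fun j => if majMod p (j.val : ℤ) then -1 else 1) (fun j => by split_ifs <;> simp) hB
  have hmm : ∀ a : ℤ, majMod p (((a : ZMod p).val : ℕ) : ℤ) = majMod p a := by
    intro a
    rw [majMod, majMod, ZMod.val_intCast, Int.emod_emod]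
  simp only [hmm] at hF
  have hes : e ^ s = Real.exp (-(s : ℝ) / (2 * (p : ℝ) ^ 2)) := by
    rw [he, ← Real.exp_nat_mul]; congr 1; ring
  rw [hes] at hF
  have hw : |∑ y : ι → Bool, (if Odd (c + ∑ i, W i (y i)) then -1 else 1 : ℝ)|
      ≤ 2 ^ Fintype.card ι := by
    refine (Finset.abs_sum_le_sum_abs _ _).trans ?_
    have : ∀ y : ι → Bool, |(if Odd (c + ∑ i, W i (y i)) then -1 else 1 : ℝ)| = 1 := by
      intro y; split_ifs <;> simp
    simp [this]
  -- The frequency `0` need not cancel against the parity sign; it is harmless because the majority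
  -- bit is balanced up to `1 / p`.
  have havg : |(∑ j : ZMod p, (if majMod p (j.val : ℤ) then -1 else 1 : ℝ)) / p| ≤ 1 / p := by
    rw [abs_div, abs_of_pos hp0]
    gcongr
    exact abs_sum_majMod_sign_le hodd
  have h3 := mul_le_mul hw havg (abs_nonneg _) (by positivity)
  rw [← abs_mul] at h3
  have h4 := abs_sub_abs_le_abs_sub
    (∑ y : ι → Bool, (if Odd (c + ∑ i, W i (y i)) then -1 else 1 : ℝ)
      * (if majMod p (c + ∑ i, W i (y i)) then -1 else 1))
    ((∑ y : ι → Bool, (if Odd (c + ∑ i, W i (y i)) then -1 else 1 : ℝ))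
      * ((∑ j : ZMod p, (if majMod p (j.val : ℤ) then -1 else 1 : ℝ)) / p))
  linarith

/-! ## Local maps do not sample the target distribution -/

/-- The set `I` of input bits of the map `f`, whose output bit `o` depends on the input bits in
`J o`, is spread out: every `i ∈ I` influences only the output bits in the pieces in `R i`, which
do not contain the top of the tree, and these sets of pieces are pairwise disjoint. -/
structure IsSpread {l N : ℕ} (T : ℕ) (f : (Fin l → Bool) → Fin (N + 1) → Bool)
    (J : Fin (N + 1) → Finset (Fin l)) (I : Finset (Fin l)) (R : Fin l → Finset ℕ) : Prop where
  dep : ∀ o, DependsOn (fun u => f u o) (J o : Set (Fin l))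
  mem : ∀ i ∈ I, ∀ o, i ∈ J o → coordPiece T N o ∈ R i
  zero : ∀ i ∈ I, 0 ∉ R i
  disj : ∀ i ∈ I, ∀ j ∈ I, i ≠ j → Disjoint (R i) (R j)

/-- Combine values for the input bits in `I` with values for the other input bits. -/
def patch {l : ℕ} {I : Finset (Fin l)} (y : {i // i ∈ I} → Bool) (v : {i // i ∉ I} → Bool) :
    Fin l → Bool :=
  (Equiv.piEquivPiSubtypeProd (· ∈ I) fun _ => Bool).symm (y, v)

section Patch

variable {l : ℕ} {I : Finset (Fin l)}

lemma patch_of_mem (y : {i // i ∈ I} → Bool) (v : {i // i ∉ I} → Bool) {i : Fin l} (hi : i ∈ I) :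
    patch y v i = y ⟨i, hi⟩ := by
  simp [patch, Equiv.piEquivPiSubtypeProd, hi]

lemma mem_of_patch_ne {y y' : {i // i ∈ I} → Bool} {v : {i // i ∉ I} → Bool} {i : Fin l}
    (h : patch y v i ≠ patch y' v i) : ∃ hi : i ∈ I, y ⟨i, hi⟩ ≠ y' ⟨i, hi⟩ := by
  by_cases hi : i ∈ I
  · exact ⟨hi, by simpa [patch_of_mem, hi] using h⟩
  · exact absurd (by simp [patch, Equiv.piEquivPiSubtypeProd, hi]) h

lemma card_filter_patch (P : (Fin l → Bool) → Prop) [DecidablePred P] :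
    (Finset.univ.filter P).card
      = ∑ v : {i // i ∉ I} → Bool, (Finset.univ.filter fun y : {i // i ∈ I} → Bool =>
          P (patch y v)).card := by
  simp only [Finset.card_filter]
  rw [← Equiv.sum_comp (Equiv.piEquivPiSubtypeProd (· ∈ I) fun _ => Bool).symm,
    Fintype.sum_prod_type_right]
  rfl

end Patch

/-- The first `N` of `N + 1` bits. -/
def initBits {N : ℕ} (a : Fin (N + 1) → Bool) : Fin N → Bool := fun o => a o.castSucc

namespace IsSpread

variable {l N T : ℕ} {f : (Fin l → Bool) → Fin (N + 1) → Bool}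
  {J : Fin (N + 1) → Finset (Fin l)} {I : Finset (Fin l)} {R : Fin l → Finset ℕ}

lemma congr (h : IsSpread T f J I R) {y y' : {i // i ∈ I} → Bool} (v : {i // i ∉ I} → Bool)
    {o : Fin (N + 1)} (ho : ∀ i, y i ≠ y' i → coordPiece T N o ∉ R i) :
    f (patch y v) o = f (patch y' v) o := by
  refine h.dep o fun i hi => ?_
  by_contra hne
  obtain ⟨hiI, hy⟩ := mem_of_patch_ne hne
  exact ho _ hy (h.mem i hiI o hi)

/-- The sets `R j` are disjoint and avoid the top. So an output bit in `R i` reads at most the bit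
`i` among those in `I`, and an output bit in the top reads none of them. -/
lemma congr_of_mem (h : IsSpread T f J I R) {y y' : {i // i ∈ I} → Bool} (v : {i // i ∉ I} → Bool)
    (i : {i // i ∈ I}) (hi : y i = y' i) {o : Fin (N + 1)}
    (ho : coordPiece T N o = 0 ∨ coordPiece T N o ∈ R i) :
    f (patch y v) o = f (patch y' v) o := by
  refine h.congr v fun j hj hjR => ?_
  rcases ho with ho | ho
  · exact h.zero j j.2 (ho ▸ hjR)
  · have hij : (i : Fin l) ≠ j := fun e => hj (by rw [← Subtype.ext e]; exact hi)
    exact Finset.disjoint_left.1 (h.disj i i.2 j j.2 hij) ho hjR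

lemma signedBit_congr (h : IsSpread T f J I R) (hT : 0 < T) {y y' : {i // i ∈ I} → Bool}
    (v : {i // i ∉ I} → Bool) {k : ℕ} (hk : k < N / 2)
    (ho : ∀ i, y i ≠ y' i → treePiece T (k + 2) ∉ R i) :
    signedBit (initBits (f (patch y v))) k = signedBit (initBits (f (patch y' v))) k := by
  refine _root_.signedBit_congr hT hk fun o hor => h.congr v fun i hi hiR => ?_
  rw [Fin.val_castSucc] at hiR
  rcases hor with h0 | h0
  · exact h.zero i i.2 (h0 ▸ hiR)
  · exact ho i hi (h0 ▸ hiR)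

/-- The contribution to the signed sum of the pieces influenced by the input bit `i`, if its value
is `b`. -/
def weight (T : ℕ) (f : (Fin l → Bool) → Fin (N + 1) → Bool) (R : Fin l → Finset ℕ)
    (v : {i // i ∉ I} → Bool) (i : {i // i ∈ I}) (b : Bool) : ℤ :=
  pieceSum T (R i) (initBits (f (patch (fun _ => b) v)))

lemma pieceSum_eq (h : IsSpread T f J I R) (hT : 0 < T) (y : {i // i ∈ I} → Bool)
    (v : {i // i ∉ I} → Bool) (i : {i // i ∈ I}) :
    pieceSum T (R i) (initBits (f (patch y v))) = weight T f R v i (y i) := by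
  refine Finset.sum_congr rfl fun k hk => ?_
  simp only [Finset.mem_filter, Finset.mem_range] at hk
  refine h.signedBit_congr hT v hk.1 fun j hj hjR => ?_
  have hij : (i : Fin l) ≠ j := fun e => hj (by rw [← Subtype.ext e])
  exact Finset.disjoint_left.1 (h.disj i i.2 j j.2 hij) hk.2 hjR

/-- For fixed `v` the pieces in `R i` contribute a function of `y i` only, and all other vertices
contribute a constant. This makes the signed sum a sum of independent terms. -/
lemma exists_signedSum_eq (h : IsSpread T f J I R) (hT : 0 < T) (v : {i // i ∉ I} → Bool) :
    ∃ c, ∀ y, signedSum (initBits (f (patch y v))) = c + ∑ i, weight T f R v i (y i) := by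
  classical
  refine ⟨∑ k ∈ (Finset.range (N / 2)).filter fun k =>
      ¬ ∃ i : {i // i ∈ I}, treePiece T (k + 2) ∈ R i,
      signedBit (initBits (f (patch (fun _ => false) v))) k, fun y => ?_⟩
  rw [signedSum_eq, ← Finset.sum_filter_add_sum_filter_not (Finset.range (N / 2))
    (fun k => ∃ i : {i // i ∈ I}, treePiece T (k + 2) ∈ R i), add_comm]
  congr 1
  · refine Finset.sum_congr rfl fun k hk => ?_
    simp only [Finset.mem_filter, Finset.mem_range, not_exists] at hk
    exact h.signedBit_congr hT v hk.1 fun i _ => hk.2 i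
  · rw [← Finset.sum_congr rfl fun i _ => h.pieceSum_eq hT y v i]
    simp only [pieceSum]
    rw [← Finset.sum_biUnion]
    · refine Finset.sum_congr ?_ fun _ _ => rfl
      ext k
      simp only [Finset.mem_filter, Finset.mem_biUnion, Finset.mem_univ, true_and,
        exists_and_left]
    · intro i _ j _ hij
      rw [Function.onFun, Finset.disjoint_left]
      intro k hk hk'
      simp only [Finset.mem_filter] at hk hk'
      exact Finset.disjoint_left.1 (h.disj i i.2 j j.2 fun e => hij (Subtype.ext e)) hk.2 hk'.2

/-- The input bits in `I` whose value matters for the signed sum modulo `p`. -/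
def moving (T p : ℕ) (f : (Fin l → Bool) → Fin (N + 1) → Bool) (R : Fin l → Finset ℕ)
    (v : {i // i ∉ I} → Bool) : Finset {i // i ∈ I} :=
  Finset.univ.filter fun i => ¬ (p : ℤ) ∣ weight T f R v i true - weight T f R v i false

open Classical in
/-- The input bits in `I` whose value does not matter. -/
def idle (f : (Fin l → Bool) → Fin (N + 1) → Bool) (v : {i // i ∉ I} → Bool) :
    Finset {i // i ∈ I} :=
  Finset.univ.filter fun i => ∀ y y' : {i // i ∈ I} → Bool, (∀ j, j ≠ i → y j = y' j) →
    f (patch y v) = f (patch y' v)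

/-- The answer bit is counted as part of the top, so no bit in `I` influences it. -/
lemma coordPiece_last : coordPiece T N (Fin.last N) = 0 := by
  rw [coordPiece, Fin.val_last, if_neg (by omega), if_neg (by omega)]

/-- If the bit `i` influences the output at all, flipping it leaves the peak. This lowers the
contribution of `R i` by a positive amount that is less than `p`, hence nonzero modulo `p`. -/
lemma mem_moving_or_mem_idle (h : IsSpread T f J I R) (hT : 0 < T) {p : ℕ}
    (y : {i // i ∈ I} → Bool) (v : {i // i ∉ I} → Bool) (i : {i // i ∈ I})
    (hp : 2 * ((Finset.range (N / 2)).filter fun k => treePiece T (k + 2) ∈ R i).card < p)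
    (hpeak : IsPeak T (R i) (initBits (f (patch y v)))) :
    i ∈ moving T p f R v ∨ i ∈ idle f v := by
  classical
  by_contra hcon
  rw [not_or] at hcon
  obtain ⟨hmov, hidle⟩ := hcon
  simp only [idle, Finset.mem_filter, Finset.mem_univ, true_and, not_forall] at hidle
  obtain ⟨y₁, y₂, h12, hne⟩ := hidle
  obtain ⟨o, ho⟩ := Function.ne_iff.1 hne
  have hoR : coordPiece T N o ∈ R i := by
    by_contra hoR
    refine ho (h.congr v fun j hj => ?_)
    by_cases hji : j = i
    · rw [hji]; exact hoR
    · exact absurd (h12 j hji) hj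
  have hy12 : y₁ i ≠ y₂ i := fun e => ho (h.congr_of_mem v i e (Or.inr hoR))
  -- The output bit `o` sees only the value at `i`, and a bit has just two values. So a difference
  -- at `o` for some pair `y₁`, `y₂` gives a difference between `y` and its flip.
  set y' := Function.update y i (!y i) with hy'
  have hy'i : y' i = !y i := by simp [hy']
  have hzo : f (patch y v) o ≠ f (patch y' v) o := by
    by_cases e : y i = y₁ i
    · rw [h.congr_of_mem v i e (Or.inr hoR), h.congr_of_mem (y := y') v i (y' := y₂) ?_
        (Or.inr hoR)]
      · exact ho
      · rw [hy'i, e]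
        revert hy12
        cases y₁ i <;> cases y₂ i <;> simp
    · have e2 : y i = y₂ i := by
        revert hy12 e
        cases y₁ i <;> cases y₂ i <;> cases y i <;> simp
      rw [h.congr_of_mem v i e2 (Or.inr hoR), h.congr_of_mem (y := y') v i (y' := y₁) ?_
        (Or.inr hoR)]
      · exact ho.symm
      · rw [hy'i]
        revert e
        cases y₁ i <;> cases y i <;> simp
  have hz : initBits (f (patch y v)) ≠ initBits (f (patch y' v)) := by
    intro e
    rcases Fin.eq_castSucc_or_eq_last o with ⟨o', rfl⟩ | rfl
    · exact hzo (congrFun e o')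
    · rw [coordPiece_last] at hoR
      exact h.zero i i.2 hoR
  have key := IsPeak.pieceSum_sub hT (h.zero i i.2) hpeak hz fun o ho => by
    refine h.congr v fun j hj => ?_
    by_cases hji : j = i
    · rw [hji]; exact ho
    · exact absurd (by simp [hy', hji]) hj
  rw [h.pieceSum_eq hT, h.pieceSum_eq hT, hy'i] at key
  simp only [moving, Finset.mem_filter, Finset.mem_univ, true_and, not_not] at hmov
  have hdvd : (p : ℤ) ∣ weight T f R v i (y i) - weight T f R v i (!y i) := by
    cases y i
    · rw [← neg_sub]; exact hmov.neg_right
    · exact hmov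
  -- A positive multiple of `p` is at least `p`, but the drop is at most twice the number of
  -- vertices in `R i`.
  have := Int.le_of_dvd key.1 hdvd
  have hp' : (2 * ((Finset.range (N / 2)).filter fun k => treePiece T (k + 2) ∈ R i).card : ℤ)
      < p := by exact_mod_cast hp
  omega

/-- No output bit reads more than one bit in `I`, so changing all idle bits at once looks, at each
output bit, like changing a single one. -/
lemma eval_eq_of_idle (h : IsSpread T f J I R) (v : {i // i ∉ I} → Bool)
    {y y' : {i // i ∈ I} → Bool} (hy : ∀ i, i ∉ idle f v → y i = y' i) :
    f (patch y v) = f (patch y' v) := by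
  classical
  funext o
  by_cases hex : ∃ i, y i ≠ y' i ∧ coordPiece T N o ∈ R i
  · obtain ⟨i, hi, hoR⟩ := hex
    have hidle : i ∈ idle f v := by
      by_contra hc
      exact hi (hy i hc)
    simp only [idle, Finset.mem_filter, Finset.mem_univ, true_and] at hidle
    have e1 := hidle y (Function.update y i (y' i)) fun j hj => by simp [hj]
    rw [e1]
    exact h.congr_of_mem v i (by simp) (Or.inr hoR)
  · push Not at hex
    exact h.congr v hex

/-- For fixed values of the input bits outside `I` for which many of the others are moving, the
last output bit is wrong for almost half of the inputs. -/
lemma card_wrong_ge (h : IsSpread T f J I R) (hT : 0 < T) {p : ℕ} (hp : p.Prime) (hodd : Odd p)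
    (v : {i // i ∉ I} → Bool) {s : ℕ} (hs : s ≤ (moving T p f R v).card) :
    2 ^ I.card * (1 / 2 - (1 / p + p * Real.exp (-(s : ℝ) / (2 * (p : ℝ) ^ 2))) / 2)
      ≤ ((Finset.univ.filter fun y : {i // i ∈ I} → Bool =>
          f (patch y v) (Fin.last N) ≠ pmmajmod p (initBits (f (patch y v)))).card : ℝ) := by
  classical
  obtain ⟨c, hc⟩ := h.exists_signedSum_eq hT v
  have key := abs_sum_majMod_mul_parity_le hp hodd c (fun i => weight T f R v i) s hs
  rw [Fintype.card_coe] at key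
  -- The last output bit lies in the top and is therefore constant in `y`.
  set β := f (patch (fun _ => false) v) (Fin.last N) with hβ
  have hlast : ∀ y, f (patch y v) (Fin.last N) = β := fun y =>
    h.congr v fun i _ => by rw [coordPiece_last]; exact h.zero i i.2
  set G : ({i // i ∈ I} → Bool) → ℝ := fun y =>
    (if Odd (c + ∑ i, weight T f R v i (y i)) then -1 else 1 : ℝ)
        * (if majMod p (c + ∑ i, weight T f R v i (y i)) then -1 else 1) with hG
  have h1 : ∀ y, (if f (patch y v) (Fin.last N) ≠ pmmajmod p (initBits (f (patch y v)))
      then 1 else 0 : ℝ) = 1 / 2 - (if β then -1 else 1) * G y / 2 := by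
    intro y
    rw [hlast, pmmajmod, odd_signedSum_iff, hc]
    simp only [hG]
    generalize c + ∑ i, weight T f R v i (y i) = a
    cases β <;> cases majMod p a <;> by_cases ho : Odd a <;> simp [ho] <;> norm_num
  have h2 : ((Finset.univ.filter fun y : {i // i ∈ I} → Bool =>
      f (patch y v) (Fin.last N) ≠ pmmajmod p (initBits (f (patch y v)))).card : ℝ)
      = 2 ^ I.card * (1 / 2) - (if β then -1 else 1) * (∑ y, G y) / 2 := by
    rw [← Finset.sum_boole, Finset.sum_congr rfl fun y _ => h1 y, Finset.sum_sub_distrib,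
      Finset.sum_const, Finset.card_univ, Fintype.card_fun, Fintype.card_coe, Fintype.card_bool,
      nsmul_eq_mul, Finset.mul_sum, Finset.sum_div]
    push_cast
    rfl
  have h3 : (if β then -1 else 1) * (∑ y, G y) ≤ |∑ y, G y| := by
    cases β
    · simpa using le_abs_self _
    · simpa using neg_le_abs _
  rw [h2]
  linarith

/-- There are few outputs on inputs for which many of the bits in `I` are idle. -/
lemma card_idle_outputs_le (h : IsSpread T f J I R) (s : ℕ) :
    open Classical in
    ((Finset.univ.filter fun a => ∃ (v : {i // i ∉ I} → Bool) (y : {i // i ∈ I} → Bool),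
      s ≤ (idle f v).card ∧ f (patch y v) = a).card : ℝ) ≤ 2 ^ l / 2 ^ s := by
  classical
  -- Resetting the idle bits to `false` keeps the output, so the outputs in question come from `U`.
  -- There at least `s` bits of `y` are prescribed.
  set U := Finset.univ.filter fun w : ({i // i ∉ I} → Bool) × ({i // i ∈ I} → Bool) =>
    s ≤ (idle f w.1).card ∧ ∀ i ∈ idle f w.1, w.2 i = false with hU
  have h1 : (Finset.univ.filter fun a => ∃ (v : {i // i ∉ I} → Bool) (y : {i // i ∈ I} → Bool),
      s ≤ (idle f v).card ∧ f (patch y v) = a) ⊆ U.image fun w => f (patch w.2 w.1) := by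
    intro a ha
    simp only [Finset.mem_filter, Finset.mem_univ, true_and] at ha
    obtain ⟨v, y, hs, rfl⟩ := ha
    refine Finset.mem_image.2 ⟨(v, fun i => if i ∈ idle f v then false else y i), ?_, ?_⟩
    · simp only [hU, Finset.mem_filter, Finset.mem_univ, true_and]
      exact ⟨hs, fun i hi => by simp [hi]⟩
    · exact h.eval_eq_of_idle v fun i hi => by simp [hi]
  have h2 : (U.card : ℝ) ≤ ∑ _v : {i // i ∉ I} → Bool, (2 ^ I.card / 2 ^ s : ℝ) := by
    have e : U.card = ∑ v : {i // i ∉ I} → Bool, (Finset.univ.filter fun y : {i // i ∈ I} → Bool =>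
        s ≤ (idle f v).card ∧ ∀ i ∈ idle f v, y i = false).card := by
      simp only [hU, Finset.card_filter]
      rw [Fintype.sum_prod_type]
    rw [e, Nat.cast_sum]
    refine Finset.sum_le_sum fun v _ => ?_
    by_cases hs : s ≤ (idle f v).card
    · simp only [hs, true_and]
      rw [card_filter_agree (idle f v) fun _ => false, Fintype.card_coe]
      gcongr
      norm_num
    · simp only [hs, false_and, Finset.filter_false, Finset.card_empty, Nat.cast_zero]
      positivity
  refine (Nat.cast_le.2 ((Finset.card_le_card h1).trans Finset.card_image_le)).trans
    (h2.trans (le_of_eq ?_))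
  rw [Finset.sum_const, Finset.card_univ, Fintype.card_fun, Fintype.card_bool, nsmul_eq_mul,
    Fintype.card_subtype_compl, Fintype.card_fin, Fintype.card_coe, mul_div_assoc']
  push_cast
  rw [← pow_add, Nat.sub_add_cancel (by simpa using Finset.card_le_univ I)]

end IsSpread

/-- The lower bound on the distance between the output of a local map and the target. -/
theorem le_tvDist_of_isSpread {l N T p : ℕ} (C : BoolCircuit l (N + 1))
    {J : Fin (N + 1) → Finset (Fin l)} {I : Finset (Fin l)} {R : Fin l → Finset ℕ}
    (h : IsSpread T C.eval J I R) (hT : 0 < T) (hp : p.Prime) (hodd : Odd p)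
    (hRp : ∀ i ∈ I,
      2 * ((Finset.range (N / 2)).filter fun k => treePiece T (k + 2) ∈ R i).card < p)
    (s₁ s₂ : ℕ) {ε : ℝ}
    (hε : open Classical in ((Finset.univ.filter fun z : Fin N → Bool =>
      (I.filter fun i => IsPeak T (R i) z).card < s₁ + s₂).card : ℝ) ≤ 2 ^ N * ε) :
    1 / 2 - (1 / p + p * Real.exp (-(s₁ : ℝ) / (2 * (p : ℝ) ^ 2))) / 2 - ε
      - 2 ^ l / 2 ^ s₂ / 2 ^ N ≤ tvDist C.outDist (targetDist p N) := by
  classical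
  set e₃ := (1 / p + p * Real.exp (-(s₁ : ℝ) / (2 * (p : ℝ) ^ 2))) / 2 with he₃
  have he₃0 : 0 ≤ e₃ := by positivity
  -- The test accepts strings with few peaks, strings reached with many idle bits, and strings with
  -- a wrong last bit. Under the target the first two are rare and the third never occurs; it
  -- remains to see that the circuit passes with probability almost `1 / 2`.
  set V₁ : (Fin (N + 1) → Bool) → Prop := fun a =>
    (I.filter fun i => IsPeak T (R i) (initBits a)).card < s₁ + s₂ with hV₁
  set V₂ : (Fin (N + 1) → Bool) → Prop := fun a =>
    ∃ (v : {i // i ∉ I} → Bool) (y : {i // i ∈ I} → Bool),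
      s₂ ≤ (IsSpread.idle C.eval v).card ∧ C.eval (patch y v) = a with hV₂
  set V₃ : (Fin (N + 1) → Bool) → Prop := fun a =>
    a (Fin.last N) ≠ pmmajmod p (initBits a) with hV₃
  have key := card_sub_card_le_tvDist C p fun a => V₁ a ∨ V₂ a ∨ V₃ a
  have hinit : ∀ z : Fin N → Bool, initBits (Fin.snoc z (pmmajmod p z) : Fin (N + 1) → Bool) = z :=
    fun z => by funext o; simp [initBits]
  have hright : ((Finset.univ.filter fun z : Fin N → Bool =>
      V₁ (Fin.snoc z (pmmajmod p z)) ∨ V₂ (Fin.snoc z (pmmajmod p z))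
        ∨ V₃ (Fin.snoc z (pmmajmod p z))).card : ℝ) ≤ 2 ^ N * ε + 2 ^ l / 2 ^ s₂ := by
    have hsub : (Finset.univ.filter fun z : Fin N → Bool =>
        V₁ (Fin.snoc z (pmmajmod p z)) ∨ V₂ (Fin.snoc z (pmmajmod p z))
          ∨ V₃ (Fin.snoc z (pmmajmod p z)))
        ⊆ (Finset.univ.filter fun z : Fin N → Bool =>
            (I.filter fun i => IsPeak T (R i) z).card < s₁ + s₂)
          ∪ (Finset.univ.filter fun a => V₂ a).image initBits := by
      intro z hz
      simp only [Finset.mem_filter, Finset.mem_univ, true_and, Finset.mem_union,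
        Finset.mem_image] at hz ⊢
      rcases hz with hz | hz | hz
      · left; simpa only [hV₁, hinit] using hz
      · exact Or.inr ⟨_, hz, hinit z⟩
      · refine absurd hz ?_
        simp [hV₃, hinit]
    refine (Nat.cast_le.2 ((Finset.card_le_card hsub).trans
      ((Finset.card_union_le _ _).trans (add_le_add le_rfl Finset.card_image_le)))).trans ?_
    rw [Nat.cast_add]
    refine add_le_add hε ?_
    convert h.card_idle_outputs_le s₂
  have hleft : 2 ^ l * (1 / 2 - e₃) ≤ ((Finset.univ.filter fun u =>
      V₁ (C.eval u) ∨ V₂ (C.eval u) ∨ V₃ (C.eval u)).card : ℝ) := by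
    have hIl : I.card ≤ l := by simpa using Finset.card_le_univ I
    have e : (2 : ℝ) ^ l * (1 / 2 - e₃)
        = ∑ _v : {i // i ∉ I} → Bool, 2 ^ I.card * (1 / 2 - e₃) := by
      rw [Finset.sum_const, Finset.card_univ, Fintype.card_fun, Fintype.card_bool, nsmul_eq_mul,
        Fintype.card_subtype_compl, Fintype.card_fin, Fintype.card_coe]
      push_cast
      rw [← mul_assoc, ← pow_add, Nat.sub_add_cancel hIl]
    rw [e, card_filter_patch (I := I), Nat.cast_sum]
    refine Finset.sum_le_sum fun v _ => ?_
    -- Which bits move and which idle depends on `v` alone. With few moving bits, every output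
    -- passes: either many bits are idle, or there are few peaks, since each peak needs a moving or
    -- idle bit.
    by_cases hm : s₁ ≤ (IsSpread.moving T p C.eval R v).card
    · refine (h.card_wrong_ge hT hp hodd v hm).trans (Nat.cast_le.2 (Finset.card_le_card ?_))
      exact Finset.monotone_filter_right _ fun y _ hy => Or.inr (Or.inr hy)
    · have hall : ∀ y : {i // i ∈ I} → Bool,
          V₁ (C.eval (patch y v)) ∨ V₂ (C.eval (patch y v)) ∨ V₃ (C.eval (patch y v)) := by
        intro y
        by_cases hi : s₂ ≤ (IsSpread.idle C.eval v).card
        · exact Or.inr (Or.inl ⟨v, y, hi, rfl⟩)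
        · left
          have hsub : (I.filter fun i => IsPeak T (R i) (initBits (C.eval (patch y v))))
              ⊆ (IsSpread.moving T p C.eval R v ∪ IsSpread.idle C.eval v).map
                (Function.Embedding.subtype _) := by
            intro i hi
            rw [Finset.mem_filter] at hi
            have := h.mem_moving_or_mem_idle hT (p := p) y v ⟨i, hi.1⟩ (hRp i hi.1) hi.2
            rw [Finset.mem_map]
            exact ⟨⟨i, hi.1⟩, Finset.mem_union.2 this, rfl⟩
          have h1 := Finset.card_le_card hsub
          rw [Finset.card_map] at h1
          have h2 := Finset.card_union_le (IsSpread.moving T p C.eval R v) (IsSpread.idle C.eval v)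
          simp only [hV₁]
          omega
      rw [Finset.filter_true_of_mem fun y _ => hall y, Finset.card_univ, Fintype.card_fun,
        Fintype.card_coe, Fintype.card_bool]
      push_cast
      nlinarith [pow_pos (two_pos : (0 : ℝ) < 2) I.card]
  have hl : (0 : ℝ) < 2 ^ l := by positivity
  have hN : (0 : ℝ) < 2 ^ N := by positivity
  have h1 : 1 / 2 - e₃ ≤ ((Finset.univ.filter fun u =>
      V₁ (C.eval u) ∨ V₂ (C.eval u) ∨ V₃ (C.eval u)).card : ℝ) / 2 ^ l := by
    rw [le_div_iff₀ hl]; linarith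
  have h2 : ((Finset.univ.filter fun z : Fin N → Bool =>
      V₁ (Fin.snoc z (pmmajmod p z)) ∨ V₂ (Fin.snoc z (pmmajmod p z))
        ∨ V₃ (Fin.snoc z (pmmajmod p z))).card : ℝ) / 2 ^ N ≤ ε + 2 ^ l / 2 ^ s₂ / 2 ^ N := by
    rw [div_le_iff₀ hN, add_mul, div_mul_cancel₀ _ hN.ne']; linarith
  linarith

/-! ### Extracting a spread set and fixing the parameters -/

lemma card_filter_coordPiece_zero_le {N T : ℕ} (hT : 0 < T) :
    (Finset.univ.filter fun o : Fin (N + 1) => coordPiece T N o = 0).card ≤ 2 * T + 2 := by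
  have hsub : (Finset.univ.filter fun o : Fin (N + 1) => coordPiece T N o = 0).map Fin.valEmbedding
      ⊆ (Finset.range T ∪ (Finset.range T).image (fun k => N / 2 + k))
        ∪ {2 * (N / 2), 2 * (N / 2) + 1} := by
    intro o ho
    simp only [Finset.mem_map, Finset.mem_filter, Finset.mem_univ, true_and,
      Fin.valEmbedding_apply] at ho
    obtain ⟨a, ha, rfl⟩ := ho
    simp only [Finset.mem_union, Finset.mem_image, Finset.mem_range, Finset.mem_insert,
      Finset.mem_singleton]
    have haN := a.2
    rcases lt_or_ge (a : ℕ) (N / 2) with h | h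
    · rw [coordPiece_edge h] at ha
      have := treePiece_eq_zero hT ha
      left; left; omega
    rcases lt_or_ge (a : ℕ) (2 * (N / 2)) with ho' | ho'
    · have hk : (a : ℕ) - N / 2 < N / 2 := by omega
      have hko : N / 2 + ((a : ℕ) - N / 2) = a := by omega
      rw [← hko, coordPiece_vertex hk] at ha
      have := treePiece_eq_zero hT ha
      left; right; exact ⟨_, by omega, hko⟩
    · right; omega
  have h1 := Finset.card_le_card hsub
  rw [Finset.card_map] at h1
  refine h1.trans ((Finset.card_union_le _ _).trans ?_)
  have h2 := Finset.card_union_le (Finset.range T) ((Finset.range T).image (fun k => N / 2 + k))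
  have h3 : ((Finset.range T).image (fun k => N / 2 + k)).card ≤ T :=
    Finset.card_image_le.trans (by simp)
  have h4 : ({2 * (N / 2), 2 * (N / 2) + 1} : Finset ℕ).card ≤ 2 := Finset.card_le_two
  rw [Finset.card_range] at h2
  omega

lemma card_filter_coordPiece_le {N T m ρ : ℕ} (hρ : ρ ≠ 0) (hm : ((Finset.range (N / 2)).filter
      fun k => treePiece T (k + 2) = ρ).card ≤ m) :
    (Finset.univ.filter fun o : Fin (N + 1) => coordPiece T N o = ρ).card ≤ 2 * m := by
  have hsub : (Finset.univ.filter fun o : Fin (N + 1) => coordPiece T N o = ρ)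
      ⊆ (pieceCoords T N {ρ}).map Fin.castSuccEmb := by
    intro o ho
    simp only [Finset.mem_filter, Finset.mem_univ, true_and] at ho
    rcases Fin.eq_castSucc_or_eq_last o with ⟨o', rfl⟩ | rfl
    · exact Finset.mem_map.2 ⟨o', by simpa [pieceCoords] using ho, rfl⟩
    · rw [IsSpread.coordPiece_last] at ho
      exact absurd ho.symm hρ
  have h1 := Finset.card_le_card hsub
  rw [Finset.card_map] at h1
  refine h1.trans ((card_pieceCoords_le (by simpa using hρ.symm)).trans ?_)
  gcongr
  simpa using hm

/-- The input bits of a local map contain a large set that is spread out. -/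
lemma exists_isSpread {l N T k m : ℕ} (f : (Fin l → Bool) → Fin (N + 1) → Bool)
    (J : Fin (N + 1) → Finset (Fin l)) (hdep : ∀ o, DependsOn (fun u => f u o) (J o : Set (Fin l)))
    (hJ : ∀ o, (J o).card ≤ k) (hk : 0 < k) (hT : 0 < T) (hm : 2 * (N / 2 + 1) ≤ m * T) :
    ∃ I R, IsSpread T f J I R
      ∧ (∀ i ∈ I, ((Finset.range (N / 2)).filter fun j => treePiece T (j + 2) ∈ R i).card
          ≤ 4 * k * m)
      ∧ 4 * l ≤ 4 * (I.card * (8 * k ^ 2 * m + 1)) + 4 * (k * (2 * T + 2)) + (N + 1) := by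
  classical
  have hpiece : ∀ ρ, ρ ≠ 0 →
      ((Finset.range (N / 2)).filter fun k => treePiece T (k + 2) = ρ).card ≤ m := fun ρ hρ =>
    Nat.le_of_mul_le_mul_right ((card_treePiece_mul_le hT hρ (N / 2)).trans hm) hT
  set D : Fin l → Finset (Fin (N + 1)) := fun i => Finset.univ.filter fun o => i ∈ J o with hD
  set R : Fin l → Finset ℕ := fun i => (D i).image fun o : Fin (N + 1) => coordPiece T N o with hR
  -- The usable inputs do not touch the top and influence at most `4k` output bits, four times the
  -- average degree if there are as many inputs as outputs.
  set V := Finset.univ.filter fun i => (∀ o, i ∈ J o → coordPiece T N o ≠ 0) ∧ (D i).card ≤ 4 * k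
    with hV
  have hV0 : ∀ i ∈ V, 0 ∉ R i := by
    intro i hi h0
    simp only [hV, hR, hD, Finset.mem_filter, Finset.mem_univ, true_and, Finset.mem_image] at hi h0
    obtain ⟨o, ho, h⟩ := h0
    exact hi.1 o ho h
  have hRc : ∀ i ∈ V, (R i).card ≤ 4 * k := fun i hi =>
    Finset.card_image_le.trans (Finset.mem_filter.1 hi).2.2
  -- Two inputs conflict if they reach a common piece. An input reaches at most `4k` pieces, a piece
  -- has at most `2m` output bits, and each of these reads at most `k` inputs.
  obtain ⟨I, hIV, hind, hcard⟩ := exists_independent V (fun i j => ¬ Disjoint (R i) (R j))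
    (fun i j h h' => h h'.symm) (8 * k ^ 2 * m + 1) (by
      intro i hi
      refine (Finset.card_insert_le _ _).trans (Nat.add_le_add_right ?_ 1)
      have hsub : V.filter (fun j => ¬ Disjoint (R i) (R j)) ⊆ (R i).biUnion fun ρ =>
          (Finset.univ.filter fun o : Fin (N + 1) => coordPiece T N o = ρ).biUnion J := by
        intro j hj
        rw [Finset.mem_filter, Finset.not_disjoint_iff] at hj
        obtain ⟨_, ρ, hρ, hρj⟩ := hj
        simp only [hR, hD, Finset.mem_image, Finset.mem_filter, Finset.mem_univ, true_and] at hρj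
        obtain ⟨o, ho, hoρ⟩ := hρj
        simp only [Finset.mem_biUnion, Finset.mem_filter, Finset.mem_univ, true_and]
        exact ⟨ρ, hρ, o, hoρ, ho⟩
      calc _ ≤ _ := Finset.card_le_card hsub
        _ ≤ (R i).card * (2 * m * k) := by
            refine Finset.card_biUnion_le_card_mul _ _ _ fun ρ hρ => ?_
            have hρ0 : ρ ≠ 0 := fun h => hV0 i hi (h ▸ hρ)
            exact (Finset.card_biUnion_le_card_mul _ _ k fun o _ => hJ o).trans
              (Nat.mul_le_mul_right _ (card_filter_coordPiece_le hρ0 (hpiece ρ hρ0)))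
        _ ≤ 4 * k * (2 * m * k) := Nat.mul_le_mul_right _ (hRc i hi)
        _ = 8 * k ^ 2 * m := by ring)
  refine ⟨I, R, ⟨hdep, fun i _ o ho => ?_, fun i hi => hV0 i (hIV hi),
    fun i hi j hj hij => not_not.1 (hind i hi j hj hij)⟩, fun i hi => ?_, ?_⟩
  · exact Finset.mem_image.2 ⟨o, by simpa [hD] using ho, rfl⟩
  · refine (card_filter_mem_le (R i) m fun ρ hρ => hpiece ρ fun h => hV0 i (hIV hi) (h ▸ hρ)).trans ?_
    exact Nat.mul_le_mul_right _ (hRc i (hIV hi))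
  -- The discarded inputs: `A` touches the top, and `B` has large degree. Double counting the pairs
  -- of an output and an input that it reads bounds `4 |B|` by `N + 1`.
  · set A := (Finset.univ.filter fun o : Fin (N + 1) => coordPiece T N o = 0).biUnion J with hA
    set B := Finset.univ.filter fun i => 4 * k < (D i).card with hB
    have hA1 : A.card ≤ k * (2 * T + 2) := by
      refine (Finset.card_biUnion_le_card_mul _ _ k fun o _ => hJ o).trans ?_
      rw [mul_comm]
      exact Nat.mul_le_mul_left _ (card_filter_coordPiece_zero_le hT)
    have hB1 : 4 * B.card ≤ N + 1 := by
      have h1 : ∑ i, (D i).card = ∑ o, (J o).card := by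
        simp only [hD, Finset.card_filter]
        rw [Finset.sum_comm]
        refine Finset.sum_congr rfl fun o _ => ?_
        rw [← Finset.card_filter]
        congr 1
        ext; simp
      have h2 : ∑ o, (J o).card ≤ (N + 1) * k := by
        refine (Finset.sum_le_card_nsmul _ _ k fun o _ => hJ o).trans ?_
        simp
      have h3 : B.card * (4 * k) ≤ ∑ i, (D i).card := by
        rw [← smul_eq_mul]
        refine (Finset.card_nsmul_le_sum B (fun i => (D i).card) (4 * k) fun i hi => ?_).trans
          (Finset.sum_le_sum_of_subset (Finset.subset_univ _))
        exact (Finset.mem_filter.1 hi).2.le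
      refine Nat.le_of_mul_le_mul_right (c := k) ?_ hk
      calc 4 * B.card * k = B.card * (4 * k) := by ring
        _ ≤ _ := h3.trans (h1.le.trans h2)
    have hcov : (Finset.univ : Finset (Fin l)) ⊆ V ∪ A ∪ B := by
      intro i _
      by_contra hcon
      simp only [Finset.mem_union, not_or] at hcon
      obtain ⟨⟨h1, h2⟩, h3⟩ := hcon
      refine h1 ?_
      simp only [hV, Finset.mem_filter, Finset.mem_univ, true_and]
      constructor
      · intro o ho h0
        exact h2 (Finset.mem_biUnion.2 ⟨o, by simpa using h0, ho⟩)
      · simpa [hB] using h3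
    have := (Finset.card_le_card hcov).trans ((Finset.card_union_le _ _).trans
      (Nat.add_le_add_right (Finset.card_union_le _ _) _))
    rw [Finset.card_univ, Fintype.card_fin] at this
    omega

/-- With too few input bits, a circuit reaches only a small part of the support of the target. -/
lemma half_le_tvDist_of_lt {l N p : ℕ} (C : BoolCircuit l (N + 1)) (hl : l < N) :
    1 / 2 ≤ tvDist C.outDist (targetDist p N) := by
  classical
  have key := card_sub_card_le_tvDist C p fun a => ∃ u, C.eval u = a
  have h1 : (Finset.univ.filter fun u => ∃ u', C.eval u' = C.eval u).card = 2 ^ l := by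
    rw [Finset.filter_true_of_mem fun u _ => ⟨u, rfl⟩]
    simp
  have h2 : (Finset.univ.filter fun z : Fin N → Bool =>
      ∃ u, C.eval u = Fin.snoc z (pmmajmod p z)).card ≤ 2 ^ l := by
    have hsub : (Finset.univ.filter fun z : Fin N → Bool =>
        ∃ u, C.eval u = Fin.snoc z (pmmajmod p z))
        ⊆ Finset.univ.image fun u => initBits (C.eval u) := by
      intro z hz
      obtain ⟨u, hu⟩ := (Finset.mem_filter.1 hz).2
      refine Finset.mem_image.2 ⟨u, Finset.mem_univ _, ?_⟩
      rw [hu]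
      funext o
      simp [initBits]
    refine (Finset.card_le_card hsub).trans (Finset.card_image_le.trans ?_)
    simp
  rw [h1] at key
  have h3 : ((2 ^ l : ℕ) : ℝ) / 2 ^ N ≤ 1 / 2 := by
    rw [div_le_iff₀ (by positivity)]
    have : (2 : ℝ) ^ (l + 1) ≤ 2 ^ N := pow_le_pow_right₀ one_le_two hl
    rw [pow_succ] at this
    push_cast
    linarith
  have h4 := div_le_div_of_nonneg_right (Nat.cast_le (α := ℝ).2 h2)
    (by positivity : (0 : ℝ) ≤ 2 ^ N)
  have h5 : ((2 ^ l : ℕ) : ℝ) / 2 ^ l = 1 := by push_cast; exact div_self (by positivity)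
  linarith

/-- The distance between the output of a circuit with `k`-local outputs and the target. -/
lemma le_tvDist_of_isJunta {l N k p s : ℕ} (C : BoolCircuit l (N + 1))
    (hC : ∀ o, BoolCircuit.IsJunta k fun u => C.eval u o) (hk : 0 < k) (hkN : 16 * k + 8 ≤ N + 1)
    (hl : N ≤ l) (hp : p.Prime) (hodd : Odd p) (hpk : 512 * k ^ 2 < p) {X : ℝ} (hX0 : 0 < X)
    (hX : X * (1026 * k ^ 3 * 2 ^ (512 * k ^ 2)) ≤ N + 1) (hs : 4 * (s : ℝ) ≤ X) :
    1 / 2 - (1 / p + p * Real.exp (-(s : ℝ) / (2 * (p : ℝ) ^ 2))) / 2 - 4 / X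
      - 2 ^ l / 2 ^ s / 2 ^ N ≤ tvDist C.outDist (targetDist p N) := by
  classical
  choose J hJ hdep using hC
  -- Small enough that the top costs only a fraction of the inputs, large enough that pieces have at
  -- most `64k` vertices.
  set T := (N + 1) / (16 * k) with hTdef
  have h16 : 0 < 16 * k := by omega
  have hT : 0 < T := Nat.div_pos (by omega) h16
  have hT1 : 16 * k * T ≤ N + 1 := Nat.mul_div_le _ _
  have hT2 : N + 1 < 16 * k * (T + 1) := Nat.lt_mul_div_succ _ h16
  have hkT : k ≤ k * T := Nat.le_mul_of_pos_right _ hT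
  obtain ⟨I, R, hI, hIm, hIc⟩ := exists_isSpread (m := 64 * k) C.eval J hdep hJ hk hT (by
    have e1 : 64 * k * T = 64 * (k * T) := by ring
    have e2 : 16 * k * (T + 1) = 16 * (k * T) + 16 * k := by ring
    omega)
  have hm : 4 * k * (64 * k) = 256 * k ^ 2 := by ring
  rw [hm] at hIm
  -- Insert `l ≥ N` into the count of inputs. The top costs at most `2kT + 2k`, and `16kT` and `16k
  -- + 8` are at most `N + 1`, so at least half of `N + 1` remains for the conflict graph with its
  -- `513 k³` bound.
  have hIcard : N + 1 ≤ I.card * (1026 * k ^ 3) := by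
    have e1 : I.card * (8 * k ^ 2 * (64 * k) + 1) = 512 * (I.card * k ^ 3) + I.card := by ring
    have e2 : I.card * (1026 * k ^ 3) = 1026 * (I.card * k ^ 3) := by ring
    have e3 : k * (2 * T + 2) = 2 * (k * T) + 2 * k := by ring
    have e4 : 16 * k * T = 16 * (k * T) := by ring
    have e5 : I.card ≤ I.card * k ^ 3 := Nat.le_mul_of_pos_right _ (by positivity)
    rw [e1, e3] at hIc
    omega
  refine le_tvDist_of_isSpread C hI hT hp hodd (fun i hi => ?_) s s ?_
  · have := hIm i hi
    omega
  -- A group has at most `4k` pieces of at most `64k` vertices, each with two bits: `512k²` bits to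
  -- prescribe.
  · have key := card_few_peaks_le (N := N) (T := T) I R hI.zero hI.disj (m := 512 * k ^ 2)
      (fun i hi => (card_pieceCoords_le (hI.zero i hi)).trans (by have := hIm i hi; omega))
      hX0 (by
        rw [le_div_iff₀ (by positivity)]
        have h1 : ((N + 1 : ℕ) : ℝ) ≤ ((I.card * (1026 * k ^ 3) : ℕ) : ℝ) := Nat.cast_le.2 hIcard
        push_cast at h1
        have h2 : (0 : ℝ) < 1026 * k ^ 3 := by positivity
        refine le_of_mul_le_mul_right ?_ h2
        calc X * 2 ^ (512 * k ^ 2) * (1026 * (k : ℝ) ^ 3)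
            = X * (1026 * k ^ 3 * 2 ^ (512 * k ^ 2)) := by ring
          _ ≤ _ := hX.trans h1)
    refine le_trans (Nat.cast_le.2 (Finset.card_le_card ?_)) key
    refine Finset.monotone_filter_right _ fun z _ hz => ?_
    have : ((I.filter fun i => IsPeak T (R i) z).card : ℝ) ≤ ((s + s : ℕ) : ℝ) :=
      Nat.cast_le.2 (le_of_lt hz)
    push_cast at this
    linarith

/-! ### Asymptotics of the error terms -/

lemma tendsto_log_mul_rpow_neg {r : ℝ} (hr : 0 < r) :
    Tendsto (fun x : ℝ => Real.log x * x ^ (-r)) atTop (nhds 0) := by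
  have := (isLittleO_log_rpow_atTop hr).tendsto_div_nhds_zero
  refine this.congr' ?_
  filter_upwards [eventually_gt_atTop 0] with x hx
  rw [Real.rpow_neg hx.le, div_eq_mul_inv]

lemma tendsto_rpow_mul_exp_neg_rpow {s η b : ℝ} (hη : 0 < η) (hb : 0 < b) :
    Tendsto (fun x : ℝ => x ^ s * Real.exp (-b * x ^ η)) atTop (nhds 0) := by
  have := (tendsto_rpow_mul_exp_neg_mul_atTop_nhds_zero (s / η) b hb).comp
    (tendsto_rpow_atTop hη)
  refine this.congr' ?_
  filter_upwards [eventually_gt_atTop 0] with x hx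
  simp only [Function.comp]
  rw [← Real.rpow_mul hx.le, mul_div_cancel₀ _ hη.ne']

/-- The requirements of the depth bound at `x = n`: room for the loss from locality, for `512k² < p`
and for `16k + 8 ≤ n`, and a bound `1 / (4 log x)` for each of the four error terms. The last is
what a gap `g` with `g n * log n → ∞` contradicts. -/
lemma eventually_error_bounds {δ α β c₁ c₂ : ℝ} (hα0 : 0 < α) (hα : α < 1 / 3) (hδβ : δ < β)
    (hβ23 : 2 / 3 < β) (hβ1 : β < 1) (hc₁ : 0 < c₁) (hc₂ : 0 < c₂) :
    ∀ᶠ x : ℝ in atTop, 1 < Real.log x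
      ∧ 600 * Real.log x ^ (1 / 2 : ℝ) ≤ (1 - β) * Real.log x
      ∧ 512 * Real.log x ^ (1 / 2 : ℝ) < c₁ * x ^ α
      ∧ 24 * x ^ (1 / 2 : ℝ) ≤ x
      ∧ Real.log x / (c₁ * x ^ α) ≤ 1 / 4
      ∧ c₂ * x ^ α * Real.exp (-(x ^ β / 8) / (2 * (c₂ * x ^ α) ^ 2)) * Real.log x ≤ 1 / 4
      ∧ 4 / x ^ β * Real.log x ≤ 1 / 4
      ∧ (2 : ℝ) ^ (1 + x ^ δ - x ^ β / 8) * Real.log x ≤ 1 / 4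
      ∧ 8 ≤ x ^ β := by
  have hβ0 : 0 < β := by linarith
  have hlog := Real.tendsto_log_atTop
  have hhalf := tendsto_rpow_atTop (by norm_num : (0 : ℝ) < 1 / 2)
  have hdecay : ∀ c r ε : ℝ, 0 < r → 0 < ε →
      ∀ᶠ x : ℝ in atTop, c * (Real.log x * x ^ (-r)) < ε := fun c r ε hr hε => by
    have := (tendsto_log_mul_rpow_neg hr).const_mul c
    rw [mul_zero] at this
    exact this.eventually_lt_const hε
  have hexp : ∀ c s η b ε : ℝ, 0 < η → 0 < b → 0 < ε →
      ∀ᶠ x : ℝ in atTop, c * (x ^ s * Real.exp (-b * x ^ η)) < ε := fun c s η b ε hη hb hε => by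
    have := (tendsto_rpow_mul_exp_neg_rpow (s := s) hη hb).const_mul c
    rw [mul_zero] at this
    exact this.eventually_lt_const hε
  have hη : 0 < β - 2 * α := by linarith
  filter_upwards [eventually_gt_atTop 1, hlog.eventually_gt_atTop 1,
    (hhalf.comp hlog).eventually_ge_atTop (600 / (1 - β)), hdecay 512 α c₁ hα0 hc₁,
    hhalf.eventually_ge_atTop 24, hdecay (1 / c₁) α (1 / 4) hα0 (by norm_num),
    hexp c₂ (α + 1) (β - 2 * α) (1 / (16 * c₂ ^ 2)) (1 / 4) hη (by positivity) (by norm_num),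
    hdecay 4 β (1 / 4) hβ0 (by norm_num),
    hexp 2 1 β (Real.log 2 / 16) (1 / 4) hβ0 (by positivity) (by norm_num),
    (tendsto_rpow_atTop (by linarith : 0 < β - δ)).eventually_ge_atTop 16,
    (tendsto_rpow_atTop hβ0).eventually_ge_atTop 8]
    with x hx1 a1 a2 a3 a4 a5 a6 a7 a8 a9 a10
  have hx0 : 0 < x := by linarith
  have hl0 : 0 < Real.log x := by linarith
  have hsplit : ∀ y : ℝ, 0 < y → y ^ (1 / 2 : ℝ) * y ^ (1 / 2 : ℝ) = y := fun y hy => by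
    rw [← Real.rpow_add hy]; norm_num
  have hlx : Real.log x ≤ x := Real.log_le_self hx0.le
  refine ⟨a1, ?_, ?_, ?_, ?_, ?_, ?_, ?_, a10⟩
  · rw [Function.comp_apply, div_le_iff₀ (by linarith)] at a2
    calc 600 * Real.log x ^ (1 / 2 : ℝ)
        ≤ (Real.log x ^ (1 / 2 : ℝ) * (1 - β)) * Real.log x ^ (1 / 2 : ℝ) := by gcongr
      _ = (1 - β) * (Real.log x ^ (1 / 2 : ℝ) * Real.log x ^ (1 / 2 : ℝ)) := by ring
      _ = _ := by rw [hsplit _ hl0]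
  · have e1 : Real.log x ^ (1 / 2 : ℝ) ≤ Real.log x := by
      conv_rhs => rw [← Real.rpow_one (Real.log x)]
      exact Real.rpow_le_rpow_of_exponent_le a1.le (by norm_num)
    rw [Real.rpow_neg hx0.le, ← div_eq_mul_inv, mul_div_assoc', div_lt_iff₀ (by positivity)] at a3
    linarith
  · calc 24 * x ^ (1 / 2 : ℝ) ≤ x ^ (1 / 2 : ℝ) * x ^ (1 / 2 : ℝ) := by gcongr
      _ = x := hsplit x hx0
  · rw [Real.rpow_neg hx0.le] at a5
    refine le_of_eq_of_le ?_ a5.le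
    field_simp
  · refine le_trans ?_ a6.le
    have e1 : -(x ^ β / 8) / (2 * (c₂ * x ^ α) ^ 2) = -(1 / (16 * c₂ ^ 2)) * x ^ (β - 2 * α) := by
      rw [Real.rpow_sub hx0, mul_comm 2 α, Real.rpow_mul hx0.le, Real.rpow_two]
      field_simp
      ring
    rw [e1, Real.rpow_add hx0, Real.rpow_one]
    calc c₂ * x ^ α * Real.exp (-(1 / (16 * c₂ ^ 2)) * x ^ (β - 2 * α)) * Real.log x
        ≤ c₂ * x ^ α * Real.exp (-(1 / (16 * c₂ ^ 2)) * x ^ (β - 2 * α)) * x := by gcongr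
      _ = _ := by ring
  · rw [Real.rpow_neg hx0.le] at a7
    refine le_of_eq_of_le ?_ a7.le
    field_simp
  · refine le_trans ?_ a8.le
    have e1 : x ^ δ ≤ x ^ β / 16 := by
      have : x ^ β = x ^ (β - δ) * x ^ δ := by rw [← Real.rpow_add hx0]; ring_nf
      have h0 : 0 < x ^ δ := by positivity
      nlinarith
    have e2 : (2 : ℝ) ^ (1 + x ^ δ - x ^ β / 8) ≤ 2 * Real.exp (-(Real.log 2 / 16) * x ^ β) := by
      calc (2 : ℝ) ^ (1 + x ^ δ - x ^ β / 8) ≤ 2 ^ (1 + (-(x ^ β / 16))) :=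
            Real.rpow_le_rpow_of_exponent_le one_le_two (by linarith)
        _ = _ := by
          rw [Real.rpow_add two_pos, Real.rpow_one, Real.rpow_def_of_pos two_pos]
          congr 2; ring
    rw [Real.rpow_one]
    calc _ ≤ 2 * Real.exp (-(Real.log 2 / 16) * x ^ β) * x := by gcongr
      _ = _ := by ring

/-- The factors are at most `2 ^ (11 k²)`, `2 ^ (3 k²)` and `2 ^ (512 k²)`, and `2 ≤ e`. -/
lemma locality_loss_le {k : ℕ} (hk : 0 < k) :
    (1026 : ℝ) * k ^ 3 * 2 ^ (512 * k ^ 2) ≤ Real.exp (600 * k ^ 2) := by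
  have a1 : (1026 : ℝ) ≤ 2 ^ (11 * k ^ 2) := by
    calc (1026 : ℝ) ≤ 2 ^ 11 := by norm_num
      _ ≤ _ := pow_le_pow_right₀ one_le_two (by nlinarith)
  have a2 : (k : ℝ) ^ 3 ≤ 2 ^ (3 * k ^ 2) := by
    have : (k : ℝ) ≤ 2 ^ k := by exact_mod_cast Nat.lt_two_pow_self.le
    calc (k : ℝ) ^ 3 ≤ (2 ^ k) ^ 3 := by gcongr
      _ = 2 ^ (3 * k) := by rw [← pow_mul, mul_comm]
      _ ≤ _ := pow_le_pow_right₀ one_le_two (by nlinarith)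
  have a3 : (2 : ℝ) ≤ Real.exp 1 := by have := Real.add_one_le_exp 1; linarith
  calc (1026 : ℝ) * k ^ 3 * 2 ^ (512 * k ^ 2)
      ≤ 2 ^ (11 * k ^ 2) * 2 ^ (3 * k ^ 2) * 2 ^ (512 * k ^ 2) := by gcongr
    _ = 2 ^ (526 * k ^ 2) := by rw [← pow_add, ← pow_add]; congr 1; ring
    _ ≤ (Real.exp 1) ^ (526 * k ^ 2) := by gcongr
    _ = Real.exp (526 * k ^ 2) := by rw [← Real.exp_nat_mul]; push_cast; ring_nf
    _ ≤ _ := by gcongr; norm_num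

/-- The lower bound on the depth of classical circuits. -/
theorem exists_depth_lower_bound {δ α : ℝ} (hδ : δ < 1) (hα0 : 0 < α) (hα : α < 1 / 3)
    (p : ℕ → ℕ) (hp : ∀ n, (p n).Prime) (hodd : ∀ n, Odd (p n)) {c₁ c₂ : ℝ} (hc₁ : 0 < c₁)
    (hc₂ : 0 < c₂) (hp₁ : ∀ᶠ n : ℕ in atTop, c₁ * (n : ℝ) ^ α ≤ p n)
    (hp₂ : ∀ᶠ n : ℕ in atTop, (p n : ℝ) ≤ c₂ * (n : ℝ) ^ α) :
    ∃ c : ℝ, 0 < c ∧ ∀ g : ℕ → ℝ,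
      Tendsto (fun n : ℕ => g n * Real.log n) atTop atTop →
      ∀ᶠ N : ℕ in atTop, ∀ l : ℕ,
        (l : ℝ) ≤ ((N + 1 : ℕ) : ℝ) + ((N + 1 : ℕ) : ℝ) ^ δ →
        ∀ C : BoolCircuit l (N + 1),
          tvDist C.outDist (targetDist (p (N + 1)) N) ≤ 1 / 2 - g (N + 1) →
          c * Real.log (Real.log ((N + 1 : ℕ) : ℝ)) ≤ (C.depth : ℝ) := by
  -- A depth below `(1/4) log log n` gives `k = 2 ^ depth ≤ (log n)^(1/4)`. Then `k²` is at most
  -- `√(log n)`, and `exp(600 k²)` stays below `n ^ (1 - β)`.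
  refine ⟨1 / 4, by norm_num, fun g hg => ?_⟩
  -- About `n ^ β` peaks are used. The bound `β < 1` pays for locality, `β > δ` lets the idle bits
  -- outweigh the surplus random bits, and `β > 2/3 > 2α` gives far more moving bits than `p²`.
  obtain ⟨β, hβ, hβ1⟩ := exists_between (max_lt hδ (by norm_num : (2 / 3 : ℝ) < 1))
  have hδβ : δ < β := (le_max_left _ _).trans_lt hβ
  have hβ23 : 2 / 3 < β := (le_max_right _ _).trans_lt hβ
  have hreal := eventually_error_bounds hα0 hα hδβ hβ23 hβ1 hc₁ hc₂
  have hnat : ∀ᶠ n : ℕ in atTop, 1 ≤ g n * Real.log n := hg.eventually_ge_atTop 1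
  have hall := (((tendsto_natCast_atTop_atTop (R := ℝ)).eventually hreal).and
    (hnat.and (hp₁.and hp₂)))
  filter_upwards [(tendsto_add_atTop_nat 1).eventually hall] with N hN l hl C hC
  obtain ⟨⟨h1, h2, h3, h4, h5, h6, h7, h8, h9⟩, hgN, hpN₁, hpN₂⟩ := hN
  by_contra hcon
  push Not at hcon
  set n : ℝ := ((N + 1 : ℕ) : ℝ) with hn
  have hn0 : 0 < n := by rw [hn]; positivity
  set P := p (N + 1) with hP
  have hlog0 : 0 < Real.log n := by linarith
  have hg0 : 0 < g (N + 1) := by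
    by_contra h
    push Not at h
    have := mul_nonpos_of_nonpos_of_nonneg h hlog0.le
    linarith
  rcases lt_or_ge l N with hlN | hlN
  · have := half_le_tvDist_of_lt (p := P) C hlN
    linarith
  set k := 2 ^ C.depth with hk
  have hkR : (k : ℝ) ≤ Real.log n ^ (1 / 4 : ℝ) := by
    have e2 : ((2 ^ C.depth : ℕ) : ℝ) = Real.exp (C.depth * Real.log 2) := by
      rw [Real.exp_nat_mul, Real.exp_log two_pos]; push_cast; rfl
    rw [hk, Real.rpow_def_of_pos hlog0, e2]
    apply Real.exp_le_exp.2
    have := Real.log_two_lt_d9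
    have hd : (0 : ℝ) ≤ C.depth := Nat.cast_nonneg _
    have := mul_le_of_le_one_right hd (by linarith : Real.log 2 ≤ 1)
    linarith
  have hk0 : 0 < k := by positivity
  have hk2 : (k : ℝ) ^ 2 ≤ Real.log n ^ (1 / 2 : ℝ) := by
    calc (k : ℝ) ^ 2 ≤ (Real.log n ^ (1 / 4 : ℝ)) ^ 2 := by gcongr
      _ = _ := by rw [← Real.rpow_natCast, ← Real.rpow_mul hlog0.le]; norm_num
  have hk1 : (1 : ℝ) ≤ k := by exact_mod_cast hk0
  set s := ⌊n ^ β / 4⌋₊ with hs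
  have hX0 : 0 < n ^ β := by positivity
  have hs1 : 4 * (s : ℝ) ≤ n ^ β := by
    have := Nat.floor_le (by positivity : 0 ≤ n ^ β / 4)
    rw [← hs] at this
    linarith
  have hs2 : n ^ β / 8 ≤ s := by
    have := Nat.lt_floor_add_one (n ^ β / 4)
    rw [← hs] at this
    linarith
  have key := le_tvDist_of_isJunta (p := P) (s := s) (X := n ^ β) C C.isJunta_eval hk0 ?_ hlN
    (hp _) (hodd _) ?_ hX0 ?_ hs1
  · -- the errors are too small
    have hP0 : (0 : ℝ) < P := by exact_mod_cast (hp _).pos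
    have hcn : 0 < c₁ * n ^ α := by positivity
    have t1 : 1 / (P : ℝ) * Real.log n ≤ 1 / 4 := by
      refine le_trans ?_ h5
      rw [one_div_mul_eq_div]
      gcongr
    have t2 : P * Real.exp (-(s : ℝ) / (2 * (P : ℝ) ^ 2)) * Real.log n ≤ 1 / 4 := by
      refine le_trans ?_ h6
      gcongr ?_ * Real.exp ?_ * _
      rw [neg_div, neg_div, neg_le_neg_iff]
      gcongr
    have t4 : (2 : ℝ) ^ l / 2 ^ s / 2 ^ N * Real.log n ≤ 1 / 4 := by
      refine le_trans ?_ h8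
      gcongr
      rw [← Real.rpow_natCast, ← Real.rpow_natCast, ← Real.rpow_natCast,
        ← Real.rpow_sub two_pos, ← Real.rpow_sub two_pos]
      apply Real.rpow_le_rpow_of_exponent_le one_le_two
      have : n = N + 1 := by rw [hn]; push_cast; ring
      linarith
    have h10 : g (N + 1) ≤ (1 / P + P * Real.exp (-(s : ℝ) / (2 * (P : ℝ) ^ 2))) / 2
        + 4 / n ^ β + 2 ^ l / 2 ^ s / 2 ^ N := by linarith
    have h11 := mul_le_mul_of_nonneg_right h10 hlog0.le
    -- Multiplied by `log n`, the errors add up to at most `3/4`, while `g (N + 1) * log n ≥ 1`.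
    rw [add_mul, add_mul, div_mul_eq_mul_div, add_mul] at h11
    linarith
  · have hsq : (k : ℝ) ≤ n ^ (1 / 2 : ℝ) := by
      have e1 : (k : ℝ) ≤ k ^ 2 := le_self_pow₀ hk1 two_ne_zero
      have e2 : Real.log n ^ (1 / 2 : ℝ) ≤ n ^ (1 / 2 : ℝ) :=
        Real.rpow_le_rpow hlog0.le (Real.log_le_self hn0.le) (by norm_num)
      linarith
    have : ((16 * k + 8 : ℕ) : ℝ) ≤ ((N + 1 : ℕ) : ℝ) := by
      rw [← hn]
      push_cast
      linarith
    exact_mod_cast this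
  · have : ((512 * k ^ 2 : ℕ) : ℝ) < P := by
      push_cast
      linarith
    exact_mod_cast this
  · have e1 := locality_loss_le hk0
    calc n ^ β * (1026 * (k : ℝ) ^ 3 * 2 ^ (512 * k ^ 2))
        ≤ n ^ β * n ^ (1 - β) := by
          gcongr
          refine e1.trans ?_
          rw [Real.rpow_def_of_pos hn0]
          apply Real.exp_le_exp.2
          linarith
      _ = n := by rw [← Real.rpow_add hn0]; simp
      _ = N + 1 := by rw [hn]; push_cast; ring

/-! ## Programs in polynomial time -/

namespace Ram

/-- A size bound for the values `V i γ` of the variables. -/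
def size {Γ ι : Type} [Fintype ι] (V : ι → Γ → ℕ) (γ : Γ) : ℕ := ∑ i, V i γ + 2

/-- The variables `V`, together with a new natural number variable. -/
def ext {Γ ι : Type} (V : ι → Γ → ℕ) : Option ι → Γ × ℕ → ℕ
  | none => Prod.snd
  | some i => fun x => V i x.1

/-- There are programs that compute `g` from the variables `V` in polynomial time: wherever the
variables are stored below the cell `r`, the value is written into the cell `r`, using only the
cells from `r` on. -/
def Computes {Γ ι : Type} [Fintype ι] (V : ι → Γ → ℕ) (g : Γ → ℕ) : Prop :=
  (∃ c, ∀ γ, g γ ≤ size V γ ^ c) ∧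
    ∀ (r : ℕ) (ρ : ι → ℕ), (∀ i, ρ i < r) → ∃ (P : RamProg) (c : ℕ), ∀ (γ : Γ) (s : RamState),
      (∀ i, s.mem (ρ i) = V i γ) → ∃ s' t, RamExec P s s' t ∧ t ≤ size V γ ^ c ∧
        s'.mem r = g γ ∧ (∀ j < r, s'.mem j = s.mem j) ∧ s'.out = s.out

/-- There are programs that write the word `w` on the output tape in polynomial time. -/
def Writes {Γ ι : Type} [Fintype ι] (V : ι → Γ → ℕ) (w : Γ → List CircSym) : Prop :=
  ∀ (r : ℕ) (ρ : ι → ℕ), (∀ i, ρ i < r) → ∃ (P : RamProg) (c : ℕ), ∀ (γ : Γ) (s : RamState),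
    (∀ i, s.mem (ρ i) = V i γ) → ∃ s' t, RamExec P s s' t ∧ t ≤ size V γ ^ c ∧
      (∀ j < r, s'.mem j = s.mem j) ∧ s'.out = s.out ++ w γ

/-- Sizes are at least `2`, so all time bounds can be kept in the form `size ^ c`. -/
lemma pow_add_pow_le {x : ℕ} (hx : 2 ≤ x) (a b : ℕ) : x ^ a + x ^ b ≤ x ^ (a + b + 1) := by
  have h1 : x ^ a ≤ x ^ (a + b) := Nat.pow_le_pow_right (by omega) (by omega)
  have h2 : x ^ b ≤ x ^ (a + b) := Nat.pow_le_pow_right (by omega) (by omega)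
  rw [pow_succ]
  exact (add_le_add h1 h2).trans (by rw [← mul_two]; exact Nat.mul_le_mul_left _ hx)

lemma le_pow_self {x : ℕ} (hx : 2 ≤ x) (n : ℕ) : n ≤ x ^ n :=
  (Nat.lt_pow_self hx).le

lemma iterate_add_one (n m : ℕ) : (fun k => k + 1)^[n] m = m + n := by
  rw [← Nat.succ_iterate]

/-- The invariant rule for counting loops: at the start of round `i` the control cell holds `G - i`,
and `τ` bounds the time of one round. -/
lemma exec_loop {a : ℕ} {P : RamProg} {Inv : ℕ → RamState → Prop} {G τ : ℕ}
    (h0 : ∀ i s, Inv i s → s.mem a = G - i)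
    (hstep : ∀ i < G, ∀ s, Inv i s → ∃ s' t, RamExec P s s' t ∧ t ≤ τ ∧ Inv (i + 1) s')
    {s : RamState} (hs : Inv 0 s) :
    ∃ s' t, RamExec (.loop a P) s s' t ∧ t ≤ G * (τ + 1) + 1 ∧ Inv G s' := by
  have key : ∀ m i s, i + m = G → Inv i s →
      ∃ s' t, RamExec (.loop a P) s s' t ∧ t ≤ m * (τ + 1) + 1 ∧ Inv G s' := by
    intro m
    induction m with
    | zero =>
      intro i s hi h
      refine ⟨s, 1, .loop_exit ?_, by simp, ?_⟩
      · rw [h0 i s h]; omega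
      · rwa [← hi, add_zero]
    | succ m ih =>
      intro i s hi h
      obtain ⟨s', t, he, ht, h'⟩ := hstep i (by omega) s h
      obtain ⟨s'', t', he', ht', h''⟩ := ih (i + 1) s' (by omega) h'
      refine ⟨s'', 1 + t + t', .loop_step ?_ he he', ?_, h''⟩
      · rw [h0 i s h]; omega
      · rw [add_mul, one_mul]; omega
  exact key G 0 s (by omega) hs

/-- Emptying the cell `b` by applying an operation `φ` to the cell `a` as often as possible. -/
lemma exec_transfer {a b : ℕ} (hab : a ≠ b) {P : RamProg} {φ : ℕ → ℕ}
    (hP : ∀ s : RamState, RamExec P s ⟨Function.update s.mem a (φ (s.mem a)), s.out⟩ 1)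
    (s : RamState) :
    ∃ s' t, RamExec (.loop b (.seq P (.dec b))) s s' t ∧ t ≤ s.mem b * 3 + 1 ∧
      s'.mem a = φ^[s.mem b] (s.mem a) ∧ (∀ j, j ≠ a → j ≠ b → s'.mem j = s.mem j) ∧
      s'.out = s.out := by
  obtain ⟨s', t, he, ht, h1, h2, h3, h4⟩ := exec_loop (a := b) (P := .seq P (.dec b))
    (Inv := fun i s' => s'.mem b = s.mem b - i ∧ s'.mem a = φ^[i] (s.mem a) ∧
      (∀ j, j ≠ a → j ≠ b → s'.mem j = s.mem j) ∧ s'.out = s.out) (G := s.mem b) (τ := 2)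
    (fun i s' h => h.1)
    (fun i hi s' ⟨h1, h2, h3, h4⟩ => by
      refine ⟨_, 1 + 1, .seq (hP s') (.dec _ b), le_rfl, ?_, ?_, ?_, h4⟩
      · simp [hab.symm, h1]; omega
      · simp [hab, h2, Function.iterate_succ_apply']
      · intro j hja hjb
        simp [hja, hjb, h3])
    ⟨rfl, rfl, fun _ _ _ => rfl, rfl⟩
  exact ⟨s', t, he, ht, h2, h3, h4⟩

section

variable {Γ ι : Type} [Fintype ι] {V : ι → Γ → ℕ}

lemma two_le_size (γ : Γ) : 2 ≤ size V γ := Nat.le_add_left _ _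

lemma size_ext (γ : Γ) (i : ℕ) : size (ext V) (γ, i) = size V γ + i := by
  simp only [size, Fintype.sum_option, ext]
  omega

lemma Computes.var (i : ι) : Computes V (V i) := by
  refine ⟨⟨1, fun γ => ?_⟩, fun r ρ hρ => ⟨.copy r (ρ i), 1, fun γ s hs => ?_⟩⟩
  · rw [pow_one]
    exact (Finset.single_le_sum (f := fun i => V i γ) (fun _ _ => Nat.zero_le _)
      (Finset.mem_univ i)).trans (Nat.le_add_right _ _)
  · refine ⟨_, 1, .copy s r (ρ i), ?_, ?_, fun j hj => ?_, rfl⟩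
    · rw [pow_one]; exact (Nat.le_succ 1).trans (two_le_size γ)
    · simp [hs]
    · simp [hj.ne]

lemma Computes.const (n : ℕ) : Computes V fun _ => n := by
  refine ⟨⟨n, fun γ => le_pow_self (two_le_size γ) n⟩,
    fun r ρ hρ => ⟨.const r n, 1, fun γ s hs => ⟨_, 1, .const s r n, ?_, ?_, fun j hj => ?_, rfl⟩⟩⟩
  · rw [pow_one]; exact (Nat.le_succ 1).trans (two_le_size γ)
  · simp
  · simp [hj.ne]

/-- As `σ` is injective, the old variables form a subfamily of the new ones, so time bounds in the
old size remain valid in the new one. -/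
lemma Computes.rename {Γ' ι' : Type} [Fintype ι'] {V' : ι' → Γ' → ℕ} {g : Γ → ℕ}
    (hg : Computes V g) (θ : Γ' → Γ) (σ : ι → ι') (hσ : Function.Injective σ)
    (hV : ∀ i x, V i (θ x) = V' (σ i) x) : Computes V' fun x => g (θ x) := by
  classical
  have hsize : ∀ x, size V (θ x) ≤ size V' x := fun x => by
    unfold size
    simp only [hV]
    rw [← Finset.sum_image (f := fun i => V' i x) (g := σ) (s := Finset.univ)
      fun a _ b _ h => hσ h]
    exact Nat.add_le_add_right (Finset.sum_le_sum_of_subset (Finset.subset_univ _)) 2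
  obtain ⟨⟨c, hc⟩, hP⟩ := hg
  refine ⟨⟨c, fun x => (hc _).trans (Nat.pow_le_pow_left (hsize x) c)⟩, fun r ρ hρ => ?_⟩
  obtain ⟨P, c, hP⟩ := hP r (fun i => ρ (σ i)) fun i => hρ _
  refine ⟨P, c, fun x s hs => ?_⟩
  obtain ⟨s', t, he, ht, h⟩ := hP (θ x) s fun i => by rw [hs, hV]
  exact ⟨s', t, he, ht.trans (Nat.pow_le_pow_left (hsize x) c), h⟩

lemma Computes.weaken {g : Γ → ℕ} (hg : Computes V g) : Computes (ext V) fun x => g x.1 :=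
  hg.rename Prod.fst some (Option.some_injective _) fun _ _ => rfl

lemma Computes.weaken_snd {f : Γ → ℕ → ℕ} (hf : Computes (ext V) fun x => f x.1 x.2) :
    Computes (ext (ext V)) fun x => f x.1.1 x.2 :=
  hf.rename (fun x : (Γ × ℕ) × ℕ => (x.1.1, x.2)) (fun o => o.map some)
    (Option.map_injective (Option.some_injective _)) fun i _ => by cases i <;> rfl

lemma Computes.new : Computes (ext V) Prod.snd := Computes.var (V := ext V) none

/-- The common program for addition and truncated subtraction: with `g` in cell `r` and `h` in cell
`r + 1`, step cell `r` while cell `r + 1` counts down. -/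
lemma Computes.iterate {g h k : Γ → ℕ} {φ : ℕ → ℕ} {Q : ℕ → RamProg}
    (hQ : ∀ r, ∀ s : RamState,
      RamExec (Q r) s ⟨Function.update s.mem r (φ (s.mem r)), s.out⟩ 1)
    (hg : Computes V g) (hh : Computes V h) (hk : ∀ γ, φ^[h γ] (g γ) = k γ)
    (hb : ∀ γ, k γ ≤ g γ + h γ) : Computes V k := by
  obtain ⟨⟨cg, hcg⟩, hPg⟩ := hg
  obtain ⟨⟨ch, hch⟩, hPh⟩ := hh
  refine ⟨⟨cg + ch + 1, fun γ => (hb γ).trans ((add_le_add (hcg γ) (hch γ)).trans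
    (pow_add_pow_le (two_le_size γ) _ _))⟩, fun r ρ hρ => ?_⟩
  obtain ⟨P, c, hP⟩ := hPg r ρ hρ
  obtain ⟨P', c', hP'⟩ := hPh (r + 1) ρ fun i => (hρ i).trans (Nat.lt_succ_self r)
  refine ⟨.seq P (.seq P' (.loop (r + 1) (.seq (Q r) (.dec (r + 1))))), c + (c' + (ch + 2 + 1 + 1) + 1) + 1,
    fun γ s hs => ?_⟩
  obtain ⟨s₁, t₁, he₁, ht₁, hr₁, hm₁, ho₁⟩ := hP γ s hs
  obtain ⟨s₂, t₂, he₂, ht₂, hr₂, hm₂, ho₂⟩ := hP' γ s₁ fun i => by rw [hm₁ _ (hρ i), hs]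
  obtain ⟨s₃, t₃, he₃, ht₃, hr₃, hm₃, ho₃⟩ := exec_transfer (Nat.succ_ne_self r).symm (hQ r) s₂
  refine ⟨s₃, _, .seq he₁ (.seq he₂ he₃), ?_, ?_, fun j hj => ?_, by rw [ho₃, ho₂, ho₁]⟩
  · have hx := two_le_size (V := V) γ
    refine (add_le_add ht₁ ((add_le_add ht₂ ?_).trans (pow_add_pow_le hx _ _))).trans
      (pow_add_pow_le hx _ _)
    refine ht₃.trans ?_
    rw [hr₂]
    calc h γ * 3 + 1 ≤ size V γ ^ ch * size V γ ^ 2 + size V γ ^ 1 := by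
          refine add_le_add (Nat.mul_le_mul (hch γ) ?_) (by rw [pow_one]; omega)
          calc 3 ≤ 2 ^ 2 := by norm_num
            _ ≤ _ := Nat.pow_le_pow_left hx 2
      _ ≤ _ := by rw [← pow_add]; exact pow_add_pow_le hx _ _
  · rw [hr₃, hr₂, hm₂ r (Nat.lt_succ_self r), hr₁, hk]
  · rw [hm₃ j hj.ne (by omega), hm₂ j (by omega), hm₁ j hj]

lemma Computes.add {g h : Γ → ℕ} (hg : Computes V g) (hh : Computes V h) :
    Computes V fun γ => g γ + h γ :=
  Computes.iterate (φ := fun n => n + 1) (Q := .inc) (fun r s => .inc s r) hg hh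
    (fun _ => iterate_add_one _ _) fun _ => le_rfl

lemma Computes.sub {g h : Γ → ℕ} (hg : Computes V g) (hh : Computes V h) :
    Computes V fun γ => g γ - h γ :=
  Computes.iterate (φ := fun n => n - 1) (Q := .dec) (fun r s => .dec s r) hg hh
    (fun γ => by
      generalize h γ = n
      induction n with
      | zero => rfl
      | succ n ih => rw [Function.iterate_succ_apply', ih]; omega)
    fun γ => (Nat.sub_le _ _).trans (Nat.le_add_right _ _)

/-- A loop index stays below a polynomial bound, so the loop body, polynomial in the size including
the index, is polynomial in the original size. -/
lemma size_ext_le {γ : Γ} {c G i : ℕ} (hG : G ≤ size V γ ^ c) (hi : i < G) :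
    size (ext V) (γ, i) ≤ size V γ ^ (1 + c + 1) := by
  rw [size_ext]
  refine le_trans ?_ (pow_add_pow_le (two_le_size γ) 1 c)
  rw [pow_one]
  omega

lemma Computes.sum {g : Γ → ℕ} {f : Γ → ℕ → ℕ} (hg : Computes V g)
    (hf : Computes (ext V) fun x => f x.1 x.2) :
    Computes V fun γ => ∑ i ∈ Finset.range (g γ), f γ i := by
  obtain ⟨⟨cg, hcg⟩, hPg⟩ := hg
  obtain ⟨⟨cf, hcf⟩, hPf⟩ := hf
  have hfb : ∀ γ, ∀ i < g γ, f γ i ≤ size V γ ^ ((1 + cg + 1) * cf) := fun γ i hi => by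
    rw [pow_mul]
    exact (hcf (γ, i)).trans (Nat.pow_le_pow_left (size_ext_le (hcg γ) hi) cf)
  refine ⟨⟨cg + (1 + cg + 1) * cf, fun γ => ?_⟩, fun r ρ hρ => ?_⟩
  · rw [pow_add]
    refine (Finset.sum_le_card_nsmul _ _ (size V γ ^ ((1 + cg + 1) * cf)) fun i hi =>
      hfb γ i (Finset.mem_range.1 hi)).trans ?_
    rw [Finset.card_range, smul_eq_mul]
    exact Nat.mul_le_mul_right _ (hcg γ)
  obtain ⟨P, c, hP⟩ := hPg (r + 1) ρ fun i => (hρ i).trans (Nat.lt_succ_self r)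
  obtain ⟨P', c', hP'⟩ := hPf (r + 3) (fun o => o.elim (r + 2) ρ) (by
    rintro (_ | i)
    · exact Nat.lt_succ_self _
    · exact (hρ i).trans (by omega))
  set e := (1 + cg + 1) * cf with he
  set e' := (1 + cg + 1) * c' with he'
  -- Cell `r` accumulates the sum, `r + 1` counts down from `g γ`, `r + 2` holds the index, and `f`
  -- is computed into `r + 3` and then emptied into `r`.
  refine ⟨.seq P (.seq (.const r 0) (.seq (.const (r + 2) 0) (.loop (r + 1)
    (.seq P' (.seq (.loop (r + 3) (.seq (.inc r) (.dec (r + 3))))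
      (.seq (.inc (r + 2)) (.dec (r + 1)))))))),
    c + (cg + (e' + (e + 2 + 3 + 1) + 1) + 2 + 1) + 1, fun γ s hs => ?_⟩
  have hx := two_le_size (V := V) γ
  obtain ⟨s₁, t₁, he₁, ht₁, hr₁, hm₁, ho₁⟩ := hP γ s hs
  obtain ⟨s₂, t₂, he₂, ht₂, h₂⟩ := exec_loop (a := r + 1)
    (P := .seq P' (.seq (.loop (r + 3) (.seq (.inc r) (.dec (r + 3))))
      (.seq (.inc (r + 2)) (.dec (r + 1)))))
    (Inv := fun i s' => s'.mem (r + 1) = g γ - i ∧ s'.mem (r + 2) = i ∧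
      s'.mem r = ∑ j ∈ Finset.range i, f γ j ∧ (∀ j < r, s'.mem j = s.mem j) ∧ s'.out = s.out)
    (G := g γ) (τ := size V γ ^ e' + (size V γ ^ e * 3 + 1 + 2))
    (fun i s' h => h.1)
    (fun i hi s' ⟨h1, h2, h3, h4, h5⟩ => by
      obtain ⟨q₁, u₁, hu₁, hut₁, hur₁, hum₁, huo₁⟩ := hP' (γ, i) s' (by
        rintro (_ | j)
        · exact h2
        · exact (h4 _ (hρ j)).trans (hs j))
      obtain ⟨q₂, u₂, hu₂, hut₂, hur₂, hum₂, huo₂⟩ := exec_transfer (a := r) (b := r + 3)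
        (by omega) (φ := fun n => n + 1) (P := .inc r) (fun s => .inc s r) q₁
      refine ⟨_, _, .seq hu₁ (.seq hu₂ (.seq (.inc _ _) (.dec _ _))), ?_, ?_, ?_, ?_, ?_, ?_⟩
      · refine add_le_add (hut₁.trans ?_) (add_le_add_left (hut₂.trans ?_) _)
        · rw [he', pow_mul]
          exact Nat.pow_le_pow_left (size_ext_le (hcg γ) hi) c'
        · rw [hur₁]
          exact Nat.add_le_add_right (Nat.mul_le_mul_right _ (hfb γ i hi)) 1
      · simp
        rw [hum₂ _ (by omega) (by omega), hum₁ _ (by omega), h1]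
        omega
      · simp
        rw [hum₂ _ (by omega) (by omega), hum₁ _ (by omega), h2]
      · simp
        rw [hur₂, hur₁, hum₁ _ (by omega), h3, iterate_add_one, Finset.sum_range_succ]
      · intro j hj
        have n1 : j ≠ r + 1 := by omega
        have n2 : j ≠ r + 2 := by omega
        simp [n1, n2]
        rw [hum₂ _ (by omega) (by omega), hum₁ _ (by omega), h4 j hj]
      · simp only
        rw [huo₂, huo₁, h5])
    (s := ⟨Function.update (Function.update s₁.mem r 0) (r + 2) 0, s₁.out⟩) (by
      refine ⟨by simp [hr₁], by simp, by simp, fun j hj => ?_, ho₁⟩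
      have n1 : j ≠ r + 2 := by omega
      simp [n1, hj.ne]
      exact hm₁ j (by omega))
  refine ⟨s₂, _, .seq he₁ (.seq (.const _ _ _) (.seq (.const _ _ _) he₂)), ?_, h₂.2.2.1,
    h₂.2.2.2.1, h₂.2.2.2.2⟩
  refine (add_le_add ht₁ ?_).trans (pow_add_pow_le hx _ _)
  set x := size V γ with hxdef
  have b1 : x ^ e * 3 + 1 + 2 + 1 ≤ x ^ (e + 2 + 3 + 1) := by
    have : x ^ e * 3 + 4 ≤ x ^ (e + 2) + x ^ 3 := by
      rw [pow_add]
      refine add_le_add (Nat.mul_le_mul_left _ ?_) ?_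
      · exact le_trans (by norm_num) (Nat.pow_le_pow_left hx 2)
      · exact le_trans (by norm_num) (Nat.pow_le_pow_left hx 3)
    exact this.trans (pow_add_pow_le hx _ _)
  have b2 : x ^ e' + (x ^ e * 3 + 1 + 2) + 1 ≤ x ^ (e' + (e + 2 + 3 + 1) + 1) :=
    (by omega : _ ≤ x ^ e' + x ^ (e + 2 + 3 + 1)).trans (pow_add_pow_le hx _ _)
  calc 1 + (1 + t₂) ≤ g γ * (x ^ e' + (x ^ e * 3 + 1 + 2) + 1) + 3 := by omega
    _ ≤ x ^ (cg + (e' + (e + 2 + 3 + 1) + 1)) + x ^ 2 := by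
        rw [pow_add x cg]
        refine add_le_add (Nat.mul_le_mul (hcg γ) b2) ?_
        exact le_trans (by norm_num) (Nat.pow_le_pow_left hx 2)
    _ ≤ _ := pow_add_pow_le hx _ _

lemma Writes.word (w : List CircSym) : Writes V fun _ => w := by
  intro r ρ hρ
  have key : ∃ (P : RamProg) (c : ℕ), ∀ s : RamState, ∃ s' t, RamExec P s s' t ∧ t ≤ c ∧
      (∀ j < r, s'.mem j = s.mem j) ∧ s'.out = s.out ++ w := by
    induction w with
    | nil => exact ⟨.const r 0, 1, fun s => ⟨_, 1, .const s r 0, le_rfl,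
        fun j hj => by simp [hj.ne], by simp⟩⟩
    | cons x w ih =>
      obtain ⟨P, c, h⟩ := ih
      refine ⟨.seq (.write x) P, 1 + c, fun s => ?_⟩
      obtain ⟨s', t, he, ht, hm, ho⟩ := h ⟨s.mem, s.out ++ [x]⟩
      exact ⟨s', 1 + t, .seq (.write s x) he, Nat.add_le_add_left ht 1, hm, by simp [ho]⟩
  obtain ⟨P, c, h⟩ := key
  refine ⟨P, c, fun γ s _ => ?_⟩
  obtain ⟨s', t, he, ht, h⟩ := h s
  exact ⟨s', t, he, ht.trans (le_pow_self (two_le_size γ) c), h⟩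

lemma Writes.append {w w' : Γ → List CircSym} (hw : Writes V w) (hw' : Writes V w') :
    Writes V fun γ => w γ ++ w' γ := by
  intro r ρ hρ
  obtain ⟨P, c, hP⟩ := hw r ρ hρ
  obtain ⟨P', c', hP'⟩ := hw' r ρ hρ
  refine ⟨.seq P P', c + c' + 1, fun γ s hs => ?_⟩
  obtain ⟨s₁, t₁, he₁, ht₁, hm₁, ho₁⟩ := hP γ s hs
  obtain ⟨s₂, t₂, he₂, ht₂, hm₂, ho₂⟩ := hP' γ s₁ fun i => by rw [hm₁ _ (hρ i), hs]
  refine ⟨s₂, _, .seq he₁ he₂, (add_le_add ht₁ ht₂).trans (pow_add_pow_le (two_le_size γ) _ _),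
    fun j hj => by rw [hm₂ j hj, hm₁ j hj], by rw [ho₂, ho₁, List.append_assoc]⟩

lemma Writes.flatMap {g : Γ → ℕ} {w : Γ → ℕ → List CircSym} (hg : Computes V g)
    (hw : Writes (ext V) fun x => w x.1 x.2) :
    Writes V fun γ => (List.range (g γ)).flatMap (w γ) := by
  obtain ⟨⟨cg, hcg⟩, hPg⟩ := hg
  intro r ρ hρ
  obtain ⟨P, c, hP⟩ := hPg r ρ hρ
  obtain ⟨P', c', hP'⟩ := hw (r + 2) (fun o => o.elim (r + 1) ρ) (by
    rintro (_ | i)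
    · exact Nat.lt_succ_self _
    · exact (hρ i).trans (by omega))
  set e' := (1 + cg + 1) * c' with he'
  refine ⟨.seq P (.seq (.const (r + 1) 0) (.loop r
    (.seq P' (.seq (.inc (r + 1)) (.dec r))))), c + (cg + (e' + 2 + 1) + 1 + 1) + 1,
    fun γ s hs => ?_⟩
  have hx := two_le_size (V := V) γ
  obtain ⟨s₁, t₁, he₁, ht₁, hr₁, hm₁, ho₁⟩ := hP γ s hs
  obtain ⟨s₂, t₂, he₂, ht₂, h₂⟩ := exec_loop (a := r)
    (P := .seq P' (.seq (.inc (r + 1)) (.dec r)))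
    (Inv := fun i s' => s'.mem r = g γ - i ∧ s'.mem (r + 1) = i ∧
      (∀ j < r, s'.mem j = s.mem j) ∧ s'.out = s.out ++ (List.range i).flatMap (w γ))
    (G := g γ) (τ := size V γ ^ e' + 2)
    (fun i s' h => h.1)
    (fun i hi s' ⟨h1, h2, h3, h4⟩ => by
      obtain ⟨q₁, u₁, hu₁, hut₁, hum₁, huo₁⟩ := hP' (γ, i) s' (by
        rintro (_ | j)
        · exact h2
        · exact (h3 _ (hρ j)).trans (hs j))
      refine ⟨_, _, .seq hu₁ (.seq (.inc _ _) (.dec _ _)), ?_, ?_, ?_, ?_, ?_⟩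
      · refine Nat.add_le_add_right (hut₁.trans ?_) _
        rw [he', pow_mul]
        exact Nat.pow_le_pow_left (size_ext_le (hcg γ) hi) c'
      · simp
        rw [hum₁ _ (by omega), h1]
        omega
      · simp
        rw [hum₁ _ (by omega), h2]
      · intro j hj
        have n1 : j ≠ r + 1 := by omega
        simp [n1, hj.ne]
        rw [hum₁ _ (by omega), h3 j hj]
      · simp only
        rw [huo₁, h4, List.range_succ, List.flatMap_append, List.append_assoc]
        simp)
    (s := ⟨Function.update s₁.mem (r + 1) 0, s₁.out⟩) (by
      refine ⟨by simp [hr₁], by simp, fun j hj => ?_, by simp [ho₁]⟩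
      have n1 : j ≠ r + 1 := by omega
      simp [n1]
      exact hm₁ j hj)
  refine ⟨s₂, _, .seq he₁ (.seq (.const _ _ _) he₂), ?_, h₂.2.2.1, h₂.2.2.2⟩
  refine (add_le_add ht₁ ?_).trans (pow_add_pow_le hx _ _)
  set x := size V γ with hxdef
  have b1 : x ^ e' + 2 + 1 ≤ x ^ (e' + 2 + 1) :=
    (Nat.add_le_add_left (le_trans (by norm_num : 3 ≤ 2 ^ 2) (Nat.pow_le_pow_left hx 2))
      (x ^ e')).trans
      (pow_add_pow_le hx e' 2)
  calc 1 + t₂ ≤ g γ * (x ^ e' + 2 + 1) + 2 := by omega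
    _ ≤ x ^ (cg + (e' + 2 + 1)) + x ^ 1 := by
        rw [pow_add x cg, pow_one]
        exact add_le_add (Nat.mul_le_mul (hcg γ) b1) hx
    _ ≤ _ := pow_add_pow_le hx _ _

/-! ### Derived functions -/

lemma Computes.mul {g h : Γ → ℕ} (hg : Computes V g) (hh : Computes V h) :
    Computes V fun γ => g γ * h γ := by
  simpa using hg.sum (f := fun γ _ => h γ) hh.weaken

lemma Computes.pow {g : Γ → ℕ} (hg : Computes V g) (k : ℕ) : Computes V fun γ => g γ ^ k := by
  induction k with
  | zero => simpa using Computes.const 1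
  | succ k ih => simpa only [pow_succ] using ih.mul hg

open Classical in
/-- Programs that decide a property in polynomial time. -/
def Decides (V : ι → Γ → ℕ) (P : Γ → Prop) : Prop := Computes V fun γ => if P γ then 1 else 0

lemma Computes.lt {g h : Γ → ℕ} (hg : Computes V g) (hh : Computes V h) :
    Decides V fun γ => g γ < h γ := by
  have := (Computes.const 1).sub ((Computes.const 1).sub (hh.sub hg))
  refine (congrArg (Computes V) (funext fun γ => ?_)).mp this
  split_ifs <;> omega

lemma Decides.not {P : Γ → Prop} (hP : Decides V P) : Decides V fun γ => ¬ P γ := by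
  have := (Computes.const 1).sub hP
  refine (congrArg (Computes V) (funext fun γ => ?_)).mp this
  by_cases h : P γ <;> simp [h]

lemma Decides.and {P Q : Γ → Prop} (hP : Decides V P) (hQ : Decides V Q) :
    Decides V fun γ => P γ ∧ Q γ := by
  have := Computes.mul hP hQ
  refine (congrArg (Computes V) (funext fun γ => ?_)).mp this
  by_cases h : P γ <;> by_cases h' : Q γ <;> simp [h, h']

lemma Computes.le {g h : Γ → ℕ} (hg : Computes V g) (hh : Computes V h) :
    Decides V fun γ => g γ ≤ h γ := by
  simpa only [not_lt] using (hh.lt hg).not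

lemma Computes.eq {g h : Γ → ℕ} (hg : Computes V g) (hh : Computes V h) :
    Decides V fun γ => g γ = h γ := by
  simpa only [← le_antisymm_iff] using (hg.le hh).and (hh.le hg)

lemma Decides.exists_lt {g : Γ → ℕ} {P : Γ → ℕ → Prop} (hg : Computes V g)
    (hP : Decides (ext V) fun x => P x.1 x.2) : Decides V fun γ => ∃ i < g γ, P γ i := by
  classical
  have := (Computes.const 0).lt (hg.sum (f := fun γ i => if P γ i then 1 else 0) hP)
  refine (congrArg (Decides V) (funext fun γ => propext ?_)).mp this
  rw [Finset.sum_boole, Nat.cast_id, Finset.card_pos]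
  simp [Finset.Nonempty]

lemma Decides.forall_lt {g : Γ → ℕ} {P : Γ → ℕ → Prop} (hg : Computes V g)
    (hP : Decides (ext V) fun x => P x.1 x.2) : Decides V fun γ => ∀ i < g γ, P γ i := by
  have := (Decides.exists_lt (P := fun γ i => ¬ P γ i) hg hP.not).not
  refine (congrArg (Decides V) (funext fun γ => propext ?_)).mp this
  push Not
  rfl

open Classical in
lemma Computes.ite {g h : Γ → ℕ} {P : Γ → Prop} (hP : Decides V P) (hg : Computes V g)
    (hh : Computes V h) : Computes V fun γ => if P γ then g γ else h γ := by
  have := (Computes.mul hP hg).add (Computes.mul hP.not hh)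
  refine (congrArg (Computes V) (funext fun γ => ?_)).mp this
  by_cases h : P γ <;> simp [h]

/-- Bounded search. -/
lemma Computes.find {b g : Γ → ℕ} {P : Γ → ℕ → Prop} (hb : Computes V b)
    (hP : Decides (ext V) fun x => P x.1 x.2) (hg : ∀ γ, P γ (g γ)) (hgb : ∀ γ, g γ ≤ b γ)
    (hmin : ∀ γ, ∀ i < g γ, ¬ P γ i) : Computes V g := by
  classical
  have h1 : Decides (ext V) fun x => ∀ i < x.2 + 1, ¬ P x.1 i := by
    have h2 : Decides (ext (ext V)) fun x => P x.1.1 x.2 :=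
      Computes.weaken_snd (f := fun γ i => if P γ i then 1 else 0) hP
    exact Decides.forall_lt (P := fun x i => ¬ P x.1 i) (Computes.new.add (Computes.const 1))
      h2.not
  -- The least solution equals the number of `j` below the bound for which nothing up to `j` is a
  -- solution.
  have := hb.sum (f := fun γ j => if ∀ i < j + 1, ¬ P γ i then 1 else 0) (by
    unfold Decides at h1; convert h1)
  refine (congrArg (Computes V) (funext fun γ => ?_)).mp this
  rw [Finset.sum_boole, Nat.cast_id]
  have : (Finset.range (b γ)).filter (fun j => ∀ i < j + 1, ¬ P γ i) = Finset.range (g γ) := by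
    ext j
    simp only [Finset.mem_filter, Finset.mem_range]
    constructor
    · intro h
      by_contra hj
      exact h.2 (g γ) (by omega) (hg γ)
    · intro h
      exact ⟨h.trans_le (hgb γ), fun i hi => hmin γ i (by omega)⟩
  rw [this, Finset.card_range]

lemma Computes.div {g h : Γ → ℕ} (hg : Computes V g) (hh : Computes V h) (h0 : ∀ γ, 0 < h γ) :
    Computes V fun γ => g γ / h γ := by
  refine Computes.find (P := fun γ j => g γ < (j + 1) * h γ) hg
    (hg.weaken.lt ((Computes.new.add (Computes.const 1)).mul hh.weaken)) (fun γ => ?_)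
    (fun γ => Nat.div_le_self _ _) fun γ i hi => ?_
  · rw [mul_comm]; exact Nat.lt_mul_div_succ _ (h0 γ)
  · rw [not_lt]
    exact (Nat.le_div_iff_mul_le (h0 γ)).1 hi

lemma Computes.mod {g h : Γ → ℕ} (hg : Computes V g) (hh : Computes V h) (h0 : ∀ γ, 0 < h γ) :
    Computes V fun γ => g γ % h γ := by
  have := hg.sub (hh.mul (hg.div hh h0))
  refine (congrArg (Computes V) (funext fun γ => ?_)).mp this
  have := Nat.mod_add_div (g γ) (h γ)
  omega

/-- Exhaustive search for factors `i, j < g γ`; it is polynomial because time is measured in the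
values, not in their lengths. -/
lemma Decides.prime {g : Γ → ℕ} (hg : Computes V g) : Decides V fun γ => (g γ).Prime := by
  have h1 : Decides (ext (ext V)) fun x => ¬ x.1.2 * x.2 = g x.1.1 :=
    ((Computes.new.weaken.mul Computes.new).eq hg.weaken.weaken).not
  have h2 := ((Computes.const 2).le hg).and (Decides.forall_lt (P := fun γ i =>
    ∀ j < g γ, ¬ i * j = g γ) hg (Decides.forall_lt (P := fun x j => ¬ x.2 * j = g x.1)
      hg.weaken h1))
  refine (congrArg (Decides V) (funext fun γ => propext ?_)).mp h2
  constructor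
  · rintro ⟨h2, h⟩
    by_contra hp
    obtain ⟨m, hm, hm1, hmlt⟩ := Nat.exists_dvd_of_not_prime2 h2 hp
    obtain ⟨j, hj⟩ := hm
    refine h m hmlt j ?_ hj.symm
    have hj0 : 0 < j := by
      rcases Nat.eq_zero_or_pos j with h0 | h0
      · rw [h0] at hj; omega
      · exact h0
    nlinarith
  · intro hp
    refine ⟨hp.two_le, fun i hi j hj hij => ?_⟩
    rcases (Nat.prime_mul_iff.1 (hij ▸ hp)) with ⟨_, h⟩ | ⟨_, h⟩
    · rw [h] at hij; omega
    · rw [h] at hij; omega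

open Classical in
-- A condition is a loop of length `0` or `1`.
lemma Writes.guard {w : Γ → List CircSym} {P : Γ → Prop} (hP : Decides V P) (hw : Writes V w) :
    Writes V fun γ => if P γ then w γ else [] := by
  have h1 : Writes (ext V) fun x => w x.1 := by
    intro r ρ hρ
    obtain ⟨Q, c, h⟩ := hw r (fun i => ρ (some i)) fun i => hρ _
    refine ⟨Q, c, fun x s hs => ?_⟩
    obtain ⟨s', t, he, ht, h⟩ := h x.1 s fun i => hs (some i)
    refine ⟨s', t, he, ht.trans (Nat.pow_le_pow_left ?_ c), h⟩
    rw [← Prod.mk.eta (p := x), size_ext]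
    exact Nat.le_add_right _ _
  have := Writes.flatMap (w := fun γ _ => w γ) hP h1
  refine (congrArg (Writes V) (funext fun γ => ?_)).mp this
  by_cases h : P γ <;> simp [h]

lemma Writes.describeNat {g : Γ → ℕ} (hg : Computes V g) :
    Writes V fun γ => describeNat (g γ) := by
  have := (Writes.flatMap (w := fun _ _ => [CircSym.one]) hg (Writes.word _)).append
    (Writes.word [CircSym.done])
  refine (congrArg (Writes V) (funext fun γ => ?_)).mp this
  rw [_root_.describeNat]
  congr 1
  generalize g γ = n
  induction n with
  | zero => rfl
  | succ n ih => rw [List.range_succ, List.flatMap_append, ih, List.replicate_succ']; rfl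

end

/-- A family of circuits whose descriptions are written by a program is uniform. -/
lemma isUniformFamily {C : ∀ n, QCircuit n}
    (h : Writes (fun (_ : Unit) (n : ℕ) => n) fun n => (C n).describe) : IsUniformFamily C := by
  obtain ⟨P, c, hP⟩ := h 1 (fun _ => 0) fun _ => one_pos
  refine ⟨P, (Polynomial.X + 2) ^ c, fun n => ?_⟩
  obtain ⟨s, t, he, ht, _, ho⟩ := hP n (ramInit n) fun _ => by simp [ramInit]
  refine ⟨s, t, he, ?_, ?_⟩
  · simpa [size] using ht
  · simpa [ramInit] using ho

end Ram

/-! ## Gates acting on states -/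

section Gates

variable {n k : ℕ}

/-- A gate on the wires `w` acts on the factor of a state that belongs to these wires. -/
lemma onWires_mulVec (G : Matrix (Fin k → Bool) (Fin k → Bool) ℂ) {w : Fin k → Fin n}
    (hw : Function.Injective w) {R : (Fin n → Bool) → ℂ}
    (hR : ∀ x y, (∀ i, (∀ j, w j ≠ i) → x i = y i) → R x = R y) (B : (Fin k → Bool) → ℂ) :
    (onWires G w).mulVec (fun y => R y * B fun j => y (w j))
      = fun x => R x * G.mulVec B fun j => x (w j) := by
  classical
  funext x
  simp only [Matrix.mulVec, dotProduct, onWires, Matrix.of_apply]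
  rw [Finset.mul_sum]
  symm
  have hagree : ∀ (u : Fin k → Bool) i, (∀ j, w j ≠ i) → x i = Function.extend w u x i :=
    fun u i hi => (Function.extend_apply' _ _ _ (by push Not; exact hi)).symm
  refine Finset.sum_of_injOn (fun u => Function.extend w u x) ?_ (by simp) ?_ ?_
  · intro u _ u' _ h
    funext j
    have := congrFun h (w j)
    simpa [hw.extend_apply] using this
  · intro y _ hy
    rw [if_neg, zero_mul]
    intro h
    refine hy ⟨fun j => y (w j), by simp, ?_⟩
    funext i
    by_cases hi : ∃ j, w j = i
    · obtain ⟨j, rfl⟩ := hi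
      exact hw.extend_apply _ _ _
    · refine (Function.extend_apply' _ _ _ hi).trans ?_
      push Not at hi
      exact h i hi
  · intro u _
    have h1 : (fun j => Function.extend w u x (w j)) = u := by
      funext j; rw [hw.extend_apply]
    rw [if_pos (hagree u), ← hR x _ (hagree u)]
    erw [h1]
    ring

/-- A layer of gates on pairwise disjoint sets of wires acts factorwise. -/
lemma foldl_onWires_mulVec (G : Matrix (Fin k → Bool) (Fin k → Bool) ℂ) (K : ℕ)
    (w : ℕ → Fin k → Fin n) (hw : ∀ t < K, Function.Injective (w t))
    (hdisj : ∀ t < K, ∀ t' < K, t ≠ t' → ∀ j j', w t j ≠ w t' j') (R : (Fin n → Bool) → ℂ)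
    (hR : ∀ x y, (∀ i, (∀ t < K, ∀ j, w t j ≠ i) → x i = y i) → R x = R y)
    (B : ℕ → (Fin k → Bool) → ℂ) :
    (List.range K).foldl (fun φ t => (onWires G (w t)).mulVec φ)
        (fun x => R x * ∏ t ∈ Finset.range K, B t fun j => x (w t j))
      = fun x => R x * ∏ t ∈ Finset.range K, G.mulVec (B t) fun j => x (w t j) := by
  induction K generalizing R with
  | zero => rfl
  | succ K ih =>
    rw [List.range_succ, List.foldl_append, List.foldl_cons, List.foldl_nil]
    -- While the first `K` gates act, the factor of the last one counts as part of `R`; afterwards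
    -- their factors do, and the last gate acts.
    have e1 : (fun x : Fin n → Bool => R x * ∏ t ∈ Finset.range (K + 1), B t fun j => x (w t j))
        = fun x => (R x * B K fun j => x (w K j)) * ∏ t ∈ Finset.range K, B t fun j => x (w t j) := by
      funext x
      rw [Finset.prod_range_succ]
      ring
    rw [e1, ih (fun t ht => hw t (by omega)) (fun t ht t' ht' => hdisj t (by omega) t' (by omega))]
    · have e2 : (fun x : Fin n → Bool => (R x * B K fun j => x (w K j))
            * ∏ t ∈ Finset.range K, G.mulVec (B t) fun j => x (w t j))
          = fun x => (R x * ∏ t ∈ Finset.range K, G.mulVec (B t) fun j => x (w t j))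
            * B K fun j => x (w K j) := by
        funext x; ring
      rw [e2, onWires_mulVec G (hw K (by omega))]
      · funext x
        rw [Finset.prod_range_succ]
        ring
      · intro x y hxy
        congr 1
        · exact hR x y fun i hi => hxy i (hi K (by omega))
        · refine Finset.prod_congr rfl fun t ht => ?_
          congr 1
          funext j
          have htK := Finset.mem_range.1 ht
          exact hxy _ fun j' => hdisj K (by omega) t (by omega) htK.ne' j' j
    · intro x y hxy
      congr 1
      · refine hR x y fun i hi => hxy i fun t ht => hi t (by omega)
      · congr 1
        funext j
        exact hxy _ fun t ht j' => hdisj t (by omega) K (by omega) ht.ne j' j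

lemma cnot_mulVec {c t : Fin n} (hct : c ≠ t) (φ : (Fin n → Bool) → ℂ) :
    (QGate.cnot c t).toMatrix.mulVec φ
      = fun x => φ (Function.update x t (xor (x c) (x t))) := by
  classical
  funext x
  simp only [Matrix.mulVec, dotProduct, QGate.toMatrix, onWires, Matrix.of_apply, cnotMatrix]
  rw [Finset.sum_eq_single (Function.update x t (xor (x c) (x t)))]
  · rw [if_pos, if_pos, one_mul]
    · funext j
      fin_cases j
      · simp [hct]
      · simp [hct]
    · intro i hi
      have : i ≠ t := by
        have := hi 1
        simpa using this.symm
      simp [this]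
  · intro y _ hy
    rw [ite_mul, zero_mul, ite_eq_right_iff]
    intro h
    rw [if_neg, zero_mul]
    intro h'
    have h0 := congrFun h' 0
    have h1 := congrFun h' 1
    simp at h0 h1
    refine hy (funext fun i => ?_)
    by_cases hit : i = t
    · subst hit
      simp [h0, h1]
    · by_cases hic : i = c
      · subst hic
        simp [hct, h0]
      · rw [Function.update_of_ne hit]
        refine (h i fun j => ?_).symm
        fin_cases j
        · simpa using fun e => hic e.symm
        · simpa using fun e => hit e.symm
  · intro h
    exact absurd (Finset.mem_univ _) h

lemma foldl_mulVec_sum {ι α : Type*} [Fintype ι] (gs : List α)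
    (M : α → Matrix (Fin n → Bool) (Fin n → Bool) ℂ) (c : ι → ℂ) (φ : ι → (Fin n → Bool) → ℂ) :
    gs.foldl (fun ψ g => (M g).mulVec ψ) (∑ i, c i • φ i)
      = ∑ i, c i • gs.foldl (fun ψ g => (M g).mulVec ψ) (φ i) := by
  induction gs generalizing φ with
  | nil => rfl
  | cons g gs ih =>
    simp only [List.foldl_cons]
    rw [Matrix.mulVec_sum]
    simp only [Matrix.mulVec_smul]
    exact ih fun i => (M g).mulVec (φ i)

/-- The entries of the Hadamard matrix. -/
noncomputable def hadEntry (a b : Bool) : ℂ := (if a && b then -1 else 1) / (Real.sqrt 2 : ℂ)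

lemma hadMatrix_mulVec_indicator (b : Bool) (u : Fin 1 → Bool) :
    hadMatrix.mulVec (fun v => if v 0 = b then 1 else 0) u = hadEntry (u 0) b := by
  simp only [Matrix.mulVec, dotProduct]
  rw [← (Equiv.funUnique (Fin 1) Bool).symm.sum_comp, Fintype.sum_bool]
  cases b <;> simp [hadMatrix, hadEntry]

end Gates

/-! ## The quantum circuits -/

namespace Sampler

/-- The cyclic successor of `k` in its block of length `m + 1`, for the full blocks below `L`. -/
def succIndex (m L k : ℕ) : ℕ :=
  if k < (m + 1) * (L / (m + 1)) then (m + 1) * (k / (m + 1)) + (k % (m + 1) + 1) % (m + 1) else k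

/-- The cyclic predecessor of `k` in its block of length `m + 1`, for the full blocks below `L`. -/
def predIndex (m L k : ℕ) : ℕ :=
  if k < (m + 1) * (L / (m + 1)) then (m + 1) * (k / (m + 1)) + (k % (m + 1) + m) % (m + 1) else k

/-- The wire with the number `i`. -/
def wire (N i : ℕ) : Fin (N + 1) := Fin.ofNat (N + 1) i

/-- The number of the wire that holds the spin of the vertex `v_j`. -/
def spinWire (m N j : ℕ) : ℕ := if j = 0 then N else N / 2 + succIndex m (N / 2) (j - 1)

/-- The wires of the non-root vertices, followed by the last wire. -/
def treeWire (N t : ℕ) : ℕ := if t < N / 2 then N / 2 + t else N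

/-- The circuit for `N + 1` qubits: a cat state on the tree, whose edge bits are written into the
first wires, followed by rotations. -/
def circuit (m q N : ℕ) : QCircuit (N + 1) :=
  [(List.range (N + 1 - N / 2)).map fun t => .had (wire N (N / 2 + t)),
    (List.range (N / 2)).map fun k => .cnot (wire N (spinWire m N (k + 1))) (wire N k),
    (List.range ((N / 2 + 1) / 2)).map fun j => .cnot (wire N (spinWire m N j)) (wire N (2 * j)),
    (List.range (N / 2 / 2)).map fun j => .cnot (wire N (spinWire m N j)) (wire N (2 * j + 1)),
    (List.range (N / 2 + 1)).map fun t => .had (wire N (treeWire N t)),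
    (List.range 1).map fun _ => .rot (wire N N),
    (List.range (N / 2 / (m + 1))).map fun t =>
      .block m q fun i => wire N (N / 2 + ((m + 1) * t + i))]

/-- The family of circuits. -/
def family (m : ℕ) (p : ℕ → ℕ) : ∀ n, QCircuit n
  | 0 => []
  | N + 1 => circuit m (p (N + 1)) N

/-! ### Arithmetic of blocks and wires -/

lemma block_index_lt {m t i K : ℕ} (ht : t < K) (hi : i < m + 1) :
    (m + 1) * t + i < (m + 1) * K := by
  calc (m + 1) * t + i < (m + 1) * t + (m + 1) := by omega
    _ = (m + 1) * (t + 1) := by ring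
    _ ≤ _ := Nat.mul_le_mul_left _ ht

lemma succIndex_block {m L t i : ℕ} (ht : t < L / (m + 1)) (hi : i < m + 1) :
    succIndex m L ((m + 1) * t + i) = (m + 1) * t + (i + 1) % (m + 1) := by
  rw [succIndex, if_pos (block_index_lt ht hi), Nat.mul_add_mod, Nat.mod_eq_of_lt hi,
    Nat.mul_add_div (by omega), Nat.div_eq_of_lt hi, add_zero]

lemma predIndex_block {m L t i : ℕ} (ht : t < L / (m + 1)) (hi : i < m + 1) :
    predIndex m L ((m + 1) * t + i) = (m + 1) * t + (i + m) % (m + 1) := by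
  rw [predIndex, if_pos (block_index_lt ht hi), Nat.mul_add_mod, Nat.mod_eq_of_lt hi,
    Nat.mul_add_div (by omega), Nat.div_eq_of_lt hi, add_zero]

lemma exists_block_index {m L k : ℕ} (hk : k < (m + 1) * (L / (m + 1))) :
    ∃ t i, t < L / (m + 1) ∧ i < m + 1 ∧ k = (m + 1) * t + i :=
  ⟨k / (m + 1), k % (m + 1), Nat.div_lt_of_lt_mul hk, Nat.mod_lt _ (by omega),
    (Nat.div_add_mod k (m + 1)).symm⟩

lemma succIndex_predIndex (m L k : ℕ) : succIndex m L (predIndex m L k) = k := by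
  by_cases hk : k < (m + 1) * (L / (m + 1))
  · obtain ⟨t, i, ht, hi, rfl⟩ := exists_block_index hk
    rw [predIndex_block ht hi, succIndex_block ht (Nat.mod_lt _ (by omega)), Nat.mod_add_mod,
      add_assoc, Nat.add_mod_right, Nat.mod_eq_of_lt hi]
  · rw [predIndex, if_neg hk, succIndex, if_neg hk]

lemma predIndex_succIndex (m L k : ℕ) : predIndex m L (succIndex m L k) = k := by
  by_cases hk : k < (m + 1) * (L / (m + 1))
  · obtain ⟨t, i, ht, hi, rfl⟩ := exists_block_index hk
    rw [succIndex_block ht hi, predIndex_block ht (Nat.mod_lt _ (by omega)), Nat.mod_add_mod,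
      add_assoc, add_comm 1 m, Nat.add_mod_right, Nat.mod_eq_of_lt hi]
  · rw [succIndex, if_neg hk, predIndex, if_neg hk]

lemma succIndex_lt {m L k : ℕ} (hk : k < L) : succIndex m L k < L := by
  by_cases h : k < (m + 1) * (L / (m + 1))
  · obtain ⟨t, i, ht, hi, rfl⟩ := exists_block_index h
    rw [succIndex_block ht hi]
    exact (block_index_lt ht (Nat.mod_lt _ (by omega))).trans_le (Nat.mul_div_le _ _)
  · rwa [succIndex, if_neg h]

lemma predIndex_lt {m L k : ℕ} (hk : k < L) : predIndex m L k < L := by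
  by_cases h : k < (m + 1) * (L / (m + 1))
  · obtain ⟨t, i, ht, hi, rfl⟩ := exists_block_index h
    rw [predIndex_block ht hi]
    exact (block_index_lt ht (Nat.mod_lt _ (by omega))).trans_le (Nat.mul_div_le _ _)
  · rwa [predIndex, if_neg h]

lemma wire_val {N i : ℕ} (hi : i ≤ N) : (wire N i : ℕ) = i :=
  Nat.mod_eq_of_lt (Nat.lt_succ_of_le hi)

lemma wire_inj {N i j : ℕ} (hi : i ≤ N) (hj : j ≤ N) : wire N i = wire N j ↔ i = j := by
  rw [Fin.ext_iff, wire_val hi, wire_val hj]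

lemma spinWire_le {m N j : ℕ} (hj : j ≤ N / 2) : spinWire m N j ≤ N := by
  rw [spinWire]
  split_ifs with h
  · exact le_rfl
  · have := succIndex_lt (m := m) (show j - 1 < N / 2 by omega)
    omega

lemma le_spinWire (m N j : ℕ) : N / 2 ≤ spinWire m N j := by
  rw [spinWire]
  split_ifs <;> omega

lemma spinWire_inj {m N i j : ℕ} (hi : i ≤ N / 2) (hj : j ≤ N / 2)
    (h : spinWire m N i = spinWire m N j) : i = j := by
  have key : ∀ j, j ≤ N / 2 → j ≠ 0 → spinWire m N j < N ∧
      predIndex m (N / 2) (spinWire m N j - N / 2) + 1 = j := fun j hj h0 => by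
    have := succIndex_lt (m := m) (show j - 1 < N / 2 by omega)
    rw [spinWire, if_neg h0, Nat.add_sub_cancel_left, predIndex_succIndex]
    omega
  have h0 : spinWire m N 0 = N := if_pos rfl
  by_cases hi0 : i = 0 <;> by_cases hj0 : j = 0
  · omega
  · subst hi0
    have := (key j hj hj0).1
    omega
  · subst hj0
    have := (key i hi hi0).1
    omega
  · rw [← (key i hi hi0).2, ← (key j hj hj0).2, h]

lemma treeWire_le (N t : ℕ) : treeWire N t ≤ N := by
  rw [treeWire]; split_ifs <;> omega

lemma treeWire_inj {N s t : ℕ} (hs : s ≤ N / 2) (ht : t ≤ N / 2)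
    (h : treeWire N s = treeWire N t) : s = t := by
  rw [treeWire, treeWire] at h
  split_ifs at h <;> omega

lemma block_wire_le {m N t i : ℕ} (ht : t < N / 2 / (m + 1)) (hi : i < m + 1) :
    N / 2 + ((m + 1) * t + i) ≤ N := by
  have := (block_index_lt ht hi).trans_le (Nat.mul_div_le (N / 2) (m + 1))
  omega

lemma block_index_inj {m t t' i i' : ℕ} (hi : i < m + 1) (hi' : i' < m + 1)
    (h : (m + 1) * t + i = (m + 1) * t' + i') : t = t' ∧ i = i' := by
  have h1 := congrArg (· / (m + 1)) h
  have h2 := congrArg (· % (m + 1)) h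
  simpa [Nat.mul_add_div, Nat.mul_add_mod, Nat.div_eq_of_lt, Nat.mod_eq_of_lt, hi, hi'] using
    And.intro h1 h2

/-! ### Validity and constant depth -/

lemma layer_isValid {n K : ℕ} {g : ℕ → QGate n} (hg : ∀ t < K, (g t).IsValid)
    (hd : ∀ t < K, ∀ t' < K, t ≠ t' → List.Disjoint (g t).wires (g t').wires) :
    (∀ γ ∈ (List.range K).map g, γ.IsValid) ∧
      ((List.range K).map g).Pairwise fun γ γ' => List.Disjoint γ.wires γ'.wires := by
  constructor
  · intro γ hγ
    obtain ⟨t, ht, rfl⟩ := List.mem_map.1 hγ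
    exact hg t (List.mem_range.1 ht)
  · rw [List.pairwise_map]
    refine (List.nodup_range (n := K)).imp_of_mem fun ha hb hab => ?_
    exact hd _ (List.mem_range.1 ha) _ (List.mem_range.1 hb) hab

lemma cnot_layer_isValid {N K : ℕ} {c t : ℕ → ℕ} (hc : ∀ j < K, N / 2 ≤ c j ∧ c j ≤ N)
    (ht : ∀ j < K, t j < N / 2) (hci : ∀ i < K, ∀ j < K, c i = c j → i = j)
    (hti : ∀ i < K, ∀ j < K, t i = t j → i = j) :
    (∀ γ ∈ (List.range K).map fun j => QGate.cnot (wire N (c j)) (wire N (t j)), γ.IsValid) ∧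
      ((List.range K).map fun j => QGate.cnot (wire N (c j)) (wire N (t j))).Pairwise
        fun γ γ' => List.Disjoint γ.wires γ'.wires := by
  have h2 : ∀ j < K, t j ≤ N := fun j hj => by have := ht j hj; omega
  refine layer_isValid (fun j hj => ⟨?_, trivial⟩) fun i hi j hj hij => ?_
  · have := hc j hj
    have := ht j hj
    simp [QGate.wires, wire_inj (hc j hj).2 (h2 j hj)]
    omega
  · have := hc i hi
    have := hc j hj
    have := ht i hi
    have := ht j hj
    have h3 : c i ≠ c j := fun h => hij (hci i hi j hj h)
    have h4 : t i ≠ t j := fun h => hij (hti i hi j hj h)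
    simp [QGate.wires, List.Disjoint, wire_inj, (hc j hj).2, (hc i hi).2, h2 i hi, h2 j hj]
    omega

lemma circuit_isValid {m q N : ℕ} (hq : 3 ≤ q) : (circuit m q N).IsValid := by
  intro layer hl
  simp only [circuit, List.mem_cons, List.not_mem_nil, or_false] at hl
  rcases hl with rfl | rfl | rfl | rfl | rfl | rfl | rfl
  · refine layer_isValid (fun t _ => ⟨by simp [QGate.wires], trivial⟩) fun t ht t' ht' h => ?_
    simp [QGate.wires, List.Disjoint,
      wire_inj (show N / 2 + t ≤ N by omega) (show N / 2 + t' ≤ N by omega), h]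
  · refine cnot_layer_isValid (c := fun k => spinWire m N (k + 1)) (t := fun k => k)
      (fun j hj => ⟨le_spinWire _ _ _, spinWire_le (by omega)⟩) (fun j hj => hj)
      (fun i hi j hj h => ?_) fun i _ j _ h => h
    have := spinWire_inj (by omega) (by omega) h
    omega
  · refine cnot_layer_isValid (c := fun k => spinWire m N k) (t := fun k => 2 * k)
      (fun j hj => ⟨le_spinWire _ _ _, spinWire_le (by omega)⟩) (fun j hj => by omega)
      (fun i hi j hj h => spinWire_inj (by omega) (by omega) h) fun i _ j _ h => ?_
    omega
  · refine cnot_layer_isValid (c := fun k => spinWire m N k) (t := fun k => 2 * k + 1)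
      (fun j hj => ⟨le_spinWire _ _ _, spinWire_le (by omega)⟩) (fun j hj => by omega)
      (fun i hi j hj h => spinWire_inj (by omega) (by omega) h) fun i _ j _ h => ?_
    omega
  · refine layer_isValid (fun t _ => ⟨by simp [QGate.wires], trivial⟩) fun t ht t' ht' h => ?_
    have : treeWire N t ≠ treeWire N t' := fun e => h (treeWire_inj (by omega) (by omega) e)
    simp [QGate.wires, List.Disjoint, wire_inj, treeWire_le, this]
  · exact layer_isValid (fun t _ => ⟨by simp [QGate.wires], trivial⟩) fun t ht t' ht' h => by omega
  · refine layer_isValid (fun t ht => ⟨?_, hq⟩) fun t ht t' ht' h => ?_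
    · rw [QGate.wires, List.nodup_ofFn]
      intro i j hij
      rw [wire_inj (block_wire_le ht i.2) (block_wire_le ht j.2)] at hij
      exact Fin.ext (by omega)
    · intro a ha hb
      rw [QGate.wires, List.mem_ofFn] at ha hb
      obtain ⟨i, rfl⟩ := ha
      obtain ⟨j, hj⟩ := hb
      rw [wire_inj (block_wire_le ht' j.2) (block_wire_le ht i.2)] at hj
      exact h (block_index_inj i.2 j.2 (by omega)).1

lemma isConstantDepthFamily (m : ℕ) {p : ℕ → ℕ} (hp : ∀ n, 3 ≤ p n) :
    IsConstantDepthFamily (family m p) := by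
  refine ⟨7, m + 2, fun n => ?_⟩
  rcases n with _ | N
  · exact ⟨fun l hl => by simp [family] at hl, by simp [family, QCircuit.depth],
      fun l hl => by simp [family] at hl⟩
  refine ⟨circuit_isValid (hp _), le_of_eq rfl, fun l hl g hg => ?_⟩
  simp only [family, circuit, List.mem_cons, List.not_mem_nil, or_false] at hl
  rcases hl with rfl | rfl | rfl | rfl | rfl | rfl | rfl <;>
    obtain ⟨t, _, rfl⟩ := List.mem_map.1 hg <;> simp [QGate.wires]

/-! ### Uniformity -/

section Uniform

open Ram

variable {Γ ι : Type} [Fintype ι] {V : ι → Γ → ℕ} {N f g : Γ → ℕ}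

lemma computes_half (hN : Computes V N) : Computes V fun γ => N γ / 2 :=
  hN.div (Computes.const 2) fun _ => two_pos

lemma computes_succIndex (m : ℕ) (hN : Computes V N) (hf : Computes V f) :
    Computes V fun γ => succIndex m (N γ) (f γ) := by
  have hm : Computes V fun _ => m + 1 := Computes.const _
  have hm0 : ∀ _ : Γ, 0 < m + 1 := fun _ => Nat.succ_pos m
  have := Computes.ite (hf.lt (hm.mul (hN.div hm hm0)))
    ((hm.mul (hf.div hm hm0)).add (((hf.mod hm hm0).add (Computes.const 1)).mod hm hm0)) hf
  refine (congrArg (Computes V) (funext fun γ => ?_)).mp this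
  rw [succIndex]
  congr

lemma computes_spinWire (m : ℕ) (hN : Computes V N) (hf : Computes V f) :
    Computes V fun γ => spinWire m (N γ) (f γ) := by
  have := Computes.ite (hf.eq (Computes.const 0)) hN ((computes_half hN).add
    (computes_succIndex m (computes_half hN) (hf.sub (Computes.const 1))))
  refine (congrArg (Computes V) (funext fun γ => ?_)).mp this
  rw [spinWire]
  congr

lemma computes_treeWire (hN : Computes V N) (hf : Computes V f) :
    Computes V fun γ => treeWire (N γ) (f γ) := by
  have := Computes.ite (hf.lt (computes_half hN)) ((computes_half hN).add hf) hN
  refine (congrArg (Computes V) (funext fun γ => ?_)).mp this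
  rw [treeWire]
  congr

lemma writes_wire (hN : Computes V N) (hf : Computes V f) :
    Writes V fun γ => describeNat (wire (N γ) (f γ)) :=
  Writes.describeNat (hf.mod (hN.add (Computes.const 1)) fun _ => Nat.succ_pos _)

lemma writes_layer {G : Γ → Σ n, ℕ → QGate n} (hf : Computes V f)
    (h : Writes (ext V) fun x => ((G x.1).2 x.2).describe) :
    Writes V fun γ => CircSym.layer :: ((List.range (f γ)).map (G γ).2).flatMap QGate.describe := by
  simpa only [List.flatMap_map] using! (Writes.word [CircSym.layer]).append
    (Writes.flatMap (w := fun γ t => ((G γ).2 t).describe) hf h)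

lemma writes_circuit (m : ℕ) {q : Γ → ℕ} (hN : Computes V N) (hq : Computes V q) :
    Writes V fun γ => (circuit m (q γ) (N γ)).describe := by
  have hN' := hN.weaken
  have hL := computes_half hN
  have hL' := computes_half hN'
  have hm : ∀ {Γ ι : Type} [Fintype ι] {V : ι → Γ → ℕ}, Computes V fun _ => m + 1 :=
    Computes.const _
  have two : Computes (ext V) fun _ => 2 := Computes.const 2
  have one : ∀ {Γ ι : Type} [Fintype ι] {V : ι → Γ → ℕ}, Computes V fun _ => 1 := Computes.const 1
  have l1 := writes_layer (G := fun γ => ⟨_, fun t => .had (wire (N γ) (N γ / 2 + t))⟩)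
    ((hN.add one).sub hL)
    ((Writes.word [CircSym.had]).append (writes_wire hN' (hL'.add Computes.new)))
  have l2 := writes_layer (G := fun γ => ⟨_, fun k => .cnot (wire (N γ) (spinWire m (N γ) (k + 1)))
      (wire (N γ) k)⟩) hL
    ((Writes.word [CircSym.cnot]).append
      ((writes_wire hN' (computes_spinWire m hN' (Computes.new.add one))).append
        (writes_wire hN' Computes.new)))
  have l3 := writes_layer (G := fun γ => ⟨_, fun k => .cnot (wire (N γ) (spinWire m (N γ) k))
      (wire (N γ) (2 * k))⟩) (computes_half (hL.add one))
    ((Writes.word [CircSym.cnot]).append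
      ((writes_wire hN' (computes_spinWire m hN' Computes.new)).append
        (writes_wire hN' (two.mul Computes.new))))
  have l4 := writes_layer (G := fun γ => ⟨_, fun k => .cnot (wire (N γ) (spinWire m (N γ) k))
      (wire (N γ) (2 * k + 1))⟩) (computes_half hL)
    ((Writes.word [CircSym.cnot]).append
      ((writes_wire hN' (computes_spinWire m hN' Computes.new)).append
        (writes_wire hN' ((two.mul Computes.new).add one))))
  have l5 := writes_layer (G := fun γ => ⟨_, fun t => .had (wire (N γ) (treeWire (N γ) t))⟩)
    (hL.add one)
    ((Writes.word [CircSym.had]).append (writes_wire hN' (computes_treeWire hN' Computes.new)))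
  have l6 := writes_layer (G := fun γ => ⟨_, fun _ => .rot (wire (N γ) (N γ))⟩) (one (V := V))
    ((Writes.word [CircSym.rot]).append (writes_wire hN' hN'))
  have l7 := writes_layer (V := V) (G := fun γ => ⟨_, fun t => .block m (q γ) fun i =>
      wire (N γ) (N γ / 2 + ((m + 1) * t + i))⟩) (hL.div hm fun _ => Nat.succ_pos m) (by
    have hw := Writes.flatMap (V := ext V) (w := fun x i => describeNat
      (wire (N x.1) (N x.1 / 2 + ((m + 1) * x.2 + i)))) (hm (V := ext V))
      (writes_wire hN'.weaken (hL'.weaken.add ((hm.mul Computes.new.weaken).add Computes.new)))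
    have := (Writes.word [CircSym.block]).append
      (((Writes.describeNat (Computes.const m)).append (Writes.describeNat hq.weaken)).append hw)
    refine (congrArg (Writes (ext V)) (funext fun x => ?_)).mp this
    simp [QGate.describe, List.ofFn_eq_map, ← List.map_coe_finRange_eq_range, List.flatMap_map,
      List.flatMap_assoc, -List.ofFn_succ])
  have := ((((((l1.append l2).append l3).append l4).append l5).append l6).append l7)
  refine (congrArg (Writes V) (funext fun γ => ?_)).mp this
  simp only [circuit, QCircuit.describe, List.flatMap_cons, List.flatMap_nil, List.append_nil,
    List.append_assoc, List.cons_append]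

lemma isUniformFamily (m : ℕ) {p : ℕ → ℕ} (hp : Computes (fun (_ : Unit) (n : ℕ) => n) p) :
    IsUniformFamily (family m p) := by
  refine Ram.isUniformFamily ?_
  have hn : Computes (fun (_ : Unit) (n : ℕ) => n) fun n => n := Computes.var ()
  have := Writes.guard ((Computes.const 0).lt hn)
    (writes_circuit m (hn.sub (Computes.const 1)) hp)
  refine (congrArg (Writes _) (funext fun n => ?_)).mp this
  rcases n with _ | N
  · exact if_neg (lt_irrefl 0)
  · exact if_pos (Nat.succ_pos N)

end Uniform

end Sampler

namespace Sampler

/-! ### The final state -/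

/-- No control is a target and the targets are distinct, so the gates can be applied simultaneously:
the layer is composition with the map `f` on basis strings. -/
lemma foldl_cnot {n : ℕ} (K : ℕ) (c t : ℕ → Fin n) (hct : ∀ i < K, ∀ j < K, c i ≠ t j)
    (ht : ∀ i < K, ∀ j < K, t i = t j → i = j) (f : (Fin n → Bool) → Fin n → Bool)
    (hf : ∀ x, ∀ j < K, f x (t j) = xor (x (c j)) (x (t j)))
    (hf' : ∀ x i, (∀ j < K, t j ≠ i) → f x i = x i) (φ : (Fin n → Bool) → ℂ) :
    (List.range K).foldl (fun ψ j => (QGate.cnot (c j) (t j)).toMatrix.mulVec ψ) φ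
      = fun x => φ (f x) := by
  classical
  induction K generalizing f with
  | zero =>
    funext x
    exact congrArg φ (funext fun i => (hf' x i fun j hj => by omega).symm)
  | succ K ih =>
    rw [List.range_succ, List.foldl_append, List.foldl_cons, List.foldl_nil,
      ih (fun i hi j hj => hct i (by omega) j (by omega))
        (fun i hi j hj => ht i (by omega) j (by omega))
        (fun x => Function.update (f x) (t K) (x (t K))),
      cnot_mulVec (hct K (by omega) K (by omega))]
    · funext x
      refine congrArg φ (funext fun i => ?_)
      by_cases hi : i = t K
      · subst hi
        rw [Function.update_self, Function.update_self, hf x K (by omega)]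
      · rw [Function.update_of_ne hi]
        by_cases hi' : ∃ j < K, t j = i
        · obtain ⟨j, hj, rfl⟩ := hi'
          rw [hf _ j (by omega), hf _ j (by omega), Function.update_of_ne hi,
            Function.update_of_ne (hct j (by omega) K (by omega))]
        · push Not at hi'
          have h : ∀ j < K + 1, t j ≠ i := fun j hj => by
            rcases Nat.lt_succ_iff_lt_or_eq.1 hj with h | rfl
            · exact hi' j h
            · exact Ne.symm hi
          rw [hf' _ i h, hf' _ i h, Function.update_of_ne hi]
    · intro x j hj
      rw [Function.update_of_ne fun e => hj.ne (ht j (by omega) K (by omega) e),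
        hf x j (by omega)]
    · intro x i hi
      by_cases hiK : i = t K
      · rw [hiK, Function.update_self]
      · rw [Function.update_of_ne hiK]
        refine hf' x i fun j hj => ?_
        rcases Nat.lt_succ_iff_lt_or_eq.1 hj with h | rfl
        · exact hi j h
        · exact Ne.symm hiK

lemma prod_range_mul {M : Type*} [CommMonoid M] (m K : ℕ) (f : ℕ → M) :
    ∏ j ∈ Finset.range ((m + 1) * K), f j
      = ∏ t ∈ Finset.range K, ∏ i : Fin (m + 1), f ((m + 1) * t + i) := by
  induction K with
  | zero => simp
  | succ K ih =>
    rw [Finset.prod_range_succ _ K, ← ih, mul_add, mul_one, Finset.prod_range_add]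
    congr 1
    exact Finset.prod_range fun i => f ((m + 1) * K + i)

lemma prod_range_blocks {M : Type*} [CommMonoid M] (m L : ℕ) (f : ℕ → M) :
    ∏ j ∈ Finset.range L, f j
      = (∏ t ∈ Finset.range (L / (m + 1)), ∏ i : Fin (m + 1), f ((m + 1) * t + i))
        * ∏ j ∈ Finset.Ico ((m + 1) * (L / (m + 1))) L, f j := by
  rw [← prod_range_mul, Finset.range_eq_Ico, Finset.range_eq_Ico,
    Finset.prod_Ico_consecutive f (Nat.zero_le _) (Nat.mul_div_le L (m + 1))]

/-- The action of a layer. -/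
noncomputable def applyLayer {n : ℕ} (φ : (Fin n → Bool) → ℂ) (layer : List (QGate n)) :
    (Fin n → Bool) → ℂ :=
  layer.foldl (fun φ g => g.toMatrix.mulVec φ) φ

lemma applyLayer_map {n K : ℕ} (g : ℕ → QGate n) (φ : (Fin n → Bool) → ℂ) :
    applyLayer φ ((List.range K).map g)
      = (List.range K).foldl (fun φ t => (g t).toMatrix.mulVec φ) φ :=
  List.foldl_map

lemma applyLayer_sum {n : ℕ} {ι : Type*} [Fintype ι] (layer : List (QGate n)) (c : ι → ℂ)
    (φ : ι → (Fin n → Bool) → ℂ) :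
    applyLayer (∑ i, c i • φ i) layer = ∑ i, c i • applyLayer (φ i) layer :=
  foldl_mulVec_sum layer QGate.toMatrix c φ

lemma applyLayer_had {n K : ℕ} {w : ℕ → Fin n} (hw : ∀ t < K, ∀ t' < K, w t = w t' → t = t')
    {R : (Fin n → Bool) → ℂ} (hR : ∀ x y, (∀ i, (∀ t < K, w t ≠ i) → x i = y i) → R x = R y)
    (b : ℕ → Bool) :
    applyLayer (fun x => R x * ∏ t ∈ Finset.range K, if x (w t) = b t then 1 else 0)
        ((List.range K).map fun t => .had (w t))
      = fun x => R x * ∏ t ∈ Finset.range K, hadEntry (x (w t)) (b t) := by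
  rw [applyLayer_map]
  refine (foldl_onWires_mulVec hadMatrix K (fun t => ![w t])
    (fun t _ => Function.injective_of_subsingleton _) (fun t ht t' ht' h j j' => ?_) R
    (fun x y h => hR x y fun i hi => h i fun t ht j => ?_)
    fun t v => if v 0 = b t then 1 else 0).trans ?_
  · rw [Subsingleton.elim j 0, Subsingleton.elim j' 0]
    exact fun e => h (hw t ht t' ht' e)
  · rw [Subsingleton.elim j 0]
    exact hi t ht
  · simp only [hadMatrix_mulVec_indicator]
    rfl

variable (m N : ℕ)

/-- The condition that the edge bits are the differences of the spins. -/
def IsCat (y : Fin (N + 1) → Bool) : Prop :=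
  ∀ k < N / 2, y (wire N k)
    = xor (y (wire N (spinWire m N (k + 1)))) (y (wire N (spinWire m N (k / 2))))

/-- The wires that are not at tree vertices carry the same bits. -/
def AgreeOff (x y : Fin (N + 1) → Bool) : Prop :=
  ∀ i, (∀ t < N / 2 + 1, wire N (treeWire N t) ≠ i) → x i = y i

/-- The entries of the product of `exp(-iπX/4)` and the Hadamard matrix. -/
noncomputable def rotHadEntry (a c : Bool) : ℂ := ∑ b, rotX (Real.pi / 4) a b * hadEntry b c

open Classical in
/-- The state after the layers of CNOT gates. -/
lemma applyLayer_cat :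
    (((circuit m q N).take 4).foldl applyLayer (Pi.single (fun _ => false) 1))
      = fun y => (1 / (Real.sqrt 2 : ℂ)) ^ (N + 1 - N / 2) * if IsCat m N y then 1 else 0 := by
  have h2 : ∀ k < N / 2, ∀ j, wire N (spinWire m N j) ≠ wire N k ∨ ¬ j ≤ N / 2 := by
    intro k hk j
    by_cases hj : j ≤ N / 2
    · left
      have := le_spinWire m N j
      rw [Ne, wire_inj (spinWire_le hj) (by omega)]
      omega
    · exact .inr hj
  have h3 : ∀ k < N / 2, ∀ j ≤ N / 2, wire N (spinWire m N j) ≠ wire N k := fun k hk j hj =>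
    (h2 k hk j).resolve_right (not_not.2 hj)
  simp only [circuit, List.take_succ_cons, List.take_zero, List.foldl_cons, List.foldl_nil]
  -- The initial state is written as a product, with one factor for each wire that receives a
  -- Hadamard gate.
  have e1 : (Pi.single (fun _ => false) 1 : (Fin (N + 1) → Bool) → ℂ) = fun y =>
      (if ∀ k < N / 2, y (wire N k) = false then 1 else 0)
        * ∏ t ∈ Finset.range (N + 1 - N / 2),
            if y (wire N (N / 2 + t)) = (fun _ => false) t then 1 else 0 := by
    funext y
    rw [Finset.prod_boole, ite_zero_mul_ite_zero, one_mul, Pi.single_apply]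
    refine if_congr ?_ rfl rfl
    constructor
    · rintro rfl
      simp
    · rintro ⟨ha, hb⟩
      funext i
      have hi : i = wire N i := Fin.ext (wire_val (Nat.lt_succ_iff.1 i.2)).symm
      by_cases h : (i : ℕ) < N / 2
      · rw [hi]; exact ha _ h
      · have := hb (i - N / 2) (Finset.mem_range.2 (by omega))
        rwa [show N / 2 + (i - N / 2) = (i : ℕ) by omega, ← hi] at this
  rw [e1, applyLayer_had]
  rotate_left
  · intro t ht t' ht' h
    rw [wire_inj (by omega) (by omega)] at h
    omega
  · intro x y h
    refine if_congr (forall₂_congr fun k hk => ?_) rfl rfl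
    rw [h]
    intro t ht
    rw [Ne, wire_inj (by omega) (by omega)]
    omega
  rw [applyLayer_map, applyLayer_map, applyLayer_map]
  rw [foldl_cnot (N / 2) _ _ (fun i hi j hj => h3 j hj _ (by omega))
    (fun i hi j hj h => (wire_inj (by omega) (by omega)).1 h)
    (fun x i => if (i : ℕ) < N / 2 then xor (x (wire N (spinWire m N (i + 1)))) (x i) else x i)
    (fun x j hj => by
      rw [wire_val (by omega), if_pos hj])
    (fun x i h => if_neg fun hi => h i hi (Fin.ext (wire_val (by omega))))]
  rw [foldl_cnot ((N / 2 + 1) / 2) _ _ (fun i hi j hj => h3 _ (by omega) _ (by omega))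
    (fun i hi j hj h => by
      have := (wire_inj (by omega) (by omega)).1 h
      omega)
    (fun x i => if (i : ℕ) < N / 2 ∧ (i : ℕ) % 2 = 0 then
      xor (x (wire N (spinWire m N (i / 2)))) (x i) else x i)
    (fun x j hj => by
      rw [wire_val (by omega), if_pos ⟨by omega, by omega⟩, show 2 * j / 2 = j by omega])
    (fun x i h => if_neg fun hi => h (i / 2) (by omega) (Fin.ext (by
      rw [wire_val (by omega)]; omega)))]
  rw [foldl_cnot (N / 2 / 2) _ _ (fun i hi j hj => h3 _ (by omega) _ (by omega))
    (fun i hi j hj h => by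
      have := (wire_inj (by omega) (by omega)).1 h
      omega)
    (fun x i => if (i : ℕ) < N / 2 ∧ (i : ℕ) % 2 = 1 then
      xor (x (wire N (spinWire m N (i / 2)))) (x i) else x i)
    (fun x j hj => by
      rw [wire_val (by omega), if_pos ⟨by omega, by omega⟩, show (2 * j + 1) / 2 = j by omega])
    (fun x i h => if_neg fun hi => h (i / 2) (by omega) (Fin.ext (by
      rw [wire_val (by omega)]; omega)))]
  funext y
  have e2 : ∀ b, hadEntry b false = 1 / (Real.sqrt 2 : ℂ) := fun b => by simp [hadEntry]
  simp only [e2, Finset.prod_const, Finset.card_range]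
  rw [mul_comm]
  congr 1
  refine if_congr (forall₂_congr fun k hk => ?_) rfl rfl
  have h4 : ∀ j ≤ N / 2, ¬ ((wire N (spinWire m N j) : ℕ) < N / 2) := fun j hj => by
    have := le_spinWire m N j
    rw [wire_val (spinWire_le hj)]
    omega
  have h5 := h4 (k + 1) (by omega)
  have h6 := h4 (k / 2) (by omega)
  -- Edge `k` receives the spin of its parent end in the third layer for even `k` and in the fourth
  -- for odd `k`; thus a vertex controls at most one gate per layer.
  rcases Nat.mod_two_eq_zero_or_one k with h | h <;>
    simp [wire_val (show k ≤ N by omega), hk, h, h5, h6] <;>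
    generalize y (wire N k) = a <;> generalize y (wire N (spinWire m N (k + 1))) = b <;>
    generalize y (wire N (spinWire m N (k / 2))) = c <;> revert a b c <;> decide

open Classical in
/-- The last three layers, applied to a basis state. -/
lemma applyLayer_single (q : ℕ) (y : Fin (N + 1) → Bool) :
    ((circuit m q N).drop 4).foldl applyLayer (Pi.single y 1)
      = fun x => (if AgreeOff N x y then 1 else 0) * (rotHadEntry (x (wire N N)) (y (wire N N))
        * ((∏ t ∈ Finset.range (N / 2 / (m + 1)), (blockMatrix m (Real.pi / q)).mulVec
            (fun u => ∏ i, hadEntry (u i) (y (wire N (N / 2 + ((m + 1) * t + i)))))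
            fun i => x (wire N (N / 2 + ((m + 1) * t + i))))
          * ∏ j ∈ Finset.Ico ((m + 1) * (N / 2 / (m + 1))) (N / 2),
              hadEntry (x (wire N (N / 2 + j))) (y (wire N (N / 2 + j))))) := by
  have hA : ∀ {x x' : Fin (N + 1) → Bool} {S : Fin (N + 1) → Prop},
      (∀ i, S i → ∃ t < N / 2 + 1, wire N (treeWire N t) = i) → (∀ i, ¬ S i → x i = x' i) →
        (AgreeOff N x y ↔ AgreeOff N x' y) := fun {x x' S} hS h =>
    forall₂_congr fun i hi => by rw [h i fun hSi => ?_]; obtain ⟨t, ht, e⟩ := hS i hSi; exact hi t ht e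
  have hroot : wire N (treeWire N (N / 2)) = wire N N := by
    rw [treeWire, if_neg (lt_irrefl _)]
  have hvert : ∀ j < N / 2, wire N (treeWire N j) = wire N (N / 2 + j) := fun j hj => by
    rw [treeWire, if_pos hj]
  have hne : ∀ j < N / 2, wire N N ≠ wire N (N / 2 + j) := fun j hj => by
    rw [Ne, wire_inj le_rfl (by omega)]
    omega
  simp only [circuit, List.drop_succ_cons, List.drop_zero, List.foldl_cons, List.foldl_nil]
  have e1 : (Pi.single y 1 : (Fin (N + 1) → Bool) → ℂ) = fun x =>
      (if AgreeOff N x y then 1 else 0)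
        * ∏ t ∈ Finset.range (N / 2 + 1),
            if x (wire N (treeWire N t)) = (fun t => y (wire N (treeWire N t))) t then 1 else 0 := by
    funext x
    rw [Finset.prod_boole, ite_zero_mul_ite_zero, one_mul, Pi.single_apply]
    refine if_congr ?_ rfl rfl
    constructor
    · rintro rfl
      exact ⟨fun _ _ => rfl, fun _ _ => rfl⟩
    · rintro ⟨ha, hb⟩
      funext i
      by_cases h : ∃ t < N / 2 + 1, wire N (treeWire N t) = i
      · obtain ⟨t, ht, rfl⟩ := h
        exact hb t (Finset.mem_range.2 ht)
      · push Not at h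
        exact ha i h
  rw [e1, applyLayer_had (fun t ht t' ht' h => treeWire_inj (by omega) (by omega)
    ((wire_inj (treeWire_le _ _) (treeWire_le _ _)).1 h)) fun x x' h =>
      if_congr (hA (S := fun i => ∃ t < N / 2 + 1, wire N (treeWire N t) = i) (fun _ h => h)
        fun i hi => h i (by push Not at hi; exact hi)) rfl rfl]
  have e2 : (fun x : Fin (N + 1) → Bool => (if AgreeOff N x y then (1 : ℂ) else 0)
        * ∏ t ∈ Finset.range (N / 2 + 1),
          hadEntry (x (wire N (treeWire N t))) (y (wire N (treeWire N t))))
      = fun x => ((if AgreeOff N x y then (1 : ℂ) else 0)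
        * ∏ j ∈ Finset.range (N / 2), hadEntry (x (wire N (N / 2 + j))) (y (wire N (N / 2 + j))))
          * ∏ t ∈ Finset.range 1, (fun _ v => hadEntry (v 0) (y (wire N N)) :
              ℕ → (Fin 1 → Bool) → ℂ) t fun i => x (![wire N N] i) := by
    funext x
    rw [Finset.prod_range_succ, hroot, Finset.prod_range_one, ← mul_assoc]
    congr 2
    exact Finset.prod_congr rfl fun j hj => by rw [hvert j (Finset.mem_range.1 hj)]
  rw [e2, applyLayer_map (K := 1)]
  have e3 := foldl_onWires_mulVec rotMatrix 1 (fun _ => ![wire N N])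
    (fun t _ => Function.injective_of_subsingleton _) (fun t ht t' ht' h => by omega)
    (fun x : Fin (N + 1) → Bool => (if AgreeOff N x y then (1 : ℂ) else 0)
      * ∏ j ∈ Finset.range (N / 2), hadEntry (x (wire N (N / 2 + j))) (y (wire N (N / 2 + j))))
    (fun x x' h => by
      have h' : ∀ i, ¬ (i = wire N N) → x i = x' i := fun i hi => h i fun t _ j => by
        rw [Subsingleton.elim j 0]
        exact fun e => hi e.symm
      congr 1
      · exact if_congr (hA (S := fun i => i = wire N N) (fun i hi => ⟨N / 2, by omega, by
          rw [hroot, hi]⟩) h') rfl rfl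
      · exact Finset.prod_congr rfl fun j hj => by
          rw [h' _ (hne j (Finset.mem_range.1 hj)).symm])
    (fun _ v => hadEntry (v 0) (y (wire N N)))
  refine (congrArg (fun φ => applyLayer φ _) e3).trans ?_
  have e4 : ∀ b c : Bool, rotMatrix.mulVec (fun v => hadEntry (v 0) c) (fun _ => b)
      = rotHadEntry b c := fun b c => by
    simp only [Matrix.mulVec, dotProduct]
    rw [← (Equiv.funUnique (Fin 1) Bool).symm.sum_comp]
    rfl
  -- The Hadamard factors are regrouped: those in full blocks are about to be rotated, the fewer
  -- than `m + 1` leftover vertices join the passive part.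
  have e5 : (fun x : Fin (N + 1) → Bool => ((if AgreeOff N x y then (1 : ℂ) else 0)
        * ∏ j ∈ Finset.range (N / 2), hadEntry (x (wire N (N / 2 + j))) (y (wire N (N / 2 + j))))
          * ∏ t ∈ Finset.range 1, rotMatrix.mulVec (fun v => hadEntry (v 0) (y (wire N N)))
            fun i => x (![wire N N] i))
      = fun x => ((if AgreeOff N x y then (1 : ℂ) else 0) * (rotHadEntry (x (wire N N))
          (y (wire N N)) * ∏ j ∈ Finset.Ico ((m + 1) * (N / 2 / (m + 1))) (N / 2),
              hadEntry (x (wire N (N / 2 + j))) (y (wire N (N / 2 + j)))))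
        * ∏ t ∈ Finset.range (N / 2 / (m + 1)), (fun t u => ∏ i, hadEntry (u i)
            (y (wire N (N / 2 + ((m + 1) * t + i)))) : ℕ → (Fin (m + 1) → Bool) → ℂ) t
              fun i => x (wire N (N / 2 + ((m + 1) * t + i))) := by
    funext x
    rw [Finset.prod_range_one, prod_range_blocks m (N / 2)]
    have : (fun i => x (![wire N N] i)) = fun _ => x (wire N N) :=
      funext fun i => by rw [Subsingleton.elim i 0]; rfl
    rw [this, e4]
    ring
  rw [e5, applyLayer_map]
  have hlt : ∀ t < N / 2 / (m + 1), ∀ i < m + 1, (m + 1) * t + i < N / 2 := fun t ht i hi =>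
    (block_index_lt ht hi).trans_le (Nat.mul_div_le _ _)
  refine (foldl_onWires_mulVec (blockMatrix m (Real.pi / q)) (N / 2 / (m + 1))
    (fun t i => wire N (N / 2 + ((m + 1) * t + i))) ?_ ?_
    (fun x => (if AgreeOff N x y then 1 else 0) * (rotHadEntry (x (wire N N)) (y (wire N N))
      * ∏ j ∈ Finset.Ico ((m + 1) * (N / 2 / (m + 1))) (N / 2),
          hadEntry (x (wire N (N / 2 + j))) (y (wire N (N / 2 + j))))) ?_
    (fun t u => ∏ i, hadEntry (u i) (y (wire N (N / 2 + ((m + 1) * t + i)))))).trans ?_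
  · intro t ht i j h
    exact Fin.ext (block_index_inj (t := t) (t' := t) i.2 j.2
      (by have := (wire_inj (block_wire_le ht i.2) (block_wire_le ht j.2)).1 h; omega)).2
  · intro t ht t' ht' h i j e
    exact h (block_index_inj i.2 j.2
      (by have := (wire_inj (block_wire_le ht i.2) (block_wire_le ht' j.2)).1 e; omega)).1
  · intro x x' h
    have hk : ∀ k ≤ N, (∀ t < N / 2 / (m + 1), ∀ i : Fin (m + 1), N / 2 + ((m + 1) * t + i) ≠ k) →
        x (wire N k) = x' (wire N k) := fun k hk hne => h _ fun t ht i e =>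
      hne t ht i ((wire_inj (block_wire_le ht i.2) hk).1 e)
    rw [hk N le_rfl fun t ht i => by have := hlt t ht i i.2; omega]
    congr 1
    · refine if_congr (hA (S := fun i => ∃ t < N / 2 / (m + 1), ∃ j : Fin (m + 1),
        wire N (N / 2 + ((m + 1) * t + j)) = i) ?_ fun i hi => h i ?_) rfl rfl
      · rintro _ ⟨t, ht, j, rfl⟩
        exact ⟨_, (hlt t ht j j.2).trans (Nat.lt_succ_self _), hvert _ (hlt t ht j j.2)⟩
      · push Not at hi
        exact hi
    · congr 1
      refine Finset.prod_congr rfl fun j hj => ?_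
      rw [Finset.mem_Ico] at hj
      rw [hk _ (by omega) fun t ht i => by have := block_index_lt ht i.2; omega]
  · funext x
    ring

/-- The spin at the wire `N / 2 + j`, for given edge bits and a given spin of the root. -/
def spin (x : Fin (N + 1) → Bool) (c : Bool) (j : ℕ) : Bool :=
  xor c (pathParity (fun k => x (wire N k)) (predIndex m (N / 2) j + 1))

/-- The state after the CNOT layers is uniform on the strings whose edge bits are spin differences.
The last three layers do not touch the edge wires or the spare wire (present for odd `N`), so an
outcome `x` receives amplitude from just two strings, one for each root spin `c`. -/
lemma finalState_circuit (q : ℕ) (x : Fin (N + 1) → Bool) :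
    (circuit m q N).finalState x = (1 / (Real.sqrt 2 : ℂ)) ^ (N + 1 - N / 2) *
      ∑ c, rotHadEntry (x (wire N N)) c
        * ((∏ t ∈ Finset.range (N / 2 / (m + 1)), (blockMatrix m (Real.pi / q)).mulVec
            (fun u => ∏ i, hadEntry (u i) (spin m N x c ((m + 1) * t + i)))
            fun i => x (wire N (N / 2 + ((m + 1) * t + i))))
          * ∏ j ∈ Finset.Ico ((m + 1) * (N / 2 / (m + 1))) (N / 2),
              hadEntry (x (wire N (N / 2 + j))) (spin m N x c j)) := by
  classical
  have h0 : (circuit m q N).finalState = ((circuit m q N).drop 4).foldl applyLayer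
      (((circuit m q N).take 4).foldl applyLayer (Pi.single (fun _ => false) 1)) := by
    rw [← List.foldl_append, List.take_append_drop]
    rfl
  have hsum : ∀ (ls : List (List (QGate (N + 1)))) (φ : (Fin (N + 1) → Bool) → ℂ),
      ls.foldl applyLayer φ = ∑ y, φ y • ls.foldl applyLayer (Pi.single y 1) := by
    intro ls φ
    have h1 : φ = ∑ y, φ y • (Pi.single y 1 : (Fin (N + 1) → Bool) → ℂ) := by
      funext z
      simp [Finset.sum_apply, Pi.single_apply]
    have h2 : ∀ (ls : List (List (QGate (N + 1)))) (ψ : (Fin (N + 1) → Bool) → _),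
        ls.foldl applyLayer (∑ y, φ y • ψ y) = ∑ y, φ y • ls.foldl applyLayer (ψ y) := by
      intro ls
      induction ls with
      | nil => intro ψ; rfl
      | cons l ls ih =>
        intro ψ
        rw [List.foldl_cons, applyLayer_sum, ih]
        rfl
    conv_lhs => rw [h1]
    exact h2 ls _
  rw [h0, applyLayer_cat, hsum, Finset.sum_apply]
  simp only [Pi.smul_apply, smul_eq_mul, applyLayer_single, mul_assoc]
  rw [← Finset.mul_sum]
  congr 1
  -- the two basis states that contribute
  set Y : Bool → Fin (N + 1) → Bool := fun c i =>
    if (i : ℕ) = N then c else if (i : ℕ) < N / 2 then x i else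
      if (i : ℕ) < N / 2 + N / 2 then spin m N x c (i - N / 2) else x i with hY
  have hYN : ∀ c, Y c (wire N N) = c := fun c => by simp only [hY, wire_val le_rfl, if_true]
  have hYk : ∀ c, ∀ k < N / 2, Y c (wire N k) = x (wire N k) := fun c k hk => by
    simp only [hY]
    rw [wire_val (by omega), if_neg (by omega), if_pos hk]
  have hYj : ∀ c, ∀ j < N / 2, Y c (wire N (N / 2 + j)) = spin m N x c j := fun c j hj => by
    simp only [hY]
    rw [wire_val (by omega), if_neg (by omega), if_neg (by omega), if_pos (by omega),
      Nat.add_sub_cancel_left]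
  have hYs : ∀ c, ∀ j ≤ N / 2, Y c (wire N (spinWire m N j))
      = xor c (pathParity (fun k => x (wire N k)) j) := fun c j hj => by
    rcases j with _ | k
    · simp [spinWire, hYN, pathParity]
    · rw [spinWire, if_neg (by omega), Nat.add_sub_cancel, hYj c _ (succIndex_lt (by omega)), spin,
        predIndex_succIndex]
  have hYA : ∀ c, AgreeOff N x (Y c) := fun c i hi => by
    have h1 : (i : ℕ) ≠ N := fun h => hi (N / 2) (by omega) (by
      rw [treeWire, if_neg (lt_irrefl _)]
      exact Fin.ext (by rw [wire_val le_rfl, h]))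
    simp only [hY]
    rw [if_neg h1]
    split_ifs with h2 h3
    · rfl
    · exact absurd (Fin.ext (by
        rw [treeWire, if_pos (by omega), wire_val (by omega)]; omega)) (hi (i - N / 2) (by omega))
    · rfl
  have hYC : ∀ c, IsCat m N (Y c) := fun c k hk => by
    rw [hYk c k hk, hYs c _ (by omega), hYs c _ (by omega), pathParity]
    generalize x (wire N k) = a
    generalize pathParity _ _ = b
    revert a b c
    decide
  -- The edge bits propagate the root spin down the tree.
  have huniq : ∀ y, IsCat m N y → AgreeOff N x y → y = Y (y (wire N N)) := by
    intro y hC hA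
    have hk : ∀ k < N / 2, x (wire N k) = y (wire N k) := fun k hk => hA _ fun t _ => by
      rw [Ne, wire_inj (treeWire_le _ _) (by omega), treeWire]
      split_ifs <;> omega
    have hs : ∀ j ≤ N / 2, y (wire N (spinWire m N j))
        = xor (y (wire N N)) (pathParity (fun k => x (wire N k)) j) := by
      intro j
      induction j using Nat.strong_induction_on with
      | _ j ih =>
        intro hj
        rcases j with _ | k
        · simp [spinWire, pathParity]
        · have h1 := hC k (by omega)
          have h2 := ih (k / 2) (by omega) (by omega)
          rw [h2, ← hk k (by omega)] at h1
          rw [pathParity, h1]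
          generalize y (wire N (spinWire m N (k + 1))) = a
          generalize y (wire N N) = b
          generalize pathParity _ _ = c
          revert a b c
          decide
    funext i
    have hi : i = wire N i := Fin.ext (wire_val (Nat.lt_succ_iff.1 i.2)).symm
    simp only [hY]
    split_ifs with h1 h2 h3
    · rw [hi, h1]
    · rw [hi]; exact (hk _ h2).symm
    · rw [spin, ← hs _ (predIndex_lt (by omega)), spinWire, if_neg (by omega), Nat.succ_sub_one,
        succIndex_predIndex, show N / 2 + (i - N / 2) = (i : ℕ) by omega, ← hi]
    · refine (hA i fun t ht e => ?_).symm
      have := congrArg Fin.val e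
      rw [wire_val (treeWire_le _ _), treeWire] at this
      split_ifs at this <;> omega
  symm
  refine Finset.sum_of_injOn Y (fun a _ b _ h => ?_) (by simp) (fun y _ hy => ?_) fun c _ => ?_
  · rw [← hYN a, h, hYN]
  · by_cases hC : IsCat m N y
    · by_cases hA : AgreeOff N x y
      · exact absurd ⟨y (wire N N), by simp, (huniq y hC hA).symm⟩ hy
      · rw [if_neg hA, zero_mul, mul_zero]
    · rw [if_neg hC, zero_mul]
  · rw [if_pos (hYC c), if_pos (hYA c), one_mul, one_mul, hYN]
    congr 2
    · refine Finset.prod_congr rfl fun t ht => ?_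
      congr 1
      funext u
      refine Finset.prod_congr rfl fun i _ => ?_
      rw [hYj c _ ((block_index_lt (Finset.mem_range.1 ht) i.2).trans_le (Nat.mul_div_le _ _))]
    · refine Finset.prod_congr rfl fun j hj => ?_
      rw [hYj c j (Finset.mem_Ico.1 hj).2]

end Sampler

namespace Sampler

/-! ### Rotations of Hadamard states -/

/-- The sign that belongs to a bit. -/
def boolSign (s : Bool) : ℝ := if s then -1 else 1

lemma boolSign_xor (a b : Bool) : boolSign (xor a b) = boolSign a * boolSign b := by
  cases a <;> cases b <;> simp [boolSign]

lemma hadEntry_eq (a s : Bool) : hadEntry a s = boolSign (a && s) / (Real.sqrt 2 : ℂ) := by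
  cases a <;> cases s <;> simp [hadEntry, boolSign]

lemma norm_hadEntry (a s : Bool) : ‖hadEntry a s‖ = 1 / Real.sqrt 2 := by
  cases a <;> cases s <;> simp [hadEntry]

/-- A Hadamard state is an eigenvector of `X` with eigenvalue `boolSign s`, so the rotation is a
phase. -/
lemma sum_star_rotX_mul_hadEntry (φ : ℝ) (a s : Bool) :
    ∑ b, star (rotX φ b a) * hadEntry b s
      = hadEntry a s * Complex.exp ((φ * boolSign s : ℝ) * Complex.I) := by
  rw [Complex.exp_mul_I, ← Complex.ofReal_cos, ← Complex.ofReal_sin]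
  cases a <;> cases s <;> simp [rotX, hadEntry, boolSign, -Complex.ofReal_cos,
    -Complex.ofReal_sin] <;> ring

lemma rotHadEntry_eq (a s : Bool) :
    rotHadEntry a s
      = hadEntry a s * Complex.exp ((-(Real.pi / 4) * boolSign s : ℝ) * Complex.I) := by
  rw [← sum_star_rotX_mul_hadEntry, rotHadEntry]
  refine Finset.sum_congr rfl fun b _ => ?_
  cases a <;> cases b <;> simp [rotX, -Complex.ofReal_cos, -Complex.ofReal_sin]

/-- For complementary strings exactly one of the two controls is on, and the overlap is the
amplitude with which a rotation by `θ` flips a bit. The product over the block is the overlap of the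
two columns. -/
lemma norm_sum_star_rotX_mul_rotX (θ : ℝ) (a c : Bool) :
    ‖∑ b, star (rotX (if !c then θ else 0) b (!a)) * rotX (if c then θ else 0) b a‖
      = |Real.sin θ| := by
  cases a <;> cases c <;> simp [rotX, -Complex.ofReal_cos, -Complex.ofReal_sin]

lemma sum_prod_bool {n : ℕ} (f : Fin n → Bool → ℂ) :
    ∑ y : Fin n → Bool, ∏ i, f i (y i) = ∏ i, ∑ b, f i b := by
  rw [Finset.prod_univ_sum, Fintype.piFinset_univ]

section Block

variable {m : ℕ} (θ : ℝ) (x s : Fin (m + 1) → Bool)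

/-- The amplitude of a block, for the matrix `M` in place of its orthonormalization. -/
noncomputable def blockAmplitude : ℂ :=
  ∏ i, hadEntry (x i) (s i)
    * Complex.exp (((if x (i - 1) then θ else 0) * boolSign (s i) : ℝ) * Complex.I)

lemma sum_star_shiftRot_mul :
    ∑ y, star (shiftRot θ x y) * ∏ i, hadEntry (y i) (s i) = blockAmplitude θ x s := by
  simp only [shiftRot, star_prod, ← Finset.prod_mul_distrib]
  rw [sum_prod_bool fun i b => star (rotX (if x (i - 1) then θ else 0) b (x i)) * hadEntry b (s i)]
  exact Finset.prod_congr rfl fun i _ => sum_star_rotX_mul_hadEntry _ _ _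

lemma norm_blockAmplitude : ‖blockAmplitude θ x s‖ = (1 / Real.sqrt 2) ^ (m + 1) := by
  rw [blockAmplitude, norm_prod]
  simp only [norm_mul, norm_hadEntry, Complex.norm_exp_ofReal_mul_I, mul_one, Finset.prod_const,
    Finset.card_univ, Fintype.card_fin]

lemma norm_overlap :
    ‖∑ y, star (shiftRot θ (fun j => !(x j)) y) * shiftRot θ x y‖ = |Real.sin θ| ^ (m + 1) := by
  simp only [shiftRot, star_prod, ← Finset.prod_mul_distrib]
  rw [sum_prod_bool fun i b => star (rotX (if !(x (i - 1)) then θ else 0) b (!(x i)))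
    * rotX (if x (i - 1) then θ else 0) b (x i), norm_prod]
  simp only [norm_sum_star_rotX_mul_rotX, Finset.prod_const, Finset.card_univ, Fintype.card_fin]

/-- All block amplitudes have the same modulus, so the correction by the complementary column is
small also relative to the main term. It contributes `(1 + ρ) ρ` and the normalization contributes
`ρ`. -/
lemma exists_blockMatrix_mulVec (hθ : |Real.sin θ| ^ (m + 1) ≤ 1 / 2) :
    ∃ η : ℂ, ‖η‖ ≤ 3 * |Real.sin θ| ^ (m + 1) ∧
      (blockMatrix m θ).mulVec (fun u => ∏ i, hadEntry (u i) (s i)) x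
        = blockAmplitude θ x s * (1 + η) := by
  set ρ := |Real.sin θ| ^ (m + 1) with hρ
  have hρ0 : 0 ≤ ρ := by positivity
  simp only [Matrix.mulVec, dotProduct, blockMatrix, Matrix.of_apply, blockColumn]
  by_cases hx : x 0 = true
  swap
  · refine ⟨0, by simpa using hρ0, ?_⟩
    rw [if_neg hx, sum_star_shiftRot_mul, add_zero, mul_one]
  rw [if_pos hx]
  set r := ∑ y, star (shiftRot θ (fun j => !(x j)) y) * shiftRot θ x y with hr
  have hrn : ‖r‖ = ρ := norm_overlap θ x
  set A := blockAmplitude θ x s with hA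
  set A' := blockAmplitude θ (fun j => !(x j)) s with hA'
  have hAn : ‖A‖ = ‖A'‖ := by rw [hA, hA', norm_blockAmplitude, norm_blockAmplitude]
  have hA0 : A ≠ 0 := by
    rw [← norm_ne_zero_iff, hA, norm_blockAmplitude]
    positivity
  set c : ℝ := 1 / Real.sqrt (1 - ‖r‖ ^ 2) with hc
  have hc1 : |c - 1| ≤ ρ := by
    have h1 : (0 : ℝ) < 1 - ρ ^ 2 := by nlinarith
    have h2 : Real.sqrt (1 - ρ ^ 2) ≤ 1 := Real.sqrt_le_one.2 (by nlinarith)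
    have h3 := Real.sqrt_pos.2 h1
    -- Squared, this is `1 ≤ (1 + ρ)² (1 - ρ²)`, which holds for `ρ ≤ 1/2`.
    have h4 : 1 ≤ (1 + ρ) * Real.sqrt (1 - ρ ^ 2) := by
      refine (abs_le_of_sq_le_sq' ?_ (by positivity)).2
      rw [mul_pow, Real.sq_sqrt h1.le]
      nlinarith [mul_nonneg hρ0 hρ0, mul_nonneg hρ0 (mul_nonneg hρ0 hρ0),
        mul_nonneg (mul_nonneg hρ0 hρ0) (sub_nonneg.2 hθ)]
    rw [hc, hrn, abs_of_nonneg (by rw [sub_nonneg, le_div_iff₀ h3]; linarith),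
      sub_le_iff_le_add, div_le_iff₀ h3]
    linarith
  refine ⟨(c - 1 : ℝ) - c * star r * (A' / A), ?_, ?_⟩
  · have h5 : ‖A' / A‖ = 1 := by rw [norm_div, ← hAn, div_self (norm_ne_zero_iff.2 hA0)]
    have h6 : |c| ≤ 1 + ρ := by
      have := abs_add_le (c - 1) 1
      rw [sub_add_cancel, abs_one] at this
      linarith
    refine (norm_sub_le _ _).trans ?_
    rw [norm_mul, norm_mul, h5, Complex.norm_real, Complex.norm_real, norm_star, hrn, mul_one,
      Real.norm_eq_abs, Real.norm_eq_abs]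
    nlinarith [mul_le_mul_of_nonneg_right h6 hρ0]
  · have h7 : ∀ y, star (((c : ℂ) • (shiftRot θ x - r • shiftRot θ fun j => !(x j))) y)
          * ∏ i, hadEntry (y i) (s i)
        = c * (star (shiftRot θ x y) * ∏ i, hadEntry (y i) (s i))
          - c * star r * (star (shiftRot θ (fun j => !(x j)) y) * ∏ i, hadEntry (y i) (s i)) := by
      intro y
      simp only [Pi.smul_apply, Pi.sub_apply, smul_eq_mul, star_mul', star_sub]
      simp
      ring
    simp only [h7]
    rw [Finset.sum_sub_distrib, ← Finset.mul_sum, ← Finset.mul_sum, sum_star_shiftRot_mul,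
      sum_star_shiftRot_mul, ← hA, ← hA']
    push_cast
    field_simp
    ring

end Block

/-! ### Amplitudes and outcome probabilities -/

variable (m N : ℕ)

/-- Qubit `i` carries the spin of the vertex whose bit is measured on its cyclic predecessor, the
control of its rotation. Reindexing by `i ↦ i - 1` pairs each vertex bit with the path parity of its
own vertex. -/
lemma blockAmplitude_spin {t : ℕ} (ht : t < N / 2 / (m + 1)) (θ : ℝ) (x : Fin (N + 1) → Bool)
    (c : Bool) :
    blockAmplitude θ (fun i : Fin (m + 1) => x (wire N (N / 2 + ((m + 1) * t + i))))
        (fun i => spin m N x c ((m + 1) * t + i))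
      = ∏ i : Fin (m + 1), hadEntry (x (wire N (N / 2 + ((m + 1) * t + i))))
          (spin m N x c ((m + 1) * t + i))
        * Complex.exp (((if x (wire N (N / 2 + ((m + 1) * t + i))) then θ else 0) * (boolSign c
          * boolSign (pathParity (fun k => x (wire N k)) ((m + 1) * t + i + 1))) : ℝ)
          * Complex.I) := by
  rw [blockAmplitude, Finset.prod_mul_distrib, Finset.prod_mul_distrib]
  congr 1
  refine Fintype.prod_equiv (Equiv.subRight 1) _ _ fun i => ?_
  rw [Equiv.subRight_apply, ← boolSign_xor, spin, predIndex_block ht i.2]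
  have h : ((i - 1 : Fin (m + 1)) : ℕ) = (i + m) % (m + 1) := by
    rcases m with _ | m
    · have := (i - 1).2
      omega
    · rw [Fin.val_sub, Fin.val_one', Nat.mod_eq_of_lt (by omega : 1 < m + 1 + 1), add_comm]
      rfl
  rw [h]

/-- The part of the signed sum that belongs to the full blocks. -/
def blockSum {N : ℕ} (z : Fin N → Bool) : ℤ :=
  ∑ k ∈ Finset.range ((m + 1) * (N / 2 / (m + 1))), signedBit z k

lemma norm_sq_add_sub_norm_sq_le {a e : ℂ} {ε : ℝ} (ha : ‖a‖ ≤ 2) (he : ‖e‖ ≤ 2 * ε) :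
    |‖a + e‖ ^ 2 - ‖a‖ ^ 2| ≤ 8 * ε + 4 * ε ^ 2 := by
  have h1 := abs_norm_sub_norm_le (a + e) a
  rw [add_sub_cancel_left] at h1
  have h2 : ‖a + e‖ ≤ 2 + 2 * ε := (norm_add_le a e).trans (by linarith)
  have h3 : ‖a + e‖ ^ 2 - ‖a‖ ^ 2 = (‖a + e‖ - ‖a‖) * (‖a + e‖ + ‖a‖) := by ring
  have h0 := norm_nonneg e
  rw [h3, abs_mul, abs_of_nonneg (show 0 ≤ ‖a + e‖ + ‖a‖ by positivity)]
  have := mul_le_mul (h1.trans he) (add_le_add h2 ha) (by positivity) (by linarith)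
  linarith

lemma norm_exp_add_exp_sq (w κ : ℝ) (hκ : κ = 1 ∨ κ = -1) :
    ‖Complex.exp ((w : ℝ) * Complex.I) + κ * Complex.exp ((-w : ℝ) * Complex.I)‖ ^ 2
      = 2 * (1 + κ * Real.cos (2 * w)) := by
  rw [Complex.exp_mul_I, Complex.exp_mul_I, ← Complex.ofReal_cos, ← Complex.ofReal_sin,
    ← Complex.ofReal_cos, ← Complex.ofReal_sin, Real.cos_neg, Real.sin_neg, ← Complex.normSq_eq_norm_sq,
    Complex.normSq_apply]
  have := Real.sin_sq_add_cos_sq w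
  rcases hκ with rfl | rfl
  · simp [-Complex.ofReal_cos, -Complex.ofReal_sin]
    rw [Real.cos_two_mul]
    ring
  · simp [-Complex.ofReal_cos, -Complex.ofReal_sin]
    rw [Real.cos_two_mul]
    nlinarith

section Amplitude

variable {N}

lemma apply_wire (x : Fin (N + 1) → Bool) {k : ℕ} (hk : k < N) : x (wire N k) = bitAt (fun i : Fin N => x i.castSucc) k := by
  rw [bitAt, dif_pos hk]
  exact congrArg x (Fin.ext (wire_val hk.le))

lemma pathParity_congr {d d' : ℕ → Bool} {i : ℕ} (h : ∀ k < i, d k = d' k) :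
    pathParity d i = pathParity d' i := by
  induction i using Nat.strong_induction_on with
  | _ i ih =>
    rcases i with _ | k
    · simp [pathParity]
    · rw [pathParity_succ, pathParity_succ, h k (by omega),
        ih (k / 2) (by omega) fun j hj => h j (by omega)]

lemma pathParity_apply_wire (x : Fin (N + 1) → Bool) {i : ℕ} (hi : i ≤ N / 2) :
    pathParity (fun k => x (wire N k)) i
      = pathParity (edgeBit fun i : Fin N => x i.castSucc) i :=
  pathParity_congr fun _ _ => apply_wire x (by omega)

lemma prod_boolSign_vertexBit (z : Fin N → Bool) :
    ∏ j ∈ Finset.range (N / 2), boolSign (vertexBit z j) = boolSign (vertexParity z) := by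
  simp only [boolSign]
  rw [Finset.prod_ite, Finset.prod_const, Finset.prod_const_one, mul_one, vertexParity]
  rcases Nat.even_or_odd ((Finset.range (N / 2)).filter fun k => vertexBit z k = true).card
    with h | h
  · rw [h.neg_one_pow, if_neg (by simpa using h)]
  · rw [h.neg_one_pow, if_pos (by simpa using h)]

variable (x : Fin (N + 1) → Bool)

/-- The sign of the two terms of an amplitude. -/
noncomputable def termSign (c : Bool) : ℝ :=
  boolSign (x (wire N N) && c)
    * ∏ j ∈ Finset.range (N / 2), boolSign (x (wire N (N / 2 + j)) && spin m N x c j)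

lemma abs_termSign (c : Bool) : |termSign m x c| = 1 := by
  have h : ∀ b, |boolSign b| = 1 := fun b => by cases b <;> simp [boolSign]
  rw [termSign, abs_mul, Finset.abs_prod, h, one_mul]
  exact Finset.prod_eq_one fun j _ => h _

/-- The two branches have opposite spins everywhere, so their relative sign changes once for each
bit `1` among the vertex bits and the last bit. -/
lemma termSign_true :
    termSign m x true = boolSign (xor (x (Fin.last N))
      (vertexParity fun i : Fin N => x i.castSucc)) * termSign m x false := by
  have hlast : wire N N = Fin.last N := Fin.ext (wire_val le_rfl)
  rw [boolSign_xor, ← prod_boolSign_vertexBit, termSign, termSign, hlast, Bool.and_true,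
    Bool.and_false, show boolSign false = 1 from rfl, one_mul, mul_assoc, ← Finset.prod_mul_distrib]
  congr 1
  refine Finset.prod_congr rfl fun j hj => ?_
  rw [Finset.mem_range] at hj
  rw [vertexBit, ← apply_wire x (by omega), spin, spin]
  generalize x (wire N (N / 2 + j)) = a
  generalize pathParity _ _ = b
  cases a <;> cases b <;> simp [boolSign]

variable {m} in
-- The phases of the blocks multiply to the signed sum, with a sign given by `c`; the relative
-- errors of the blocks multiply to `∏ (1 + η t)`.
lemma exists_amplitude {q : ℕ} (hq : |Real.sin (Real.pi / q)| ^ (m + 1) ≤ 1 / 2) (c : Bool) :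
    ∃ η : ℂ, ‖η‖ ≤ Real.exp (N * (3 * |Real.sin (Real.pi / q)| ^ (m + 1))) - 1 ∧
      rotHadEntry (x (wire N N)) c
        * ((∏ t ∈ Finset.range (N / 2 / (m + 1)), (blockMatrix m (Real.pi / q)).mulVec
            (fun u => ∏ i, hadEntry (u i) (spin m N x c ((m + 1) * t + i)))
            fun i => x (wire N (N / 2 + ((m + 1) * t + i))))
          * ∏ j ∈ Finset.Ico ((m + 1) * (N / 2 / (m + 1))) (N / 2),
              hadEntry (x (wire N (N / 2 + j))) (spin m N x c j))
      = (1 / (Real.sqrt 2 : ℂ)) ^ (N / 2 + 1) * termSign m x c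
        * Complex.exp ((boolSign c * (Real.pi / q * blockSum m (fun i : Fin N => x i.castSucc)
            - Real.pi / 4) : ℝ) * Complex.I) * (1 + η) := by
  set θ := Real.pi / q with hθ
  choose η hη hηe using fun t => exists_blockMatrix_mulVec θ
    (fun i : Fin (m + 1) => x (wire N (N / 2 + ((m + 1) * t + i))))
    (fun i => spin m N x c ((m + 1) * t + i)) hq
  set K := N / 2 / (m + 1) with hK
  have hKN : (m + 1) * K ≤ N / 2 := Nat.mul_div_le _ _
  refine ⟨∏ t ∈ Finset.range K, (1 + η t) - 1, ?_, ?_⟩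
  · refine (Finset.norm_prod_one_add_sub_one_le _ _).trans (sub_le_sub_right
      (Real.exp_le_exp.2 ((Finset.sum_le_sum fun t _ => hη t).trans ?_)) _)
    rw [Finset.sum_const, Finset.card_range, nsmul_eq_mul]
    refine mul_le_mul_of_nonneg_right ?_ (by positivity)
    exact_mod_cast (Nat.div_le_self _ _).trans (Nat.div_le_self _ _)
  · set P : ℂ := Complex.exp ((boolSign c * (θ * blockSum m (fun i : Fin N => x i.castSucc))
      : ℝ) * Complex.I) with hP
    have h1 : ∏ t ∈ Finset.range K, ∏ i : Fin (m + 1),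
        Complex.exp (((if x (wire N (N / 2 + ((m + 1) * t + i))) then θ else 0) * (boolSign c
          * boolSign (pathParity (fun k => x (wire N k)) ((m + 1) * t + i + 1))) : ℝ)
          * Complex.I) = P := by
      rw [← prod_range_mul m K fun k =>
        Complex.exp (((if x (wire N (N / 2 + k)) then θ else 0) * (boolSign c
          * boolSign (pathParity (fun k => x (wire N k)) (k + 1))) : ℝ) * Complex.I),
        ← Complex.exp_sum, ← Finset.sum_mul, ← Complex.ofReal_sum, hP, blockSum, Int.cast_sum,
        Finset.mul_sum, Finset.mul_sum]
      congr 3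
      refine Finset.sum_congr rfl fun k hk => ?_
      have hk := (Finset.mem_range.1 hk).trans_le hKN
      rw [apply_wire x (by omega), pathParity_apply_wire x (by omega), signedBit, vertexBit]
      split_ifs with ha hb
      · simp [boolSign, hb]
      · simp [boolSign, hb]
      · simp
    have h2 : ∏ t ∈ Finset.range K, ((blockMatrix m θ).mulVec
            (fun u => ∏ i, hadEntry (u i) (spin m N x c ((m + 1) * t + i)))
            fun i => x (wire N (N / 2 + ((m + 1) * t + i))))
        = (∏ t ∈ Finset.range K, ∏ i : Fin (m + 1),
            hadEntry (x (wire N (N / 2 + ((m + 1) * t + i)))) (spin m N x c ((m + 1) * t + i)))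
          * P * ∏ t ∈ Finset.range K, (1 + η t) := by
      rw [← h1, ← Finset.prod_mul_distrib, ← Finset.prod_mul_distrib]
      refine Finset.prod_congr rfl fun t ht => ?_
      rw [hηe, blockAmplitude_spin m N (Finset.mem_range.1 ht), Finset.prod_mul_distrib]
    have h3 := prod_range_blocks m (N / 2) fun j =>
      hadEntry (x (wire N (N / 2 + j))) (spin m N x c j)
    have h4 : ∏ j ∈ Finset.range (N / 2), hadEntry (x (wire N (N / 2 + j))) (spin m N x c j)
        = (1 / (Real.sqrt 2 : ℂ)) ^ (N / 2)
          * ∏ j ∈ Finset.range (N / 2), (boolSign (x (wire N (N / 2 + j)) && spin m N x c j) : ℂ) := by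
      simp only [hadEntry_eq, div_eq_mul_inv, Finset.prod_mul_distrib, Finset.prod_const,
        Finset.card_range, one_mul]
      ring
    have h5 : Complex.exp ((boolSign c * (θ * blockSum m (fun i : Fin N => x i.castSucc)
        - Real.pi / 4) : ℝ) * Complex.I)
        = Complex.exp ((-(Real.pi / 4) * boolSign c : ℝ) * Complex.I) * P := by
      rw [hP, ← Complex.exp_add]
      congr 1
      push_cast
      ring
    rw [h2, h5, rotHadEntry_eq, hadEntry_eq, termSign]
    calc _ = (boolSign (x (wire N N) && c) / (Real.sqrt 2 : ℂ))
          * Complex.exp ((-(Real.pi / 4) * boolSign c : ℝ) * Complex.I)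
          * P * (∏ t ∈ Finset.range K, (1 + η t))
          * ∏ j ∈ Finset.range (N / 2), hadEntry (x (wire N (N / 2 + j))) (spin m N x c j) := by
          rw [h3]; ring
      _ = _ := by
          rw [h4, Complex.ofReal_mul _ (∏ j ∈ _, _), Complex.ofReal_prod]
          ring

variable {m} in
/-- The outcome distribution, up to the error from the orthonormalization. -/
lemma abs_outDist_sub_le {q : ℕ} (hq : |Real.sin (Real.pi / q)| ^ (m + 1) ≤ 1 / 2) {ε : ℝ}
    (hε : Real.exp (N * (3 * |Real.sin (Real.pi / q)| ^ (m + 1))) - 1 ≤ ε) :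
    |(circuit m q N).outDist x - (1 + boolSign (xor (x (Fin.last N))
        (vertexParity fun i : Fin N => x i.castSucc))
          * Real.sin (2 * Real.pi * blockSum m (fun i : Fin N => x i.castSucc) / q)) / 2 ^ (N + 1)|
      ≤ (8 * ε + 4 * ε ^ 2) / 2 ^ (N + 2) := by
  obtain ⟨η₀, hη₀, h₀⟩ := exists_amplitude x hq false
  obtain ⟨η₁, hη₁, h₁⟩ := exists_amplitude x hq true
  set κ := boolSign (xor (x (Fin.last N)) (vertexParity fun i : Fin N => x i.castSucc)) with hκ
  set S := blockSum m (fun i : Fin N => x i.castSucc) with hS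
  -- The shift by `π / 4` turns the interference term `cos(2w)` into `sin(2πS/q)`.
  set w : ℝ := Real.pi / q * S - Real.pi / 4 with hw
  have hκ' : κ = 1 ∨ κ = -1 := by
    rw [hκ, boolSign]
    split_ifs
    · exact .inr rfl
    · exact .inl rfl
  have hκn : ‖(κ : ℂ)‖ = 1 := by rcases hκ' with h | h <;> simp [h]
  set a : ℂ := Complex.exp ((w : ℝ) * Complex.I) + κ * Complex.exp ((-w : ℝ) * Complex.I) with ha
  set e : ℂ := Complex.exp ((w : ℝ) * Complex.I) * η₀ + κ * Complex.exp ((-w : ℝ) * Complex.I) * η₁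
    with he
  have hfin : (circuit m q N).finalState x
      = (1 / (Real.sqrt 2 : ℂ)) ^ (N + 2) * termSign m x false * (a + e) := by
    rw [finalState_circuit, Fintype.sum_bool, h₀, h₁, termSign_true, ← hκ]
    -- The exponent counts the factors `1/√2`: `N + 1 - N/2` from the first layer and `N/2 + 1` from
    -- the second Hadamard layer.
    rw [show N + 2 = (N + 1 - N / 2) + (N / 2 + 1) by omega, pow_add, ha, he]
    rw [show boolSign true = -1 from rfl, show boolSign false = 1 from rfl, one_mul, neg_one_mul]
    push_cast
    ring
  have hout : (circuit m q N).outDist x = ‖a + e‖ ^ 2 / 2 ^ (N + 2) := by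
    rw [QCircuit.outDist, hfin, norm_mul, norm_mul, Complex.norm_real, Real.norm_eq_abs,
      abs_termSign, mul_one, mul_pow, norm_pow, ← pow_mul, mul_comm (N + 2) 2, pow_mul, norm_div,
      norm_one, Complex.norm_real, Real.norm_of_nonneg (Real.sqrt_nonneg _), div_pow,
      Real.sq_sqrt zero_le_two, one_pow, div_pow, one_pow]
    ring
  have hnorm : ‖a‖ ^ 2 = 2 * (1 + κ * Real.sin (2 * Real.pi * S / q)) := by
    rw [ha, norm_exp_add_exp_sq w κ hκ', hw, ← Real.cos_sub_pi_div_two]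
    congr 4
    ring
  have ha2 : ‖a‖ ≤ 2 := by
    refine (norm_add_le _ _).trans ?_
    rw [norm_mul, hκn, Complex.norm_exp_ofReal_mul_I, Complex.norm_exp_ofReal_mul_I]
    norm_num
  have he2 : ‖e‖ ≤ 2 * ε := by
    refine (norm_add_le _ _).trans ?_
    rw [norm_mul, norm_mul, norm_mul, hκn, Complex.norm_exp_ofReal_mul_I,
      Complex.norm_exp_ofReal_mul_I]
    linarith
  have := norm_sq_add_sub_norm_sq_le ha2 he2
  rw [hout, show (1 + κ * Real.sin (2 * Real.pi * S / q)) / 2 ^ (N + 1) = ‖a‖ ^ 2 / 2 ^ (N + 2) by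
    rw [hnorm, pow_succ _ (N + 1)]; field_simp, ← sub_div, abs_div,
    abs_of_pos (show (0 : ℝ) < 2 ^ (N + 2) by positivity)]
  gcongr

end Amplitude

end Sampler

namespace Sampler

/-! ### The distance from the target distribution -/

/-- The vertex bits as coordinates of a bit string. -/
def vertexEquiv (N : ℕ) : Fin (N / 2) ≃ {i : Fin N // N / 2 ≤ i ∧ (i : ℕ) < N / 2 + N / 2} where
  toFun k := ⟨⟨N / 2 + k, by omega⟩, Nat.le_add_right _ _, Nat.add_lt_add_left k.2 _⟩
  invFun i := ⟨i.1 - N / 2, by have := i.2; omega⟩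
  left_inv k := Fin.ext (Nat.add_sub_cancel_left _ _)
  right_inv i := Subtype.ext (Fin.ext (Nat.add_sub_cancel' i.2.1))

/-- Condition on all bits except the vertex bits. The signs are then fixed, and the sum factors into
`N / 2` cosines of the angles `±πk/p`. -/
lemma norm_sum_stdAddChar_signedSum_le {p : ℕ} [NeZero p] (N : ℕ) {k : ZMod p} (hk : k ≠ 0) :
    ‖∑ z : Fin N → Bool, ZMod.stdAddChar (k * (signedSum z : ZMod p))‖
      ≤ 2 ^ N * Real.exp (-2 / (p : ℝ) ^ 2) ^ (N / 2) := by
  classical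
  set P : Fin N → Prop := fun i => N / 2 ≤ i ∧ (i : ℕ) < N / 2 + N / 2 with hP
  set E := Equiv.piEquivPiSubtypeProd P (fun _ => Bool) with hE
  have hp : 0 < p := Nat.pos_of_ne_zero (NeZero.ne p)
  have hcard : Fintype.card {i // P i} = N / 2 := by
    rw [← Fintype.card_congr (vertexEquiv N), Fintype.card_fin]
  have htotal : (2 : ℝ) ^ N = Fintype.card ({i // ¬ P i} → Bool) * 2 ^ Fintype.card {i // P i} := by
    have := Fintype.card_congr E
    simp only [Fintype.card_prod, Fintype.card_fun, Fintype.card_fin, Fintype.card_bool] at this ⊢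
    rw [mul_comm]
    exact_mod_cast this
  rw [← E.symm.sum_comp, Fintype.sum_prod_type_right, htotal, mul_assoc]
  refine (norm_sum_le_of_le (f := fun b => _) Finset.univ fun b _ => ?_).trans_eq
    (by rw [Finset.sum_const, nsmul_eq_mul, Finset.card_univ])
  set ε : ℕ → ℤ := fun j =>
    if pathParity (edgeBit (E.symm (fun _ => false, b))) (j + 1) then -1 else 1 with hε
  set W : {i // P i} → Bool → ℤ := fun i v => if v then ε ((vertexEquiv N).symm i) else 0 with hW
  have hsum : ∀ a, signedSum (E.symm (a, b)) = 0 + ∑ i, W i (a i) := by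
    intro a
    rw [zero_add, signedSum, Finset.sum_range, ← (vertexEquiv N).sum_comp]
    refine Finset.sum_congr rfl fun j _ => ?_
    have hv : vertexBit (E.symm (a, b)) j = a (vertexEquiv N j) := by
      rw [vertexBit, bitAt, dif_pos (by omega)]
      exact dif_pos (vertexEquiv N j).2
    have hd : pathParity (edgeBit (E.symm (a, b))) (j + 1)
        = pathParity (edgeBit (E.symm (fun _ => false, b))) (j + 1) := by
      refine pathParity_congr fun l hl => ?_
      have hl' : ¬ P ⟨l, by omega⟩ := fun h => by have := h.1; dsimp only at this; omega
      have key : ∀ a, E.symm (a, b) ⟨l, by omega⟩ = b ⟨_, hl'⟩ := fun a => dif_neg hl'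
      rw [edgeBit, edgeBit, bitAt, bitAt, dif_pos (by omega), dif_pos (by omega), key, key]
    simp only [hW, Equiv.symm_apply_apply, hε, hv, hd]
  have h1 : ∀ a, (ZMod.stdAddChar (k * (signedSum (E.symm (a, b)) : ZMod p)) : ℂ)
      = Complex.exp ((((0 + ∑ i, W i (a i) : ℤ) : ℝ) * (2 * Real.pi * k.val / p) : ℝ)
        * Complex.I) := by
    intro a
    rw [stdAddChar_mul_intCast, hsum]
    congr 3
    push_cast
    ring
  simp only [h1]
  refine (norm_sum_exp_le (2 * Real.pi * k.val / p) 0 W Finset.univ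
    (e := Real.exp (-2 / (p : ℝ) ^ 2)) fun i _ => ?_).trans_eq
    (by rw [Finset.card_univ, hcard])
  have hε' : ∀ j, ε j = 1 ∨ ε j = -1 := fun j => by
    simp only [hε]
    split_ifs
    · exact .inr rfl
    · exact .inl rfl
  have hk' : ¬ (p : ℤ) ∣ (W i true - W i false) * k.val := by
    have h2 : ¬ (p : ℤ) ∣ k.val := by
      rw [Int.natCast_dvd_natCast]
      exact fun h => hk ((ZMod.val_eq_zero k).1 (Nat.eq_zero_of_dvd_of_lt h k.val_lt))
    simp only [hW, if_true, Bool.false_eq_true, if_false, sub_zero]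
    rcases hε' ((vertexEquiv N).symm i) with h | h <;> rw [h] <;> simpa using h2
  convert abs_cos_le_exp hk' hp using 3
  push_cast
  ring

lemma sum_abs_sin_signedSum_ge {p : ℕ} (hp : 2 ≤ p) (hodd : Odd p) (N : ℕ) :
    2 ^ N * (2 / Real.pi - 1 / p - p * Real.exp (-2 / (p : ℝ) ^ 2) ^ (N / 2))
      ≤ ∑ z : Fin N → Bool, |Real.sin (2 * Real.pi * signedSum z / p)| := by
  have : NeZero p := ⟨by omega⟩
  have : Fact (1 < p) := ⟨hp⟩
  have h := abs_sum_sub_average_le (p := p) (fun z : Fin N → Bool => (signedSum z : ZMod p))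
    (fun _ => 1) (fun j => |Real.sin (2 * Real.pi * (j.val : ℤ) / p)|)
    (fun j => by rw [abs_abs]; exact Real.abs_sin_le_one _)
    (B := 2 ^ N * Real.exp (-2 / (p : ℝ) ^ 2) ^ (N / 2)) (fun k hk => by
      simpa only [Complex.ofReal_one, one_mul] using norm_sum_stdAddChar_signedSum_le N hk)
  have h1 : ∀ z : Fin N → Bool, |Real.sin (2 * Real.pi * (((signedSum z : ZMod p).val : ℤ) : ℝ) / p)|
      = |Real.sin (2 * Real.pi * signedSum z / p)| := fun z => by
    rw [ZMod.val_intCast, ← sin_congr_of_emod (by omega)]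
  simp only [h1, one_mul, Finset.sum_const, Finset.card_univ, Fintype.card_pi_const,
    Fintype.card_bool, nsmul_eq_mul, mul_one] at h
  have h2 := (abs_le.1 h).1
  have h3 := mul_le_mul_of_nonneg_left (average_abs_sin_ge hp hodd)
    (show (0 : ℝ) ≤ 2 ^ N by positivity)
  rw [Nat.cast_pow, Nat.cast_ofNat] at h2
  linarith

lemma abs_signedSum_sub_blockSum_le (m : ℕ) {N : ℕ} (z : Fin N → Bool) :
    |signedSum z - blockSum m z| ≤ m := by
  rw [signedSum_eq, blockSum, Finset.range_eq_Ico, Finset.range_eq_Ico,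
    ← Finset.sum_Ico_consecutive _ (Nat.zero_le _) (Nat.mul_div_le (N / 2) (m + 1)),
    add_sub_cancel_left]
  refine (Finset.abs_sum_le_sum_abs _ _).trans ((Finset.sum_le_sum fun k _ =>
    abs_le.2 ⟨neg_one_le_signedBit k, signedBit_le_one k⟩).trans ?_)
  rw [Finset.sum_const, Nat.card_Ico, nsmul_eq_mul, mul_one]
  have h1 := Nat.mod_add_div (N / 2) (m + 1)
  have h2 := Nat.mod_lt (N / 2) (show 0 < m + 1 by omega)
  generalize (m + 1) * (N / 2 / (m + 1)) = a at h1 ⊢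
  omega

lemma sum_castSucc {N : ℕ} (g : (Fin N → Bool) → ℝ) :
    ∑ x : Fin (N + 1) → Bool, g (fun i => x i.castSucc) = 2 * ∑ z, g z := by
  rw [← (Fin.snocEquiv fun _ : Fin (N + 1) => Bool).sum_comp, Fintype.sum_prod_type]
  simp [Fin.snocEquiv, Fin.snoc_castSucc, two_mul]

/-- Given the first `N` bits, the target puts all mass on one value of the last bit. Both values
deviate by the mass that the ideal distribution gives to the wrong one. -/
lemma abs_ideal_sub_targetDist {p N : ℕ} {s : ℝ} (hs : |s| ≤ 1) (x : Fin (N + 1) → Bool) :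
    |(1 + boolSign (xor (x (Fin.last N)) (vertexParity fun i : Fin N => x i.castSucc)) * s)
        / 2 ^ (N + 1) - targetDist p N x|
      = (1 - boolSign (majMod p (signedSum fun i : Fin N => x i.castSucc)) * s) / 2 ^ (N + 1) := by
  rw [targetDist, pmmajmod]
  have h2 : (2 : ℝ) ^ (N + 1) = 2 ^ N * 2 := pow_succ _ _
  have h3 : (0 : ℝ) < 2 ^ N := by positivity
  have hs' := abs_le.1 hs
  have e1 : (1 + s) / 2 ^ (N + 1) - 1 / 2 ^ N = -((1 - s) / 2 ^ (N + 1)) := by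
    rw [h2]; field_simp; ring
  have e2 : (1 - s) / 2 ^ (N + 1) - 1 / 2 ^ N = -((1 + s) / 2 ^ (N + 1)) := by
    rw [h2]; field_simp; ring
  have e3 : 0 ≤ (1 - s) / 2 ^ (N + 1) := div_nonneg (by linarith) (by positivity)
  have e4 : 0 ≤ (1 + s) / 2 ^ (N + 1) := div_nonneg (by linarith) (by positivity)
  generalize x (Fin.last N) = a
  generalize vertexParity _ = b
  generalize majMod p _ = c
  cases a <;> cases b <;> cases c <;>
    simp only [boolSign, Bool.xor_false, Bool.xor_true, Bool.not_true, Bool.not_false, if_true,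
      Bool.false_eq_true, Bool.true_eq_false, if_false, one_mul, neg_mul, sub_zero, sub_neg_eq_add,
      ← sub_eq_add_neg, e1, e2, abs_neg, abs_of_nonneg e3, abs_of_nonneg e4]

lemma tvDist_circuit_le {m p N : ℕ} (hp : 2 ≤ p) (hodd : Odd p)
    (hq : |Real.sin (Real.pi / p)| ^ (m + 1) ≤ 1 / 2) {ε : ℝ}
    (hε : Real.exp (N * (3 * |Real.sin (Real.pi / p)| ^ (m + 1))) - 1 ≤ ε) :
    tvDist (circuit m p N).outDist (targetDist p N)
      ≤ 1 / 2 - 1 / Real.pi + (2 * ε + ε ^ 2) + (1 / 2 + Real.pi * m) / p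
        + p * Real.exp (-2 / (p : ℝ) ^ 2) ^ (N / 2) / 2 := by
  have hp0 : (0 : ℝ) < p := by exact_mod_cast (by omega : 0 < p)
  set s : (Fin N → Bool) → ℝ := fun z => Real.sin (2 * Real.pi * blockSum m z / p) with hs
  set μ : (Fin N → Bool) → ℝ := fun z => boolSign (majMod p (signedSum z)) with hμ
  have h1 : ∀ x : Fin (N + 1) → Bool,
      |(circuit m p N).outDist x - targetDist p N x|
        ≤ (8 * ε + 4 * ε ^ 2) / 2 ^ (N + 2)
          + (fun z => (1 - μ z * s z) / 2 ^ (N + 1)) (fun i : Fin N => x i.castSucc) := fun x => by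
    refine (abs_sub_le _ _ _).trans (add_le_add (abs_outDist_sub_le x hq hε) ?_)
    exact (abs_ideal_sub_targetDist (Real.abs_sin_le_one _) x).le
  -- The leftover vertices, at most `m`, are missing from the block sum; the sine is 1-Lipschitz, so
  -- this shifts it by at most `2πm/p`.
  have h2 : ∀ z, |Real.sin (2 * Real.pi * signedSum z / p)| - 2 * Real.pi * m / p ≤ μ z * s z := by
    intro z
    have h3 := majMod_sign_mul_sin (p := p) (by omega) (signedSum z)
    have h4 : |Real.sin (2 * Real.pi * signedSum z / p) - s z| ≤ 2 * Real.pi * m / p := by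
      refine (Real.abs_sin_sub_sin_le _ _).trans ?_
      rw [← sub_div, ← mul_sub, abs_div, abs_mul, abs_of_pos hp0,
        abs_of_pos Real.two_pi_pos]
      gcongr
      exact_mod_cast abs_signedSum_sub_blockSum_le m z
    have h5 : |μ z| = 1 := by
      simp only [hμ, boolSign]
      split_ifs <;> simp
    have h6 : |μ z * (Real.sin (2 * Real.pi * signedSum z / p) - s z)| ≤ 2 * Real.pi * m / p := by
      rwa [abs_mul, h5, one_mul]
    have h7 := (abs_le.1 h6).2
    rw [mul_sub, show μ z * Real.sin (2 * Real.pi * signedSum z / p) = _ from h3] at h7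
    linarith
  have h8 := Finset.sum_le_sum fun z (_ : z ∈ (Finset.univ : Finset (Fin N → Bool))) => h2 z
  have h9 := sum_abs_sin_signedSum_ge hp hodd N
  rw [Finset.sum_sub_distrib, Finset.sum_const, Finset.card_univ, Fintype.card_pi_const,
    Fintype.card_bool, nsmul_eq_mul] at h8
  have h10 : ∑ x, |(circuit m p N).outDist x - targetDist p N x|
      ≤ (4 * ε + 2 * ε ^ 2) + (1 - (∑ z, μ z * s z) / 2 ^ N) := by
    refine (Finset.sum_le_sum fun x _ => h1 x).trans_eq ?_
    rw [Finset.sum_add_distrib, sum_castSucc fun z => (1 - μ z * s z) / 2 ^ (N + 1), Finset.sum_const, Finset.card_univ,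
      Fintype.card_pi_const, Fintype.card_bool, nsmul_eq_mul, ← Finset.sum_div,
      Finset.sum_sub_distrib, Finset.sum_const, Finset.card_univ,
      Fintype.card_pi_const, Fintype.card_bool, nsmul_eq_mul]
    push_cast
    field_simp
    ring
  have h11 : 2 / Real.pi - 1 / p - p * Real.exp (-2 / (p : ℝ) ^ 2) ^ (N / 2)
      - 2 * Real.pi * m / p ≤ (∑ z, μ z * s z) / 2 ^ N := by
    rw [le_div_iff₀ (by positivity)]
    push_cast at h8
    linarith
  rw [tvDist]
  have e1 : (1 / 2 + Real.pi * m) / p = (1 / p + 2 * Real.pi * m / p) / 2 := by ring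
  have e2 : 1 / Real.pi = (2 / Real.pi) / 2 := by ring
  rw [e1, e2]
  linarith

end Sampler

namespace Sampler

/-! ### The choice of the primes -/

/-- Bertrand's postulate; `q > A ≥ 2` makes the prime odd. -/
lemma exists_prime_le {r n A : ℕ} (hA : 2 ≤ A) (h : n ^ (r - 1) ≤ A ^ (3 * r)) :
    ∃ q ≤ 2 * A, q.Prime ∧ 3 ≤ q ∧ n ^ (r - 1) ≤ q ^ (3 * r) := by
  obtain ⟨q, hq, hAq, hqA⟩ := Nat.exists_prime_lt_and_le_two_mul A (by omega)
  exact ⟨q, hqA, hq, by omega, h.trans (Nat.pow_le_pow_left hAq.le _)⟩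

lemma pow_le_add_two_pow (r n : ℕ) : n ^ (r - 1) ≤ (n + 2) ^ (3 * r) :=
  (Nat.pow_le_pow_left (Nat.le_add_right n 2) _).trans
    (Nat.pow_le_pow_right (by omega) (by omega))

lemma exists_prime (r n : ℕ) : ∃ q : ℕ, q.Prime ∧ 3 ≤ q ∧ n ^ (r - 1) ≤ q ^ (3 * r) :=
  (exists_prime_le (by omega) (pow_le_add_two_pow r n)).imp fun _ h => h.2

/-- The least odd prime that is at least `n ^ ((r - 1) / (3 r))`. -/
noncomputable def leastPrime (r n : ℕ) : ℕ := by
  classical exact Nat.find (exists_prime r n)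

lemma leastPrime_spec (r n : ℕ) : (leastPrime r n).Prime ∧ 3 ≤ leastPrime r n ∧
    n ^ (r - 1) ≤ leastPrime r n ^ (3 * r) := by
  classical exact Nat.find_spec (exists_prime r n)

lemma leastPrime_le {r n A : ℕ} (hA : 2 ≤ A) (h : n ^ (r - 1) ≤ A ^ (3 * r)) :
    leastPrime r n ≤ 2 * A := by
  classical
  obtain ⟨q, hq, h⟩ := exists_prime_le hA h
  exact (Nat.find_min' (exists_prime r n) h).trans hq

lemma odd_leastPrime (r n : ℕ) : Odd (leastPrime r n) :=
  (leastPrime_spec r n).1.odd_of_ne_two (by have := (leastPrime_spec r n).2.1; omega)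

open Ram in
-- For fixed `r` both powers are polynomial, and `2(n + 2)` bounds the search.
lemma computes_leastPrime (r : ℕ) :
    Computes (fun (_ : Unit) (n : ℕ) => n) (leastPrime r) := by
  have hn : Computes (fun (_ : Unit) (n : ℕ) => n) fun n => n := Computes.var ()
  refine Computes.find
    (P := fun n q => q.Prime ∧ 3 ≤ q ∧ n ^ (r - 1) ≤ q ^ (3 * r))
    ((Computes.const 2).mul (hn.add (Computes.const 2)))
    ((Decides.prime Computes.new).and (((Computes.const 3).le Computes.new).and
      ((hn.weaken.pow (r - 1)).le (Computes.new.pow (3 * r)))))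
    (leastPrime_spec r) (fun n => leastPrime_le (by omega) (pow_le_add_two_pow r n))
    fun n i hi h => ?_
  classical exact Nat.find_min (exists_prime r n) hi h

lemma rpow_pow_eq {r : ℕ} (hr : 1 ≤ r) {α : ℝ} (hα : α * (3 * r) = r - 1) (n : ℕ) :
    ((n : ℝ) ^ α) ^ (3 * r) = (n : ℝ) ^ (r - 1) := by
  rw [← Real.rpow_mul_natCast (Nat.cast_nonneg n), ← Real.rpow_natCast, Nat.cast_sub hr]
  push_cast
  rw [hα]

lemma rpow_le_leastPrime {r : ℕ} (hr : 1 ≤ r) {α : ℝ} (hα : α * (3 * r) = r - 1) (n : ℕ) :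
    (n : ℝ) ^ α ≤ leastPrime r n := by
  refine le_of_pow_le_pow_left₀ (n := 3 * r) (by omega) (Nat.cast_nonneg _) ?_
  rw [rpow_pow_eq hr hα]
  exact_mod_cast (leastPrime_spec r n).2.2

/-- The candidate `A = ⌈n^α⌉ + 2` is at most `4 n^α`, and Bertrand's postulate doubles it. -/
lemma leastPrime_le_rpow {r : ℕ} (hr : 1 ≤ r) {α : ℝ} (hα : α * (3 * r) = r - 1) (hα0 : 0 ≤ α)
    {n : ℕ} (hn : 1 ≤ n) : (leastPrime r n : ℝ) ≤ 8 * (n : ℝ) ^ α := by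
  have h1 : (1 : ℝ) ≤ (n : ℝ) ^ α := Real.one_le_rpow (by exact_mod_cast hn) hα0
  have h2 : leastPrime r n ≤ 2 * (⌈(n : ℝ) ^ α⌉₊ + 2) := by
    refine leastPrime_le (by omega) ?_
    have h3 : ((n : ℝ) ^ α) ^ (3 * r) ≤ ((⌈(n : ℝ) ^ α⌉₊ + 2 : ℕ) : ℝ) ^ (3 * r) := by
      refine pow_le_pow_left₀ (by positivity) ?_ _
      push_cast
      linarith [Nat.le_ceil ((n : ℝ) ^ α)]
    rw [rpow_pow_eq hr hα] at h3
    exact_mod_cast h3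
  have h4 := Nat.ceil_lt_add_one (show 0 ≤ (n : ℝ) ^ α by positivity)
  have h5 : (leastPrime r n : ℝ) ≤ 2 * (⌈(n : ℝ) ^ α⌉₊ + 2) := by exact_mod_cast h2
  linarith

/-! ### The error of the quantum circuits -/

lemma abs_sin_pow_le {α : ℝ} {m p : ℕ} {n : ℝ} (hn : 1 ≤ n) (hm : 1 + α ≤ (m + 1) * α)
    (hp : n ^ α ≤ p) :
    |Real.sin (Real.pi / p)| ^ (m + 1) ≤ Real.pi ^ (m + 1) * n ^ (-(1 + α)) := by
  have hn0 : 0 < n := by linarith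
  have h0 : 0 < n ^ α := Real.rpow_pos_of_pos hn0 _
  have hp0 : (0 : ℝ) < p := h0.trans_le hp
  have h1 : |Real.sin (Real.pi / p)| ≤ Real.pi * n ^ (-α) := by
    refine Real.abs_sin_le_abs.trans ?_
    rw [abs_of_pos (by positivity), Real.rpow_neg hn0.le, ← div_eq_mul_inv]
    gcongr
  refine (pow_le_pow_left₀ (abs_nonneg _) h1 _).trans ?_
  rw [mul_pow, ← Real.rpow_mul_natCast hn0.le]
  gcongr
  push_cast
  linarith

lemma mul_exp_pow_le {α : ℝ} {p N : ℕ} (hN : 3 ≤ N) (hp0 : 0 < p)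
    (hp : (p : ℝ) ≤ 8 * ((N + 1 : ℕ) : ℝ) ^ α)
    (hsmall : ((N + 1 : ℕ) : ℝ) ^ (2 * α)
      * Real.exp (-(1 / 128) * ((N + 1 : ℕ) : ℝ) ^ (1 - 2 * α)) ≤ 1 / 8) :
    p * Real.exp (-2 / (p : ℝ) ^ 2) ^ (N / 2) ≤ ((N + 1 : ℕ) : ℝ) ^ (-α) := by
  have hn : (4 : ℝ) ≤ ((N + 1 : ℕ) : ℝ) := by exact_mod_cast (by omega : 4 ≤ N + 1)
  have hhalf : ((N + 1 : ℕ) : ℝ) ≤ 4 * ((N / 2 : ℕ) : ℝ) := by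
    exact_mod_cast (by omega : N + 1 ≤ 4 * (N / 2))
  set n : ℝ := ((N + 1 : ℕ) : ℝ) with hn'
  have hn0 : 0 < n := by linarith
  have hp0' : (0 : ℝ) < p := by exact_mod_cast hp0
  have h1 : Real.exp (-2 / (p : ℝ) ^ 2) ^ (N / 2) ≤ Real.exp (-(1 / 128) * n ^ (1 - 2 * α)) := by
    rw [← Real.exp_nat_mul, Real.exp_le_exp]
    have h2 : (p : ℝ) ^ 2 ≤ 64 * n ^ (2 * α) := by
      have : n ^ (2 * α) = (n ^ α) ^ 2 := by
        rw [mul_comm, ← Nat.cast_two, Real.rpow_mul_natCast hn0.le]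
      rw [this]
      have := pow_le_pow_left₀ hp0'.le hp 2
      rw [mul_pow] at this
      linarith
    have h3 : n ^ (1 - 2 * α) * n ^ (2 * α) = n := by
      rw [← Real.rpow_add hn0]
      simp
    have h4 : 0 < n ^ (1 - 2 * α) := Real.rpow_pos_of_pos hn0 _
    -- The exponent is `-2 (N/2) / p²` with `N/2 ≥ n/4` and `p² ≤ 64 n^(2α)`, whence `1/128`.
    rw [mul_div_assoc', div_le_iff₀ (by positivity)]
    nlinarith [mul_le_mul_of_nonneg_left h2 h4.le]
  have h5 : n ^ α = n ^ (-α) * n ^ (2 * α) := by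
    rw [← Real.rpow_add hn0]
    congr 1
    ring
  have h6 : 0 < n ^ (-α) := Real.rpow_pos_of_pos hn0 _
  calc p * Real.exp (-2 / (p : ℝ) ^ 2) ^ (N / 2)
      ≤ (8 * n ^ α) * Real.exp (-(1 / 128) * n ^ (1 - 2 * α)) := by gcongr
    _ = 8 * n ^ (-α) * (n ^ (2 * α) * Real.exp (-(1 / 128) * n ^ (1 - 2 * α))) := by
        rw [h5]; ring
    _ ≤ 8 * n ^ (-α) * (1 / 8) := by gcongr
    _ = n ^ (-α) := by ring

lemma eventually_tvDist_le {α : ℝ} (hα0 : 0 < α) (hα : α < 1 / 3) {m : ℕ}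
    (hm : 1 + α ≤ (m + 1) * α) {p : ℕ → ℕ} (hp3 : ∀ n, 3 ≤ p n) (hodd : ∀ n, Odd (p n))
    (hp₁ : ∀ n : ℕ, (n : ℝ) ^ α ≤ p n) (hp₂ : ∀ n : ℕ, 1 ≤ n → (p n : ℝ) ≤ 8 * (n : ℝ) ^ α) :
    ∃ K, ∀ᶠ N : ℕ in atTop, tvDist (circuit m (p (N + 1)) N).outDist (targetDist (p (N + 1)) N)
      ≤ 1 / 2 - 1 / Real.pi + K * ((N + 1 : ℕ) : ℝ) ^ (-α) := by
  have hcast : Tendsto (fun N : ℕ => ((N + 1 : ℕ) : ℝ)) atTop atTop :=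
    tendsto_natCast_atTop_atTop.comp (tendsto_add_atTop_nat 1)
  have ht : ∀ᶠ N : ℕ in atTop, 3 * Real.pi ^ (m + 1) * ((N + 1 : ℕ) : ℝ) ^ (-α) ≤ 1 / 2 := by
    have := ((tendsto_rpow_neg_atTop hα0).comp hcast).const_mul (3 * Real.pi ^ (m + 1))
    rw [mul_zero] at this
    exact this.eventually_le_const (by norm_num)
  have hs : ∀ᶠ N : ℕ in atTop, ((N + 1 : ℕ) : ℝ) ^ (2 * α)
      * Real.exp (-(1 / 128) * ((N + 1 : ℕ) : ℝ) ^ (1 - 2 * α)) ≤ 1 / 8 :=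
    ((tendsto_rpow_mul_exp_neg_rpow (by linarith) (by norm_num)).comp hcast).eventually_le_const
      (by norm_num)
  -- The three parts come from the orthonormalization (`6t` with `t = 3 π^(m+1) n^(-α)`), from `p`
  -- and the leftover vertices, and from equidistribution.
  refine ⟨18 * Real.pi ^ (m + 1) + (1 / 2 + Real.pi * m) + 1, ?_⟩
  filter_upwards [ht, hs, eventually_ge_atTop 3] with N ht hs hN
  have hn : (1 : ℝ) ≤ ((N + 1 : ℕ) : ℝ) := by exact_mod_cast (by omega : 1 ≤ N + 1)
  have hNn : (N : ℝ) ≤ ((N + 1 : ℕ) : ℝ) := by exact_mod_cast (by omega : N ≤ N + 1)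
  have h1 := abs_sin_pow_le hn hm (hp₁ (N + 1))
  have h2 := mul_exp_pow_le hN (by have := hp3 (N + 1); omega) (hp₂ (N + 1) (by omega)) hs
  have hp₁' := hp₁ (N + 1)
  set n : ℝ := ((N + 1 : ℕ) : ℝ) with hn'
  have hn0 : 0 < n := by linarith
  set q := p (N + 1) with hq
  set ρ := |Real.sin (Real.pi / q)| ^ (m + 1) with hρ
  set t := 3 * Real.pi ^ (m + 1) * n ^ (-α) with ht'
  have hρ0 : 0 ≤ ρ := by positivity
  have h3 : n * (3 * ρ) ≤ t := by
    have : n * n ^ (-(1 + α)) = n ^ (-α) := by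
      nth_rewrite 1 [← Real.rpow_one n]
      rw [← Real.rpow_add hn0]
      congr 1
      ring
    calc n * (3 * ρ) ≤ n * (3 * (Real.pi ^ (m + 1) * n ^ (-(1 + α)))) := by gcongr
      _ = 3 * Real.pi ^ (m + 1) * (n * n ^ (-(1 + α))) := by ring
      _ = t := by rw [this]
  have h4 : N * (3 * ρ) ≤ t := (mul_le_mul_of_nonneg_right hNn (by positivity)).trans h3
  have h5 : ρ ≤ 1 / 2 := by nlinarith
  have h6 : Real.exp (N * (3 * ρ)) - 1 ≤ 2 * t := by
    have h0 : 0 ≤ N * (3 * ρ) := by positivity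
    have := Real.abs_exp_sub_one_le (x := N * (3 * ρ)) (by rw [abs_of_nonneg h0]; linarith)
    rw [abs_of_nonneg h0] at this
    linarith [le_abs_self (Real.exp (N * (3 * ρ)) - 1)]
  have h7 := tvDist_circuit_le (by have := hp3 (N + 1); omega) (hodd (N + 1)) h5 h6
  have h8 : (1 / 2 + Real.pi * m) / q ≤ (1 / 2 + Real.pi * m) * n ^ (-α) := by
    rw [Real.rpow_neg hn0.le, ← div_eq_mul_inv]
    have : 0 < n ^ α := Real.rpow_pos_of_pos hn0 _
    gcongr
  have ht0 : 0 ≤ t := by positivity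
  have h9 : 0 < n ^ (-α) := Real.rpow_pos_of_pos hn0 _
  have h10 : 2 * (2 * t) + (2 * t) ^ 2 ≤ 6 * t := by nlinarith
  have h11 : 6 * t = 18 * Real.pi ^ (m + 1) * n ^ (-α) := by rw [ht']; ring
  refine h7.trans ?_
  rw [add_mul, add_mul, one_mul]
  linarith

/-- Finitely many exceptions are absorbed into the constant, as `n ^ (-α)` is never zero. -/
lemma exists_tvDist_le {α : ℝ} {m : ℕ} {p : ℕ → ℕ}
    (h : ∃ K, ∀ᶠ N : ℕ in atTop,
      tvDist (circuit m (p (N + 1)) N).outDist (targetDist (p (N + 1)) N)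
        ≤ 1 / 2 - 1 / Real.pi + K * ((N + 1 : ℕ) : ℝ) ^ (-α)) :
    ∃ K, ∀ N : ℕ, tvDist (circuit m (p (N + 1)) N).outDist (targetDist (p (N + 1)) N)
      ≤ 1 / 2 - 1 / Real.pi + K * ((N + 1 : ℕ) : ℝ) ^ (-α) := by
  obtain ⟨K, hK⟩ := h
  have h0 : ∀ N : ℕ, 0 < ((N + 1 : ℕ) : ℝ) ^ (-α) := fun N => by positivity
  obtain ⟨C, _, hC⟩ := bound_of_isBigO_nat_atTop
    (f := fun N : ℕ => max (tvDist (circuit m (p (N + 1)) N).outDist (targetDist (p (N + 1)) N)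
      - (1 / 2 - 1 / Real.pi)) 0) (g'' := fun N : ℕ => ((N + 1 : ℕ) : ℝ) ^ (-α))
    (IsBigO.of_bound (max K 0) (by
      filter_upwards [hK] with N hN
      rw [Real.norm_of_nonneg (le_max_right _ _), Real.norm_of_nonneg (h0 N).le]
      refine max_le ?_ (mul_nonneg (le_max_right _ _) (h0 N).le)
      have := mul_le_mul_of_nonneg_right (le_max_left K 0) (h0 N).le
      linarith))
  refine ⟨C, fun N => ?_⟩
  have := hC (h0 N).ne'
  rw [Real.norm_of_nonneg (le_max_right _ _), Real.norm_of_nonneg (h0 N).le] at this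
  linarith [(le_max_left _ _).trans this]

end Sampler

/-! ### Choice of the exponent and the block length -/

theorem mainTheorem1 (δ : ℝ) (hδ : δ < 1) :
    ∃ (α : ℝ) (p : ℕ → ℕ), 0 < α ∧ δ / 3 < α ∧ α < 1 / 3 ∧ (∀ n, (p n).Prime) ∧
      (fun n : ℕ => (p n : ℝ)) =Θ[atTop] (fun n : ℕ => (n : ℝ) ^ α) ∧
      -- the quantum circuits; `n = N + 1` is the number of qubits
      (∃ C : ∀ n, QCircuit n, IsUniformFamily C ∧ IsConstantDepthFamily C ∧
        ∃ K : ℝ, ∀ N : ℕ,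
          tvDist (C (N + 1)).outDist (targetDist (p (N + 1)) N) ≤
            1 / 2 - 1 / Real.pi + K * ((N + 1 : ℕ) : ℝ) ^ (-α)) ∧
      -- the classical circuits; `n = N + 1` is the number of output bits
      (∃ c : ℝ, 0 < c ∧ ∀ g : ℕ → ℝ,
        Tendsto (fun n : ℕ => g n * Real.log n) atTop atTop →
        ∀ᶠ N : ℕ in atTop, ∀ l : ℕ,
          (l : ℝ) ≤ ((N + 1 : ℕ) : ℝ) + ((N + 1 : ℕ) : ℝ) ^ δ →
          ∀ C : BoolCircuit l (N + 1),
            tvDist C.outDist (targetDist (p (N + 1)) N) ≤ 1 / 2 - g (N + 1) →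
            c * Real.log (Real.log ((N + 1 : ℕ) : ℝ)) ≤ (C.depth : ℝ)) := by
  -- The condition `δ r < r - 1` says `δ/3 < (r-1)/(3r)`.
  obtain ⟨r, hr2, hrδ⟩ : ∃ r : ℕ, 2 ≤ r ∧ δ * r < r - 1 := by
    obtain ⟨s, hs⟩ := exists_nat_gt (1 / (1 - δ))
    refine ⟨s + 2, by omega, ?_⟩
    rw [div_lt_iff₀ (by linarith)] at hs
    push_cast
    nlinarith
  have hr1 : 1 ≤ r := by omega
  have hr : (2 : ℝ) ≤ r := by exact_mod_cast hr2
  set α : ℝ := (r - 1) / (3 * r) with hα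
  have hαr : α * (3 * r) = r - 1 := div_mul_cancel₀ _ (by positivity)
  have hα0 : 0 < α := div_pos (by linarith) (by positivity)
  have hαδ : δ / 3 < α := by
    rw [hα, lt_div_iff₀ (by positivity)]
    linarith
  have hα3 : α < 1 / 3 := by
    rw [hα, div_lt_iff₀ (by positivity)]
    linarith
  -- Blocks of length `m + 1 ≥ 1 + 1/α` make the overlap of order `n^(-1-α)`.
  obtain ⟨m, hm⟩ := exists_nat_ge (1 / α)
  have hm' : 1 + α ≤ (m + 1) * α := by
    rw [div_le_iff₀ hα0] at hm
    linarith
  set p := Sampler.leastPrime r with hp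
  have hp₁ : ∀ n : ℕ, (n : ℝ) ^ α ≤ p n := Sampler.rpow_le_leastPrime hr1 hαr
  have hp₂ : ∀ n : ℕ, 1 ≤ n → (p n : ℝ) ≤ 8 * (n : ℝ) ^ α := fun n hn =>
    Sampler.leastPrime_le_rpow hr1 hαr hα0.le hn
  have hp₂' : ∀ᶠ n : ℕ in atTop, (p n : ℝ) ≤ 8 * (n : ℝ) ^ α :=
    (eventually_ge_atTop 1).mono hp₂
  have hprime : ∀ n, (p n).Prime := fun n => (Sampler.leastPrime_spec r n).1
  have hp3 : ∀ n, 3 ≤ p n := fun n => (Sampler.leastPrime_spec r n).2.1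
  refine ⟨α, p, hα0, hαδ, hα3, hprime, ⟨?_, ?_⟩, ⟨Sampler.family m p,
    Sampler.isUniformFamily m (Sampler.computes_leastPrime r),
    Sampler.isConstantDepthFamily m hp3, ?_⟩, ?_⟩
  · refine IsBigO.of_bound 8 (hp₂'.mono fun n hn => ?_)
    rwa [Real.norm_of_nonneg (by positivity), Real.norm_of_nonneg (by positivity)]
  · refine IsBigO.of_bound 1 (Eventually.of_forall fun n => ?_)
    rw [Real.norm_of_nonneg (by positivity), Real.norm_of_nonneg (by positivity), one_mul]
    exact hp₁ n
  · exact Sampler.exists_tvDist_le (Sampler.eventually_tvDist_le hα0 hα3 hm' hp3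
      (Sampler.odd_leastPrime r) hp₁ hp₂)
  · exact exists_depth_lower_bound hδ hα0 hα3 p hprime (Sampler.odd_leastPrime r) one_pos
      (by norm_num : (0 : ℝ) < 8)
      (Eventually.of_forall fun n => by rw [one_mul]; exact hp₁ n) hp₂'
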